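/- Let $n\ge 1$, let $\mathcal G=sp(2n,\mathbb C)$ be spanned by $E_{i,j}-E_{n+j,n+i}$, $E_{i,n+j}+E_{j,n+i}$, $E_{n+i,j}+E_{n+j,i}$ ($1\le i,j\le n$), with Cartan subalgebra $H=\sum_{i=1}^n\mathbb C(E_{i,i}-E_{n+i,n+i})$, positive root vectors $E_{i,j}-E_{n+j,n+i}$, $E_{i,n+j}+E_{j,n+i}$ ($i<j$) and $E_{i,n+i}$, and fundamental weights $\lambda_1,\dots,\lambda_n$ (put $\lambda_0=0$). Let $\{S,T\}$ be a partition of $\{1,\dots,2n\}$ into two nonempty parts, and let $\mathcal G$ act on $\mathcal A=\mathbb C[x_1,\dots,x_{2n}]$ by $$E_{i,j}|_{\mathcal A}=\begin{cases}x_i\partial_{x_j}& i,j\in S,\\ -x_ix_j& i\in S,\ j\in T,\\ \partial_{x_i}\partial_{x_j}& i\in T,\ j\in S,\\ -x_j\partial_{x_i}-\delta_{i,j}& i,j\in T.\end{cases}$$ For $k\in\mathbb Z$ let $\mathcal A_{\langle k\rangle}$ be the span of the monomials $x^\alpha$ with $\sum_{i\in S}\alpha_i-\sum_{r\in T}\alpha_r=k$;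 it is a submodule. Put $S_1=\{i\le n: i,n+i\in S\}$, $T_1=\{i\le n: i,n+i\in T\}$, $T_2=\{i\le n: i\in T,\ n+i\in S\}$. A highest weight module of highest weight $\mu$ is a module generated by a nonzero $H$-weight vector of weight $\mu$ killed by all positive root vectors (a highest weight vector). **I.** Suppose $S_1\cup T_1\neq\emptyset$. Then every $\mathcal A_{\langle k\rangle}$ ($k\in\mathbb Z$) is irreducible. a) If $S_1\ne\emptyset$ and $T_1\neq\emptyset$, no $\mathcal A_{\langle k\rangle}$ is a highest weight module, for any choice of positive roots with respect to $H$. b) Suppose $S_1=\emptyset$ or $T_1=\emptyset$. Then, up to a symmetry, $T=\{1,\dots,t\}$ for some $1\le t\le n-1$: there are a permutation of the variables up to signs and an automorphism of $\mathcal G$ preserving $H$ that together carry the given representation to the one with $T=\{1,\dots,t\}$, taking $\mathcal A_{\langle k\rangle}$ to $\mathcal A_{\langle k\rangle}$ for all $k$ if $T_1=\emptyset$, and to $\mathcal A_{\langle -k\rangle}$ for all $k$ if $S_1=\emptyset$. If $T=\{1,\dots,t\}$ with $1\le t\le n-1$, then $\mathcal A_{\langle k\rangle}$ is an irreducible highest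 weight module with highest weight vector $x_{t+1}^k$ and highest weight $-(k+1)\lambda_t+k\lambda_{t+1}$ if $k\ge0$, and with highest weight vector $x_t^{-k}$ and highest weight $-k\lambda_{t-1}+(k-1)\lambda_t$ if $k<0$. **II.** Suppose $S_1\cup T_1=\emptyset$. Then, up to a symmetry as in b) taking $\mathcal A_{\langle k\rangle}$ to $\mathcal A_{\langle k\rangle}$ for all $k$, $T=\{1,\dots,n\}$, i.e. $T_2=\{1,\dots,n\}$. In this case: e) For $k>0$, $\mathcal A_{\langle k\rangle}$ and $\mathcal A_{\langle -k\rangle}$ are irreducible highest weight modules of highest weight $k\lambda_{n-1}-(k+1)\lambda_n$, with highest weight vectors $x_{2n}^k$ and $x_n^k$ respectively. f) $U(\mathcal G).1$ is an irreducible highest weight module of highest weight $-\lambda_n$, with highest weight vector $1$. If $n\ge2$ and $u=x_{n-1}x_{2n}-x_nx_{2n-1}$, then $\mathcal A_{\langle0\rangle}=U(\mathcal G).1\oplus U(\mathcal G).u$, and $U(\mathcal G).u$ is an irreducible highest weight module of highest weight $\lambda_{n-2}-2\lambda_n$ (that is, $-2\lambda_2$ for $n=2$), with highest weight vector $u$.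 If $n=1$, then $\mathcal A_{\langle 0\rangle}=U(\mathcal G).1$. Moreover consider the polynomials $$\sum_{r_1+\cdots+r_n=\frac12(k_1+\cdots+k_n)}(r_1+\cdots+r_n)!\prod_{t=1}^n\binom{k_t}{r_t}x_t^{k_t-r_t}x_{n+t}^{r_t}\prod_{1\le i<j\le n}(x_ix_{n+j}-x_jx_{n+i})^{k_{i,j}},$$ with $k_t,k_{i,j}\in\mathbb N$, $\sum_t k_t$ even, $k_{i,j}k_t=0$ for $i<j<t$, and $k_{i,j}k_{i_1,j_1}=0$ for $i<i_1$ and $j>j_1$. Those with $\sum k_{i,j}$ even form a basis of $U(\mathcal G).1$, and, if $n\ge 2$, those with $\sum k_{i,j}$ odd form a basis of $U(\mathcal G).u$. -/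

import Mathlib

open MvPolynomial Matrix

attribute [local instance 100] LieRing.ofAssociativeRing

noncomputable section

namespace NoncanonicalSp

/-- Indices `1, …, 2n`: `Sum.inl i` is the index `i + 1` and `Sum.inr i` is the index
`n + i + 1`, for `i : Fin n`. -/
abbrev Idx (n : ℕ) : Type := Fin n ⊕ Fin n

/-- The polynomial algebra `ℂ[x_1, …, x_{2n}]`. -/
abbrev Poly (n : ℕ) : Type := MvPolynomial (Idx n) ℂ

/-- The symplectic Lie algebra `sp(2n, ℂ)`, as `2n × 2n` matrices. -/
abbrev G (n : ℕ) : LieSubalgebra ℂ (Matrix (Idx n) (Idx n) ℂ) :=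
  LieAlgebra.Symplectic.sp (Fin n) ℂ

variable {n : ℕ}

/-! ### The representation

In the canonical representation `E_{p,q}` acts by `x_p ∂_{x_q}`.  After the swap
`-x_i ↔ ∂_{x_i}` for `i ∈ T`, the left factor becomes `∂_{x_p}` if `p ∈ T`, and the right
factor becomes `-x_q` if `q ∈ T`.  The complement of `T` is the other part `S` of the
partition. -/

/-- `x_p` if `p ∈ S`, and `∂_{x_p}` if `p ∈ T`. -/
def leftOp (T : Finset (Idx n)) (p : Idx n) : Module.End ℂ (Poly n) :=
  if p ∈ T then (pderiv p).toLinearMap else LinearMap.mulLeft ℂ (X p : Poly n)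

/-- `∂_{x_q}` if `q ∈ S`, and `-x_q` if `q ∈ T`. -/
def rightOp (T : Finset (Idx n)) (q : Idx n) : Module.End ℂ (Poly n) :=
  if q ∈ T then -LinearMap.mulLeft ℂ (X q : Poly n) else (pderiv q).toLinearMap

/-- The operator by which `E_{p,q}` acts. -/
def unitOp (T : Finset (Idx n)) (p q : Idx n) : Module.End ℂ (Poly n) :=
  leftOp T p * rightOp T q

theorem unitOp_apply (T : Finset (Idx n)) (p q : Idx n) (f : Poly n) :
    unitOp T p q f =
      if p ∈ T then
        if q ∈ T then -(X q * pderiv p f) - (if p = q then f else 0) else pderiv p (pderiv q f)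
      else if q ∈ T then -(X p * X q * f) else X p * pderiv q f := by
  by_cases hp : p ∈ T <;> by_cases hq : q ∈ T <;>
    simp [unitOp, leftOp, rightOp, hp, hq, Derivation.leibniz, pderiv_X, Pi.single_apply, mul_assoc]
  by_cases h : p = q
  · subst h; simp; ring
  · simp [h, Ne.symm h]

theorem pderiv_comm' (p q : Idx n) (f : Poly n) :
    pderiv p (pderiv q f) = pderiv q (pderiv p f) := by
  have h : ⁅(pderiv p : Derivation ℂ (Poly n) (Poly n)), (pderiv q : Derivation ℂ (Poly n) (Poly n))⁆ = 0 := by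
    apply MvPolynomial.derivation_ext
    intro i
    simp only [Derivation.commutator_apply, pderiv_X, Pi.single_apply]
    split_ifs <;> simp
  have := congrArg (fun D : Derivation ℂ (Poly n) (Poly n) => D f) h
  simpa [Derivation.commutator_apply, sub_eq_zero] using this

theorem leftOp_comm (T : Finset (Idx n)) (p q : Idx n) :
    leftOp T p * leftOp T q = leftOp T q * leftOp T p := by
  apply LinearMap.ext
  intro f
  by_cases hp : p ∈ T <;> by_cases hq : q ∈ T <;> by_cases h : p = q <;>
    simp_all [leftOp, Derivation.leibniz, pderiv_X]
  · exact pderiv_comm' p q f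
  · ring

theorem rightOp_comm (T : Finset (Idx n)) (p q : Idx n) :
    rightOp T p * rightOp T q = rightOp T q * rightOp T p := by
  apply LinearMap.ext
  intro f
  by_cases hp : p ∈ T <;> by_cases hq : q ∈ T <;> by_cases h : p = q <;>
    simp_all [rightOp, Derivation.leibniz, pderiv_X]
  · ring
  · exact pderiv_comm' p q f

theorem rightOp_leftOp (T : Finset (Idx n)) (q p : Idx n) :
    rightOp T q * leftOp T p = leftOp T p * rightOp T q + if q = p then 1 else 0 := by
  apply LinearMap.ext
  intro f
  by_cases hp : p ∈ T <;> by_cases hq : q ∈ T <;> by_cases h : q = p <;>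
    simp_all [leftOp, rightOp, Derivation.leibniz, pderiv_X]
  · exact pderiv_comm' q p f
  · ring

theorem unitOp_lie (T : Finset (Idx n)) (p q r s : Idx n) :
    unitOp T p q * unitOp T r s - unitOp T r s * unitOp T p q =
      (if q = r then unitOp T p s else 0) - (if s = p then unitOp T r q else 0) := by
  have h1 : unitOp T p q * unitOp T r s =
      leftOp T p * leftOp T r * (rightOp T q * rightOp T s)
        + if q = r then unitOp T p s else 0 := by
    have : unitOp T p q * unitOp T r s
        = leftOp T p * (rightOp T q * leftOp T r) * rightOp T s := by
      simp only [unitOp, mul_assoc]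
    rw [this, rightOp_leftOp]
    split_ifs <;> simp [unitOp, mul_add, add_mul, mul_assoc]
  have h2 : unitOp T r s * unitOp T p q =
      leftOp T r * leftOp T p * (rightOp T s * rightOp T q)
        + if s = p then unitOp T r q else 0 := by
    have : unitOp T r s * unitOp T p q
        = leftOp T r * (rightOp T s * leftOp T p) * rightOp T q := by
      simp only [unitOp, mul_assoc]
    rw [this, rightOp_leftOp]
    split_ifs <;> simp [unitOp, mul_add, add_mul, mul_assoc]
  rw [h1, h2, leftOp_comm T r p, rightOp_comm T s q]
  abel

/-- The linear map with `E_{p,q} ↦ unitOp T p q`. -/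
def glMap (T : Finset (Idx n)) :
    Matrix (Idx n) (Idx n) ℂ →ₗ[ℂ] Module.End ℂ (Poly n) where
  toFun A := ∑ p, ∑ q, A p q • unitOp T p q
  map_add' A B := by simp [add_smul, Finset.sum_add_distrib]
  map_smul' c A := by simp [mul_smul, Finset.smul_sum]

theorem glMap_single (T : Finset (Idx n)) (p q : Idx n) (c : ℂ) :
    glMap T (Matrix.single p q c) = c • unitOp T p q := by
  simp only [glMap, LinearMap.coe_mk, AddHom.coe_mk]
  rw [Finset.sum_eq_single p, Finset.sum_eq_single q]
  · simp
  · intro b _ hb; simp [Ne.symm hb]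
  · simp
  · intro b _ hb; simp [Ne.symm hb]
  · simp

/-- The representation of `gl(2n, ℂ)` on polynomials with `E_{p,q}` acting by `unitOp T p q`. -/
def glRep (T : Finset (Idx n)) :
    Matrix (Idx n) (Idx n) ℂ →ₗ⁅ℂ⁆ Module.End ℂ (Poly n) where
  toLinearMap := glMap T
  map_lie' := by
    intro A B
    change glMap T ⁅A, B⁆ = ⁅glMap T A, glMap T B⁆
    induction A using Matrix.induction_on' with
    | h_zero => simp
    | h_add A A' h h' => simp [h, h']
    | h_std_basis p q a =>
      induction B using Matrix.induction_on' with
      | h_zero => simp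
      | h_add B B' h h' => simp [h, h']
      | h_std_basis r s b =>
        have key := unitOp_lie T p q r s
        simp only [LieRing.of_associative_ring_bracket, glMap_single, map_sub,
          smul_mul_smul_comm]
        rw [mul_comm b a]
        refine Eq.trans ?_ (smul_sub (a * b) (unitOp T p q * unitOp T r s)
          (unitOp T r s * unitOp T p q))
        rw [key]
        by_cases h1 : q = r <;> by_cases h2 : s = p <;>
          simp_all [glMap_single, mul_comm, smul_sub]

/-- The noncanonical polynomial representation of `sp(2n, ℂ)` attached to `T`. -/
def spRep (T : Finset (Idx n)) : G n →ₗ⁅ℂ⁆ Module.End ℂ (Poly n) :=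
  (glRep T).comp (G n).incl

/-- The space of polynomials, regarded as the `sp(2n, ℂ)`-module attached to `T`. -/
def Osc (T : Finset (Idx n)) : Type := (fun _ => Poly n) T

instance (T : Finset (Idx n)) : AddCommGroup (Osc T) := inferInstanceAs (AddCommGroup (Poly n))

instance (T : Finset (Idx n)) : Module ℂ (Osc T) := inferInstanceAs (Module ℂ (Poly n))

instance (T : Finset (Idx n)) : LieRingModule (G n) (Osc T) :=
  LieRingModule.compLieHom (Poly n) (spRep T)

instance (T : Finset (Idx n)) : LieModule ℂ (G n) (Osc T) :=
  LieModule.compLieHom (Poly n) (spRep T)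

/-- A polynomial, as an element of the module attached to `T`. -/
def toOsc (T : Finset (Idx n)) : Poly n ≃ₗ[ℂ] Osc T := LinearEquiv.refl ℂ (Poly n)

theorem lie_toOsc (T : Finset (Idx n)) (A : G n) (f : Poly n) :
    ⁅A, toOsc T f⁆ = toOsc T (spRep T A f) := rfl

/-! ### The graded pieces -/

/-- `∑_{i ∈ S} α_i - ∑_{r ∈ T} α_r`. -/
def tdeg (T : Finset (Idx n)) (α : Idx n →₀ ℕ) : ℤ :=
  ∑ p ∈ Tᶜ, (α p : ℤ) - ∑ p ∈ T, (α p : ℤ)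

/-- The span of the monomials `x^α` with `∑_{i ∈ S} α_i - ∑_{r ∈ T} α_r = k`. -/
def gradedSpan (T : Finset (Idx n)) (k : ℤ) : Submodule ℂ (Poly n) :=
  Submodule.span ℂ {f | ∃ α : Idx n →₀ ℕ, tdeg T α = k ∧ f = monomial α 1}

theorem tdeg_add_single (T : Finset (Idx n)) (α : Idx n →₀ ℕ) (p : Idx n) :
    tdeg T (α + Finsupp.single p 1) = tdeg T α + if p ∈ T then -1 else 1 := by
  by_cases hp : p ∈ T <;>
    simp [tdeg, Finset.sum_add_distrib, Finsupp.single_apply, hp] <;> ring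

theorem X_mul_mem (T : Finset (Idx n)) (k : ℤ) (p : Idx n) (f : Poly n)
    (hf : f ∈ gradedSpan T k) :
    X p * f ∈ gradedSpan T (k + if p ∈ T then -1 else 1) := by
  induction hf using Submodule.span_induction with
  | mem f hf =>
    obtain ⟨α, hα, rfl⟩ := hf
    refine Submodule.subset_span ⟨α + Finsupp.single p 1, ?_, ?_⟩
    · rw [tdeg_add_single, hα]
    · rw [mul_comm, X, monomial_mul, one_mul]
  | zero => simp
  | add f g _ _ hf hg => rw [mul_add]; exact add_mem hf hg
  | smul c f _ hf => rw [mul_smul_comm]; exact Submodule.smul_mem _ c hf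

theorem pderiv_mem (T : Finset (Idx n)) (k : ℤ) (p : Idx n) (f : Poly n)
    (hf : f ∈ gradedSpan T k) :
    pderiv p f ∈ gradedSpan T (k - if p ∈ T then -1 else 1) := by
  induction hf using Submodule.span_induction with
  | mem f hf =>
    obtain ⟨α, hα, rfl⟩ := hf
    rw [pderiv_monomial]
    by_cases h : α p = 0
    · simp [h]
    · have hα' : α - Finsupp.single p 1 + Finsupp.single p 1 = α :=
        tsub_add_cancel_of_le (Finsupp.single_le_iff.mpr (Nat.one_le_iff_ne_zero.mpr h))
      have hd := tdeg_add_single T (α - Finsupp.single p 1) p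
      rw [hα', hα] at hd
      have : (monomial (α - Finsupp.single p 1)) ((1 : ℂ) * (α p : ℂ))
          = (α p : ℂ) • monomial (α - Finsupp.single p 1) (1 : ℂ) := by
        rw [smul_monomial, smul_eq_mul, mul_comm]
      rw [this]
      refine Submodule.smul_mem _ _ (Submodule.subset_span ⟨_, ?_, rfl⟩)
      rw [hd]; ring
  | zero => simp
  | add f g _ _ hf hg => rw [map_add]; exact add_mem hf hg
  | smul c f _ hf => rw [Derivation.map_smul]; exact Submodule.smul_mem _ c hf

theorem leftOp_mem (T : Finset (Idx n)) (k : ℤ) (p : Idx n) (f : Poly n)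
    (hf : f ∈ gradedSpan T k) : leftOp T p f ∈ gradedSpan T (k + 1) := by
  by_cases hp : p ∈ T
  · simpa [leftOp, hp] using pderiv_mem T k p f hf
  · simpa [leftOp, hp] using X_mul_mem T k p f hf

theorem rightOp_mem (T : Finset (Idx n)) (k : ℤ) (p : Idx n) (f : Poly n)
    (hf : f ∈ gradedSpan T k) : rightOp T p f ∈ gradedSpan T (k - 1) := by
  by_cases hp : p ∈ T
  · simpa [rightOp, hp, sub_eq_add_neg] using X_mul_mem T k p f hf
  · simpa [rightOp, hp] using pderiv_mem T k p f hf

theorem spRep_mem (T : Finset (Idx n)) (k : ℤ) (A : G n) (f : Poly n)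
    (hf : f ∈ gradedSpan T k) : spRep T A f ∈ gradedSpan T k := by
  change (∑ p, ∑ q, A.1 p q • unitOp T p q) f ∈ _
  simp only [LinearMap.sum_apply, LinearMap.smul_apply]
  refine Submodule.sum_mem _ fun p _ => Submodule.sum_mem _ fun q _ => Submodule.smul_mem _ _ ?_
  have := leftOp_mem T _ p _ (rightOp_mem T k q f hf)
  rwa [sub_add_cancel] at this

/-- The submodule `A_⟨k⟩`. -/
def piece (T : Finset (Idx n)) (k : ℤ) : LieSubmodule ℂ (G n) (Osc T) where
  toSubmodule := (gradedSpan T k).map (toOsc T).toLinearMap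
  lie_mem := by
    rintro A _ ⟨f, hf, rfl⟩
    exact ⟨spRep T A f, spRep_mem T k A f hf, rfl⟩

/-- `U(G).f`. -/
def generated (T : Finset (Idx n)) (f : Poly n) : LieSubmodule ℂ (G n) (Osc T) :=
  LieSubmodule.lieSpan ℂ (G n) {toOsc T f}

/-! ### Cartan subalgebra, roots and weights -/

/-- The involution `i ↔ n + i` of the indices. -/
def bar : Idx n → Idx n := Sum.swap

/-- `1` on `1, …, n` and `-1` on `n + 1, …, 2n`. -/
def sgn : Idx n → ℂ := Sum.elim (fun _ => 1) (fun _ => -1)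

/-- `E_{p,q} - sgn p * sgn q * E_{bar q, bar p}`, that is `E_{i,j} - E_{n+j,n+i}`,
`E_{i,n+j} + E_{j,n+i}` and `E_{n+i,j} + E_{n+j,i}` for `p, q` of the various types. -/
def elt (p q : Idx n) : G n :=
  ⟨Matrix.single p q 1 - (sgn p * sgn q) • Matrix.single (bar q) (bar p) 1, by
    rw [G, LieAlgebra.Symplectic.sp, mem_skewAdjointMatricesLieSubalgebra,
      mem_skewAdjointMatricesSubmodule]
    change _ᵀ * Matrix.J (Fin n) ℂ = Matrix.J (Fin n) ℂ * (-_)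
    ext a b
    rcases p with p | p <;> rcases q with q | q <;> rcases a with a | a <;> rcases b with b | b <;>
      simp [Matrix.mul_apply, Matrix.J, sgn, bar, Matrix.single_apply, Matrix.one_apply,
        Fintype.sum_sum_type]
    all_goals
      simp only [ite_and, Finset.sum_ite_eq, Finset.mem_univ, if_true, Finset.sum_ite_irrel,
        Finset.sum_const_zero]
    all_goals grind⟩

/-- The Cartan subalgebra `H`, spanned by the `E_{i,i} - E_{n+i,n+i}`. -/
def cartan (n : ℕ) : Submodule ℂ (G n) :=
  Submodule.span ℂ (Set.range fun i : Fin n => elt (Sum.inl i) (Sum.inl i))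

/-- The linear function on `H` reading off the `i`-th diagonal entry. -/
def eps (i : Fin n) : Module.Dual ℂ (cartan n) where
  toFun h := h.1.1 (Sum.inl i) (Sum.inl i)
  map_add' _ _ := rfl
  map_smul' _ _ := rfl

theorem eps_apply (i : Fin n) (h : cartan n) : eps i h = h.1.1 (Sum.inl i) (Sum.inl i) := rfl

/-- The fundamental weight `λ_m = ε_1 + ⋯ + ε_m`, with `λ_0 = 0`. -/
def fundWeight (n m : ℕ) : Module.Dual ℂ (cartan n) :=
  ∑ i : Fin n with i.val < m, eps i

/-- The simple coroots `h_j = D_j - D_{j+1}` for `j < n` and `h_n = D_n`, where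
`D_i = E_{i,i} - E_{n+i,n+i}`. -/
def simpleCoroot (j : Fin n) : cartan n :=
  if h : j.val + 1 < n then
    ⟨elt (Sum.inl j) (Sum.inl j) - elt (Sum.inl ⟨j.val + 1, h⟩) (Sum.inl ⟨j.val + 1, h⟩),
      sub_mem (Submodule.subset_span ⟨j, rfl⟩) (Submodule.subset_span ⟨_, rfl⟩)⟩
  else ⟨elt (Sum.inl j) (Sum.inl j), Submodule.subset_span ⟨j, rfl⟩⟩

theorem fundWeight_simpleCoroot (i j : Fin n) :
    fundWeight n (i.val + 1) (simpleCoroot j) = if i = j then 1 else 0 := by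
  have key : ∀ m : ℕ, fundWeight n m (simpleCoroot j) =
      (if j.val < m then 1 else 0) - (if j.val + 1 < n ∧ j.val + 1 < m then 1 else 0) := by
    intro m
    simp only [fundWeight, LinearMap.sum_apply, eps_apply]
    by_cases h : j.val + 1 < n
    · simp [simpleCoroot, h, elt, bar, Matrix.single_apply, sgn]
    · simp [simpleCoroot, h, elt, bar, Matrix.single_apply, sgn]
  rw [key]
  have := i.2
  by_cases hij : i = j
  · subst hij; simp
  · have : i.val ≠ j.val := fun h => hij (Fin.ext h)
    split_ifs <;> first | omega | simp

/-- A real coweight, given by its values `c_i` on the `ε_i`, is regular if no root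
`±ε_i ± ε_j`, `±2ε_i` vanishes on it.  Every positive system is the set of roots that are
positive on some regular coweight. -/
def IsRegularCoweight (c : Fin n → ℝ) : Prop :=
  (∀ i, c i ≠ 0) ∧ ∀ i j, i ≠ j → c i ≠ c j ∧ c i ≠ -c j

/-- The value of the coweight on the weight of `E_{p,·}`: `c_i` on `i` and `-c_i` on `n + i`. -/
def coweightExt (c : Fin n → ℝ) : Idx n → ℝ := Sum.elim c (fun i => -c i)

/-- The coweight `(n, n-1, …, 1)`.  Its positive root vectors are `E_{i,j} - E_{n+j,n+i}` and
`E_{i,n+j} + E_{j,n+i}` for `i < j`, and `E_{i,n+i}`. -/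
def stdCoweight (n : ℕ) : Fin n → ℝ := fun i => (n : ℝ) - (i.val : ℝ)

/-- `v` is a singular vector of weight `μ` for the positive system defined by `c`. -/
def IsSingular (c : Fin n → ℝ) {T : Finset (Idx n)} (μ : Module.Dual ℂ (cartan n))
    (v : Osc T) : Prop :=
  v ≠ 0 ∧ (∀ h : cartan n, ⁅(h : G n), v⁆ = μ h • v) ∧
    ∀ p q : Idx n, coweightExt c q < coweightExt c p → ⁅elt p q, v⁆ = 0

/-- `N` is a highest weight module with highest weight `μ` and highest weight vector `v`. -/
def IsHighestWeightModule (c : Fin n → ℝ) {T : Finset (Idx n)}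
    (N : LieSubmodule ℂ (G n) (Osc T)) (μ : Module.Dual ℂ (cartan n)) (v : Poly n) : Prop :=
  IsSingular c μ (toOsc T v) ∧ generated T v = N

/-- `N` is of highest weight type: it is a highest weight module for some choice of positive
roots relative to `H`. -/
def IsOfHighestWeightType {T : Finset (Idx n)} (N : LieSubmodule ℂ (G n) (Osc T)) : Prop :=
  ∃ c : Fin n → ℝ, IsRegularCoweight c ∧ ∃ μ v, IsHighestWeightModule c N μ v

/-- Irreducible highest weight module for the standard positive system. -/
def IsIrrHighestWeight {T : Finset (Idx n)} (N : LieSubmodule ℂ (G n) (Osc T))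
    (μ : Module.Dual ℂ (cartan n)) (v : Poly n) : Prop :=
  LieModule.IsIrreducible ℂ (G n) N ∧ IsHighestWeightModule (stdCoweight n) N μ v

/-! ### The index sets and the reduction by symmetry -/

/-- `S_1 = {i | i ∈ S, n + i ∈ S}`. -/
def S₁ (T : Finset (Idx n)) : Finset (Fin n) :=
  Finset.univ.filter fun i => Sum.inl i ∈ Tᶜ ∧ Sum.inr i ∈ Tᶜ

/-- `T_1 = {i | i ∈ T, n + i ∈ T}`. -/
def T₁ (T : Finset (Idx n)) : Finset (Fin n) :=
  Finset.univ.filter fun i => Sum.inl i ∈ T ∧ Sum.inr i ∈ T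

/-- The set of indices `{1, …, t}`. -/
def initialIdx (n t : ℕ) : Finset (Idx n) :=
  (Finset.univ.filter fun i : Fin n => i.val < t).image Sum.inl

/-- The representations attached to `T` and `T'` agree up to a symmetry: there are a relabelling
`θ` of the variables up to signs, and an automorphism `φ` of `sp(2n, ℂ)` that preserves `H`,
such that `θ` carries the action of `A` to the action of `φ A`, and `A_⟨k⟩` onto
`A_⟨s k⟩` for all `k`. -/
def SymmetricTo (T T' : Finset (Idx n)) (s : ℤ) : Prop :=
  ∃ (θ : Poly n ≃ₐ[ℂ] Poly n) (w : Equiv.Perm (Idx n)) (φ : G n ≃ₗ⁅ℂ⁆ G n),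
    (∀ p, θ (X p) = X (w p) ∨ θ (X p) = -X (w p)) ∧
    (cartan n).map (φ : G n →ₗ[ℂ] G n) = cartan n ∧
    (∀ A f, θ (spRep T A f) = spRep T' (φ A) (θ f)) ∧
    ∀ k, (gradedSpan T k).map θ.toLinearMap = gradedSpan T' (s * k)

/-! ### The explicit bases -/

/-- Pairs `i < j`. -/
abbrev Pairs (n : ℕ) : Type := {ij : Fin n × Fin n // ij.1 < ij.2}

/-- Exponents `(k_t)`, `(k_{i,j})_{i<j}` with `∑ k_t` even, `k_{i,j} k_t = 0` for `i < j < t`,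
and `k_{i,j} k_{i',j'} = 0` for `i < i'`, `j > j'`. -/
def IsAdmissible (k : Fin n → ℕ) (m : Pairs n → ℕ) : Prop :=
  Even (∑ t, k t) ∧
  (∀ (a : Pairs n) (t : Fin n), a.1.2 < t → m a * k t = 0) ∧
  ∀ a b : Pairs n, a.1.1 < b.1.1 → b.1.2 < a.1.2 → m a * m b = 0

/-- The polynomial `∑_{r_1+⋯+r_n = (k_1+⋯+k_n)/2} (r_1+⋯+r_n)! ∏_t C(k_t, r_t)
x_t^{k_t-r_t} x_{n+t}^{r_t} ∏_{i<j} (x_i x_{n+j} - x_j x_{n+i})^{k_{i,j}}`; the terms with some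
`r_t > k_t` vanish and are left out. -/
def basisPoly (k : Fin n → ℕ) (m : Pairs n → ℕ) : Poly n :=
  (∑ r ∈ (Fintype.piFinset fun t => Finset.range (k t + 1)).filter
      (fun r => ∑ t, r t = (∑ t, k t) / 2),
    C ((∑ t, r t).factorial : ℂ) *
      ∏ t, (C ((k t).choose (r t) : ℂ) * X (Sum.inl t) ^ (k t - r t) * X (Sum.inr t) ^ r t)) *
  ∏ a : Pairs n, (X (Sum.inl a.1.1) * X (Sum.inr a.1.2)
    - X (Sum.inl a.1.2) * X (Sum.inr a.1.1)) ^ m a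

/-- The family of the `basisPoly k m`, for admissible `(k, m)` with `P (∑ k_{i,j})`, is a basis of
`N`. -/
def HasBasis (T : Finset (Idx n)) (N : LieSubmodule ℂ (G n) (Osc T)) (P : ℕ → Prop) : Prop :=
  let b : {km : (Fin n → ℕ) × (Pairs n → ℕ) //
      IsAdmissible km.1 km.2 ∧ P (∑ a, km.2 a)} → Osc T :=
    fun km => toOsc T (basisPoly km.1.1 km.1.2)
  LinearIndependent ℂ b ∧ Submodule.span ℂ (Set.range b) = N.toSubmodule

end NoncanonicalSp

end

open NoncanonicalSp

noncomputable section

namespace NoncanonicalSp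

variable {n : ℕ}

/-! ### Diagonal operators and submodules stable under the general linear algebra -/

/-! The operators `unitOp` represent gl(2n), and under gl(2n) every A_⟨k⟩ is irreducible: the
diagonal operators separate monomials, and the others connect any two monomials of equal `tdeg`. The
question is therefore how far stability under sp(2n) falls short of stability under gl(2n).

Inside the Weyl algebra, `leftOp` and `dualOp` span two copies a, b of the vector representation,
with [b_u, a_v] = ω(u, v). Up to constants, the products a_u b_v split into a symmetric part
`symOp`, which spans the image of sp(2n), and an antisymmetric part `altOp`. The decisive fact is
`altOp_mul_altOp`: a product of two `altOp` is a polynomial in the `symOp`, so it preserves every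
sp(2n)-submodule N. It remains to see when a single `altOp` preserves N.

If p and `bar p` lie in the same part, `altOp T p (bar p)` is diagonal with eigenvalues ±(α_p +
α_{bar p} + 1), the sign being the same on all monomials. It is then a function of its own square,
so it preserves N; by commutators with `symOp` so do all `altOp`, and N is stable under gl(2n). This
settles irreducibility when S_1 ∪ T_1 is nonempty.

If T = {1, …, n}, the sum of the `altOp` over the pairs (i, n+i) is the scalar -k on A_⟨k⟩. For k ≠
0 each `altOp` is thus a multiple of a sum of products of two, and irreducibility follows again. For
k = 0 the exchange x_i ↔ x_{n+i} commutes with `symOp` and anticommutes with `altOp`. If W ≠ 0 is a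
submodule of one eigenspace of the exchange, then W plus its image under the `altOp` is stable under
gl(2n), hence is A_⟨0⟩; comparing eigenspaces, W is the whole eigenspace. The vectors 1 and u lie in
the eigenspaces for 1 and -1 and generate them.

The basis polynomials are, up to nonzero factors, middle coefficients in s of ∏ (x_t + s
x_{n+t})^{k_t}, multiplied by 2 × 2 minors. They span by a Clebsch–Gordan relation and Plücker
straightening. They are independent because a raising derivation followed by a choice of leading
terms turns them into distinct monomials. The exchange acts on them by (-1)^{∑ k_{i,j}}, which sorts
them into the two eigenspaces. -/

theorem bar_bar (p : Idx n) : bar (bar p) = p := by cases p <;> rfl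

theorem bar_ne (p : Idx n) : bar p ≠ p := by cases p <;> simp [bar]

theorem bar_eq_comm {p q : Idx n} : bar p = q ↔ p = bar q :=
  ⟨fun h => by rw [← h, bar_bar], fun h => by rw [h, bar_bar]⟩

theorem sgn_bar (p : Idx n) : sgn (bar p) = -sgn p := by cases p <;> simp [bar, sgn]

theorem sgn_mul_self (p : Idx n) : sgn p * sgn p = 1 := by cases p <;> simp [sgn]

theorem sgn_ne_zero (p : Idx n) : sgn p ≠ 0 := by cases p <;> simp [sgn]

theorem leftOp_monomial (T : Finset (Idx n)) (p : Idx n) (α : Idx n →₀ ℕ) :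
    leftOp T p (monomial α 1) =
      (if p ∈ T then (α p : ℂ) else 1) •
        monomial (if p ∈ T then α - Finsupp.single p 1 else α + Finsupp.single p 1) 1 := by
  by_cases hp : p ∈ T
  · simp [leftOp, hp, pderiv_monomial, smul_monomial]
  · simp [leftOp, hp, X, monomial_mul, add_comm]

theorem rightOp_monomial (T : Finset (Idx n)) (p : Idx n) (α : Idx n →₀ ℕ) :
    rightOp T p (monomial α 1) =
      (if p ∈ T then -1 else (α p : ℂ)) •
        monomial (if p ∈ T then α + Finsupp.single p 1 else α - Finsupp.single p 1) 1 := by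
  by_cases hp : p ∈ T
  · simp [rightOp, hp, X, monomial_mul, add_comm]
  · simp [rightOp, hp, pderiv_monomial, smul_monomial]

/-- The eigenvalue of `unitOp T p p` on the monomial `x^α`. -/
def diagValue (T : Finset (Idx n)) (p : Idx n) (α : Idx n →₀ ℕ) : ℂ :=
  if p ∈ T then -((α p : ℂ) + 1) else α p

theorem unitOp_self_monomial (T : Finset (Idx n)) (p : Idx n) (α : Idx n →₀ ℕ) :
    unitOp T p p (monomial α 1) = diagValue T p α • monomial α 1 := by
  rw [unitOp, Module.End.mul_apply, rightOp_monomial, map_smul, leftOp_monomial, smul_smul]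
  by_cases hp : p ∈ T
  · simp [hp, diagValue]
  · by_cases h : α p = 0
    · simp [hp, diagValue, h]
    · have : α - Finsupp.single p 1 + Finsupp.single p 1 = α :=
        tsub_add_cancel_of_le (Finsupp.single_le_iff.mpr (Nat.one_le_iff_ne_zero.mpr h))
      simp [hp, diagValue, this]

/-- The operator `D` multiplies the monomial `x^α` by `d α`. -/
def IsDiagonal (D : Module.End ℂ (Poly n)) (d : (Idx n →₀ ℕ) → ℂ) : Prop :=
  ∀ α f, coeff α (D f) = d α * coeff α f

theorem isDiagonal_of_monomial {D : Module.End ℂ (Poly n)} {d : (Idx n →₀ ℕ) → ℂ}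
    (h : ∀ α, D (monomial α 1) = d α • monomial α 1) : IsDiagonal D d := by
  intro α f
  induction f using MvPolynomial.induction_on' with
  | monomial β c =>
    have : (monomial β c : Poly n) = c • monomial β 1 := by simp [smul_monomial]
    rw [this, map_smul, h]
    simp only [coeff_smul, coeff_monomial, smul_eq_mul]
    split_ifs with hb
    · subst hb; ring
    · simp
  | add f g hf hg => rw [map_add, coeff_add, hf, hg, coeff_add]; ring

theorem isDiagonal_unitOp (T : Finset (Idx n)) (p : Idx n) :
    IsDiagonal (unitOp T p p) (diagValue T p) :=
  isDiagonal_of_monomial (unitOp_self_monomial T p)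

/-- A submodule stable under a diagonal operator is stable under every function of it. -/
theorem IsDiagonal.map_mem {D E : Module.End ℂ (Poly n)} {d : (Idx n →₀ ℕ) → ℂ} {g : ℂ → ℂ}
    (hD : IsDiagonal D d) (hE : IsDiagonal E (fun α => g (d α))) {N : Submodule ℂ (Poly n)}
    (hN : ∀ f ∈ N, D f ∈ N) {f : Poly n} (hf : f ∈ N) : E f ∈ N := by
  classical
  have hP : ∀ P : Polynomial ℂ, Polynomial.aeval D P f ∈ N ∧
      ∀ α, coeff α (Polynomial.aeval D P f) = P.eval (d α) * coeff α f := by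
    intro P
    induction P using Polynomial.induction_on' with
    | add P Q hP hQ =>
      refine ⟨by simpa using add_mem hP.1 hQ.1, fun α => ?_⟩
      simp [hP.2, hQ.2, add_mul]
    | monomial k c =>
      have hk : (D ^ k) f ∈ N ∧ ∀ α, coeff α ((D ^ k) f) = d α ^ k * coeff α f := by
        induction k with
        | zero => simp [hf]
        | succ k ih =>
          rw [pow_succ', Module.End.mul_apply]
          refine ⟨hN _ ih.1, fun α => ?_⟩
          rw [hD, ih.2]; ring
      rw [Polynomial.aeval_monomial]
      refine ⟨?_, fun α => ?_⟩
      · simpa [Algebra.algebraMap_eq_smul_one] using N.smul_mem c hk.1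
      · simp [Algebra.algebraMap_eq_smul_one, hk.2, mul_assoc]
  -- Only the finitely many eigenvalues occurring in `f` matter, so `g` may be replaced by a
  -- polynomial interpolating it there.
  obtain ⟨h1, h2⟩ := hP (Lagrange.interpolate (f.support.image d) id g)
  convert h1 using 1
  ext α
  rw [hE, h2]
  by_cases hα : α ∈ f.support
  · have := Lagrange.eval_interpolate_at_node (s := f.support.image d) (v := id) g
      (Function.injective_id.injOn) (Finset.mem_image_of_mem d hα)
    simp only [id] at this
    rw [this]
  · rw [notMem_support_iff.mp hα]; simp

/-- Stability under all the operators `unitOp T p q`. -/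
def IsGlStable (T : Finset (Idx n)) (N : Submodule ℂ (Poly n)) : Prop :=
  ∀ p q, ∀ f ∈ N, unitOp T p q f ∈ N

/-! ### Irreducibility of the graded pieces under gl(2n) -/

theorem diagValue_injective (T : Finset (Idx n)) (p : Idx n) {α β : Idx n →₀ ℕ}
    (h : diagValue T p α = diagValue T p β) : α p = β p := by
  unfold diagValue at h
  split_ifs at h <;> simpa using h

/-- Distinct monomials differ in an eigenvalue of some `unitOp T p p`, so subtracting an eigenvalue
shrinks the support without killing the vector. Keeping the exponent inside the support of `f`
preserves the information on its degree. -/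
theorem IsGlStable.exists_monomial_mem {T : Finset (Idx n)} {N : Submodule ℂ (Poly n)}
    (hN : IsGlStable T N) {f : Poly n} (hf : f ∈ N) (h0 : f ≠ 0) :
    ∃ α, monomial α (1 : ℂ) ∈ N ∧ α ∈ f.support := by
  induction hk : f.support.card using Nat.strong_induction_on generalizing f with
  | _ k ih =>
    obtain ⟨β, hβ⟩ := (support_nonempty.mpr h0)
    by_cases hex : ∃ α ∈ f.support, α ≠ β
    · obtain ⟨α, hα, hne⟩ := hex
      obtain ⟨p, hp⟩ : ∃ p, α p ≠ β p := by
        by_contra! h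
        exact hne (Finsupp.ext h)
      -- This combination removes the exponent `β` and keeps `α`, whose eigenvalue is different.
      set g := unitOp T p p f - diagValue T p β • f with hg
      have hc : ∀ γ, coeff γ g = (diagValue T p γ - diagValue T p β) * coeff γ f := by
        intro γ
        rw [hg, coeff_sub, isDiagonal_unitOp, coeff_smul, smul_eq_mul]; ring
      have hsub : g.support ⊆ f.support := by
        intro γ hγ
        rw [mem_support_iff, hc] at hγ
        exact mem_support_iff.mpr (right_ne_zero_of_mul hγ)
      have hlt : g.support.card < k := by
        rw [← hk]
        refine Finset.card_lt_card ⟨hsub, fun h => ?_⟩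
        have := h hβ
        rw [mem_support_iff, hc, sub_self, zero_mul] at this
        exact this rfl
      have hg0 : g ≠ 0 := by
        intro h
        have := hc α
        rw [h, coeff_zero] at this
        rcases mul_eq_zero.mp this.symm with h1 | h1
        · exact hp (diagValue_injective T p (sub_eq_zero.mp h1))
        · exact mem_support_iff.mp hα h1
      obtain ⟨γ, h1, h2⟩ := ih _ hlt (N.sub_mem (hN p p f hf) (N.smul_mem _ hf)) hg0 rfl
      exact ⟨γ, h1, hsub h2⟩
    · push Not at hex
      refine ⟨β, ?_, hβ⟩
      have hfe : f = coeff β f • monomial β 1 := by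
        ext γ
        rw [coeff_smul, coeff_monomial]
        by_cases h : β = γ
        · simp [h]
        · have : γ ∉ f.support := fun hγ => h (hex γ hγ).symm
          rw [notMem_support_iff.mp this]; simp [h]
      rw [hfe] at hf
      exact (N.smul_mem_iff (mem_support_iff.mp hβ)).mp hf

theorem tdeg_eq_sum (T : Finset (Idx n)) (α : Idx n →₀ ℕ) :
    tdeg T α = ∑ p, (if p ∈ T then -1 else 1) * (α p : ℤ) := by
  rw [tdeg, ← Finset.sum_compl_add_sum T, sub_eq_add_neg, ← Finset.sum_neg_distrib]
  congr 1
  · exact Finset.sum_congr rfl fun p hp => by simp [Finset.mem_compl.mp hp]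
  · exact Finset.sum_congr rfl fun p hp => by simp [hp]

/-- The two nonvanishing hypotheses concern exactly the factors that are derivatives: `leftOp` at an
index in `T` and `rightOp` at an index outside it. -/
theorem unitOp_monomial_of_ne (T : Finset (Idx n)) {p q : Idx n} (hpq : p ≠ q)
    (α : Idx n →₀ ℕ) (hp : p ∈ T → α p ≠ 0) (hq : q ∉ T → α q ≠ 0) :
    ∃ (c : ℂ) (α' : Idx n →₀ ℕ), c ≠ 0 ∧ unitOp T p q (monomial α 1) = c • monomial α' 1 ∧
      (α' p : ℤ) = α p + (if p ∈ T then -1 else 1) ∧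
      (α' q : ℤ) = α q - (if q ∈ T then -1 else 1) ∧
      ∀ r, r ≠ p → r ≠ q → α' r = α r := by
  rw [unitOp, Module.End.mul_apply, rightOp_monomial, map_smul, leftOp_monomial, smul_smul]
  refine ⟨_, _, ?_, rfl, ?_⟩
  · by_cases h1 : p ∈ T <;> by_cases h2 : q ∈ T <;> simp_all
  · by_cases h1 : p ∈ T <;> by_cases h2 : q ∈ T <;>
      simp_all [eq_comm] <;> grind

/-- The exponent is moved towards `β` one step at a time: `unitOp T p q` changes the signed exponent
by +1 at `p` and by -1 at `q`. The induction is on the ℓ¹-distance of the exponents. -/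
theorem IsGlStable.monomial_mem {T : Finset (Idx n)} {N : Submodule ℂ (Poly n)}
    (hN : IsGlStable T N) {α β : Idx n →₀ ℕ} (hα : monomial α (1 : ℂ) ∈ N)
    (h : tdeg T α = tdeg T β) : monomial β (1 : ℂ) ∈ N := by
  induction hk : ∑ p, ((β p : ℤ) - α p).natAbs using Nat.strong_induction_on generalizing α with
  | _ k ih =>
    by_cases hab : α = β
    · rwa [← hab]
    -- The signed differences sum to zero because the degrees agree, so unless all vanish one is
    -- positive (at `p`) and one is negative (at `q`). Their signs also ensure that the exponent is
    -- positive wherever a derivative is applied.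
    set δ : Idx n → ℤ := fun p => (if p ∈ T then -1 else 1) * ((β p : ℤ) - α p) with hδ
    have hsum : ∑ p, δ p = 0 := by
      simp only [hδ, mul_sub, Finset.sum_sub_distrib]
      rw [← tdeg_eq_sum, ← tdeg_eq_sum, h, sub_self]
    have hex : ∃ p ∈ Finset.univ, δ p ≠ 0 := by
      by_contra! hall
      refine hab (Finsupp.ext fun p => ?_)
      have := hall p (Finset.mem_univ p)
      simp only [hδ] at this
      split_ifs at this <;> omega
    obtain ⟨p, -, hp⟩ := Finset.exists_pos_of_sum_zero_of_exists_nonzero δ hsum hex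
    obtain ⟨q, -, hq⟩ := Finset.exists_pos_of_sum_zero_of_exists_nonzero (fun r => -δ r)
      (by rw [Finset.sum_neg_distrib, hsum, neg_zero])
      (by obtain ⟨r, hr, h⟩ := hex; exact ⟨r, hr, neg_ne_zero.mpr h⟩)
    have hpq : p ≠ q := by rintro rfl; simp only [hδ] at hp hq; omega
    simp only [hδ] at hp hq
    obtain ⟨c, α', hc, he, h1, h2, h3⟩ := unitOp_monomial_of_ne T hpq α
      (fun hT => by simp only [hT, if_true] at hp; omega)
      (fun hT => by simp only [hT, if_false] at hq; omega)
    have hm : monomial α' (1 : ℂ) ∈ N := by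
      have := hN p q _ hα
      rw [he] at this
      exact (N.smul_mem_iff hc).mp this
    refine ih _ ?_ hm ?_ rfl
    · rw [← hk]
      refine Finset.sum_lt_sum (fun r _ => ?_) ⟨p, Finset.mem_univ p, ?_⟩
      · by_cases hrp : r = p
        · subst hrp; rw [h1]; split_ifs at hp ⊢ <;> omega
        by_cases hrq : r = q
        · subst hrq; rw [h2]; split_ifs at hq ⊢ <;> omega
        rw [h3 r hrp hrq]
      · rw [h1]; split_ifs at hp ⊢ <;> omega
    · rw [← h, tdeg_eq_sum, tdeg_eq_sum, ← sub_eq_zero, ← Finset.sum_sub_distrib]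
      rw [Finset.sum_eq_add_of_mem p q (Finset.mem_univ _) (Finset.mem_univ _) hpq]
      · rw [h1, h2]; split_ifs <;> ring
      · rintro r - ⟨hr1, hr2⟩
        rw [h3 r hr1 hr2, sub_self]

theorem mem_gradedSpan_iff {T : Finset (Idx n)} {k : ℤ} {f : Poly n} :
    f ∈ gradedSpan T k ↔ ∀ α ∈ f.support, tdeg T α = k := by
  constructor
  · intro hf
    induction hf using Submodule.span_induction with
    | mem f hf =>
      obtain ⟨α, hα, rfl⟩ := hf
      intro β hβ
      have := support_monomial_subset hβ
      simp at this
      rw [this, hα]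
    | zero => simp
    | add f g _ _ hf hg =>
      classical
      intro α hα
      rcases Finset.mem_union.mp (support_add hα) with h | h
      exacts [hf α h, hg α h]
    | smul c f _ hf => exact fun α hα => hf α (support_smul hα)
  · intro h
    rw [f.as_sum]
    refine Submodule.sum_mem _ fun α hα => ?_
    have : (monomial α (coeff α f) : Poly n) = coeff α f • monomial α 1 := by simp [smul_monomial]
    rw [this]
    exact Submodule.smul_mem _ _ (Submodule.subset_span ⟨α, h α hα, rfl⟩)

/-- The graded pieces are irreducible under the general linear algebra. -/
theorem IsGlStable.eq_gradedSpan {T : Finset (Idx n)} {N : Submodule ℂ (Poly n)} {k : ℤ}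
    (hN : IsGlStable T N) (hk : N ≤ gradedSpan T k) (h0 : N ≠ ⊥) : N = gradedSpan T k := by
  refine le_antisymm hk ?_
  obtain ⟨f, hf, hf0⟩ := N.ne_bot_iff.mp h0
  obtain ⟨α, hα, hs⟩ := hN.exists_monomial_mem hf hf0
  refine Submodule.span_le.mpr ?_
  rintro _ ⟨β, hβ, rfl⟩
  exact hN.monomial_mem hα ((mem_gradedSpan_iff.mp (hk hf) α hs).trans hβ.symm)

/-! ### The symplectic Lie algebra inside the Weyl algebra -/

section WeylAlgebra

variable {ι R : Type*} [Ring R] [Algebra ℂ R]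

/-- The quadratic elements spanning the symplectic Lie algebra. -/
def symElt (a b : ι → R) (u v : ι) : R := a u * b v + a v * b u

/-- The quadratic elements spanning the complement of the symplectic Lie algebra in the general
linear one. -/
def altElt (a b : ι → R) (ω : ι → ι → ℂ) (u v : ι) : R := a u * b v - a v * b u - ω u v • 1

variable {a b : ι → R} {ω : ι → ι → ℂ}

/-- For commuting symbols this is a Gram determinant identity: the `symElt` are the inner products
of the vectors (a_u, b_u) for the form with matrix (0 1; 1 0), of determinant -1, and the `altElt`
are their 2 × 2 determinants. The other terms come from reordering; the constant ω(u, v) in `altElt`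
is what symmetrizing the products subtracts. -/
theorem altElt_mul_altElt (ha : ∀ u v, a u * a v = a v * a u) (hb : ∀ u v, b u * b v = b v * b u)
    (hab : ∀ u v, b u * a v = a v * b u + ω u v • 1) (hω : ∀ u v, ω v u = -ω u v)
    (u v w z : ι) :
    altElt a b ω u v * altElt a b ω w z =
      -(symElt a b u w * symElt a b v z) + symElt a b u z * symElt a b v w
        + ω w z • symElt a b u v - ω u w • symElt a b v z + ω u z • symElt a b v w
        + (ω u v * ω w z) • 1 := by
  have key : ∀ p q r s, a p * b q * (a r * b s) = a p * a r * (b q * b s) + ω q r • (a p * b s) := by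
    intro p q r s
    have : a p * b q * (a r * b s) = a p * (b q * a r) * b s := by simp only [mul_assoc]
    rw [this, hab, mul_add, add_mul]
    simp [mul_assoc]
  simp only [altElt, symElt, mul_add, add_mul, mul_sub, sub_mul, key, smul_mul_assoc,
    mul_smul_comm, one_mul, mul_one]
  rw [ha w v, ha z v, ha z w, hb z v, hb w v, hb z w, hω v w, hω v z, hω w z]
  module

/-- The `symElt` act on both `a` and `b` as sp(2n) acts on its vector representation, so their
commutator with `altElt` is the action on an exterior square. The constants in `altElt` leave no
scalar term. -/
theorem symElt_altElt_comm (ha : ∀ u v, a u * a v = a v * a u)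
    (hb : ∀ u v, b u * b v = b v * b u)
    (hab : ∀ u v, b u * a v = a v * b u + ω u v • 1) (hω : ∀ u v, ω v u = -ω u v)
    (r s u v : ι) :
    symElt a b r s * altElt a b ω u v - altElt a b ω u v * symElt a b r s =
      ω s u • altElt a b ω r v + ω r u • altElt a b ω s v
        + ω s v • altElt a b ω u r + ω r v • altElt a b ω u s := by
  have key : ∀ p q r s, a p * b q * (a r * b s) = a p * a r * (b q * b s) + ω q r • (a p * b s) := by
    intro p q r s
    have : a p * b q * (a r * b s) = a p * (b q * a r) * b s := by simp only [mul_assoc]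
    rw [this, hab, mul_add, add_mul]
    simp [mul_assoc]
  simp only [altElt, symElt, mul_add, add_mul, mul_sub, sub_mul, key, smul_mul_assoc,
    mul_smul_comm, one_mul, mul_one]
  rw [ha u r, ha v r, ha u s, ha v s, hb v r, hb v s, hb u r, hb u s, hω r u, hω r v, hω s u, hω s v]
  module

end WeylAlgebra

/-- The symplectic form on the span of the generators of the Weyl algebra. -/
def form (u v : Idx n) : ℂ := if bar u = v then sgn u else 0

/-- The operators that, like `leftOp`, span a copy of the vector representation. -/
def dualOp (T : Finset (Idx n)) (u : Idx n) : Module.End ℂ (Poly n) := sgn u • rightOp T (bar u)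

/-- The spanning operators of the image of the symplectic Lie algebra. -/
def symOp (T : Finset (Idx n)) (u v : Idx n) : Module.End ℂ (Poly n) :=
  symElt (leftOp T) (dualOp T) u v

/-- The operators complementing `symOp` to the image of the general linear Lie algebra. -/
def altOp (T : Finset (Idx n)) (u v : Idx n) : Module.End ℂ (Poly n) :=
  altElt (leftOp T) (dualOp T) form u v

theorem form_swap (u v : Idx n) : form v u = -form u v := by
  unfold form
  by_cases h : bar u = v
  · subst h; simp [bar_bar, sgn_bar]
  · have : bar v ≠ u := fun h' => h (by rw [← h', bar_bar])
    simp [h, this]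

theorem form_bar (u : Idx n) : form u (bar u) = sgn u := by simp [form]

theorem form_bar' (u : Idx n) : form (bar u) u = -sgn u := by rw [form_swap, form_bar]

theorem form_eq_zero {u v : Idx n} (h : bar u ≠ v) : form u v = 0 := by simp [form, h]

theorem dualOp_comm (T : Finset (Idx n)) (u v : Idx n) :
    dualOp T u * dualOp T v = dualOp T v * dualOp T u := by
  simp only [dualOp, smul_mul_smul_comm]
  rw [rightOp_comm, mul_comm]

theorem dualOp_leftOp (T : Finset (Idx n)) (u v : Idx n) :
    dualOp T u * leftOp T v = leftOp T v * dualOp T u + form u v • 1 := by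
  simp only [dualOp, smul_mul_assoc, rightOp_leftOp, mul_smul_comm, smul_add]
  by_cases h : bar u = v <;> simp [form, h]

theorem altOp_mul_altOp (T : Finset (Idx n)) (u v w z : Idx n) :
    altOp T u v * altOp T w z =
      -(symOp T u w * symOp T v z) + symOp T u z * symOp T v w
        + form w z • symOp T u v - form u w • symOp T v z + form u z • symOp T v w
        + (form u v * form w z) • 1 :=
  altElt_mul_altElt (leftOp_comm T) (dualOp_comm T) (dualOp_leftOp T) form_swap u v w z

theorem symOp_altOp_comm (T : Finset (Idx n)) (r s u v : Idx n) :
    symOp T r s * altOp T u v - altOp T u v * symOp T r s =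
      form s u • altOp T r v + form r u • altOp T s v
        + form s v • altOp T u r + form r v • altOp T u s :=
  symElt_altElt_comm (leftOp_comm T) (dualOp_comm T) (dualOp_leftOp T) form_swap r s u v

theorem altOp_swap (T : Finset (Idx n)) (u v : Idx n) : altOp T v u = -altOp T u v := by
  simp only [altOp, altElt]
  rw [form_swap u v]
  module

theorem rightOp_eq_dualOp (T : Finset (Idx n)) (q : Idx n) :
    rightOp T q = -sgn q • dualOp T (bar q) := by
  rw [dualOp, bar_bar, smul_smul, sgn_bar, neg_mul_neg, sgn_mul_self, one_smul]

theorem unitOp_eq (T : Finset (Idx n)) (p q : Idx n) :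
    unitOp T p q =
      (-sgn q / 2) • (symOp T p (bar q) + altOp T p (bar q) + form p (bar q) • 1) := by
  have : symOp T p (bar q) + altOp T p (bar q) + form p (bar q) • 1 =
      (2 : ℂ) • (leftOp T p * dualOp T (bar q)) := by
    simp only [symOp, symElt, altOp, altElt]; module
  rw [this, unitOp, rightOp_eq_dualOp, smul_smul, mul_smul_comm]
  congr 1; ring

/-! ### The image of sp(2n) and stability under it -/

theorem spRep_apply (T : Finset (Idx n)) (A : G n) : spRep T A = glMap T A.1 := rfl

theorem spRep_elt (T : Finset (Idx n)) (p q : Idx n) :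
    spRep T (elt p q) = unitOp T p q - (sgn p * sgn q) • unitOp T (bar q) (bar p) := by
  rw [spRep_apply, elt, map_sub, map_smul, glMap_single, glMap_single, one_smul, one_smul]

theorem spRep_elt_eq_symOp (T : Finset (Idx n)) (p q : Idx n) :
    spRep T (elt p q) = -sgn q • symOp T p (bar q) := by
  rw [spRep_elt, unitOp, unitOp, rightOp_eq_dualOp T q, rightOp_eq_dualOp T (bar p), bar_bar,
    sgn_bar, symOp, symElt, neg_neg, mul_smul_comm, mul_smul_comm, smul_smul,
    show sgn p * sgn q * sgn p = sgn q by rw [mul_right_comm, sgn_mul_self, one_mul]]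
  module

theorem apply_bar_bar (A : G n) (p q : Idx n) :
    A.1 (bar q) (bar p) = -(sgn p * sgn q) * A.1 p q := by
  have h : A.1ᵀ * Matrix.J (Fin n) ℂ = Matrix.J (Fin n) ℂ * (-A.1) :=
    (mem_skewAdjointMatricesSubmodule _ _).mp
      ((mem_skewAdjointMatricesLieSubalgebra _ _).mp A.2)
  have h' := congrFun (congrFun h q) (bar p)
  rcases p with p | p <;> rcases q with q | q <;>
    simp [Matrix.mul_apply, Matrix.J, Fintype.sum_sum_type, Matrix.one_apply, sgn, bar] at h' ⊢ <;>
    simp [h'] 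

/-- The factor 1/2 appears because every entry is counted twice: by `apply_bar_bar`, the terms with
E_{bar q, bar p} again add up to `A`. -/
theorem eq_sum_elt (A : G n) : A = (2⁻¹ : ℂ) • ∑ p, ∑ q, A.1 p q • elt p q := by
  have key : ∀ v : G n, v.1 = ((G n).incl : G n →ₗ[ℂ] Matrix (Idx n) (Idx n) ℂ) v := fun _ => rfl
  have h1 : ∀ c : Idx n → Idx n → ℂ, ((2⁻¹ : ℂ) • ∑ p, ∑ q, c p q • elt p q : G n).1 =
      (2⁻¹ : ℂ) • ∑ p, ∑ q, c p q • (elt p q).1 := by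
    intro c
    rw [key]
    simp only [map_smul, map_sum]
    rfl
  apply Subtype.ext
  rw [h1 A.1]
  ext r s
  simp only [elt, Matrix.smul_apply, Matrix.sum_apply, Matrix.sub_apply, smul_eq_mul, mul_sub,
    Finset.sum_sub_distrib]
  have e1 : ∑ p, ∑ q, A.1 p q * Matrix.single p q (1 : ℂ) r s = A.1 r s := by
    simp [Matrix.single_apply, ite_and]
  have e2 : ∑ p, ∑ q, A.1 p q * (sgn p * sgn q * Matrix.single (bar q) (bar p) (1 : ℂ) r s) =
      -A.1 r s := by
    simp only [Matrix.single_apply, bar_eq_comm, ite_and, mul_ite, mul_one, mul_zero]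
    simp only [Finset.sum_ite_eq', Finset.mem_univ, if_true]
    have := apply_bar_bar A (bar s) (bar r)
    rw [bar_bar, bar_bar] at this
    rw [this]; ring
  rw [e1, e2]; ring

/-- Stability under the action of the symplectic Lie algebra. -/
def IsSpStable (T : Finset (Idx n)) (N : Submodule ℂ (Poly n)) : Prop :=
  ∀ u v, ∀ f ∈ N, symOp T u v f ∈ N

theorem spRep_eq_sum (T : Finset (Idx n)) (A : G n) :
    spRep T A = (2⁻¹ : ℂ) • ∑ p, ∑ q, (A.1 p q * -sgn q) • symOp T p (bar q) := by
  have h := congrArg (spRep T : G n →ₗ[ℂ] Module.End ℂ (Poly n)) (eq_sum_elt A)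
  simp only [map_smul, map_sum] at h
  simp only [LieHom.coe_toLinearMap, spRep_elt_eq_symOp, smul_smul] at h
  exact h

theorem isSpStable_iff {T : Finset (Idx n)} {N : Submodule ℂ (Poly n)} :
    IsSpStable T N ↔ ∀ A, ∀ f ∈ N, spRep T A f ∈ N := by
  constructor
  · intro h A f hf
    rw [spRep_eq_sum]
    simp only [LinearMap.smul_apply, LinearMap.sum_apply]
    exact N.smul_mem _ (Submodule.sum_mem _ fun p _ => Submodule.sum_mem _ fun q _ =>
      N.smul_mem _ (h _ _ f hf))
  · intro h u v f hf
    have := h (elt u (bar v)) f hf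
    rw [spRep_elt_eq_symOp, bar_bar, LinearMap.smul_apply] at this
    exact (N.smul_mem_iff (neg_ne_zero.mpr (sgn_ne_zero _))).mp this

/-- This is how the product formula is used: the even part of the algebra generated by the `altOp`
acts through the enveloping algebra of sp(2n). -/
theorem IsSpStable.altOp_altOp_mem {T : Finset (Idx n)} {N : Submodule ℂ (Poly n)}
    (hN : IsSpStable T N) (u v w z : Idx n) {f : Poly n} (hf : f ∈ N) :
    altOp T u v (altOp T w z f) ∈ N := by
  rw [← Module.End.mul_apply, altOp_mul_altOp]
  simp only [LinearMap.add_apply, LinearMap.sub_apply, LinearMap.neg_apply, LinearMap.smul_apply,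
    Module.End.mul_apply, Module.End.one_apply]
  have h := fun u v => hN u v f hf
  exact N.add_mem (N.add_mem (N.sub_mem (N.add_mem (N.add_mem (N.neg_mem (hN _ _ _ (h _ _)))
    (hN _ _ _ (h _ _))) (N.smul_mem _ (h _ _))) (N.smul_mem _ (h _ _))) (N.smul_mem _ (h _ _)))
    (N.smul_mem _ hf)

theorem IsSpStable.isGlStable {T : Finset (Idx n)} {N : Submodule ℂ (Poly n)}
    (hN : IsSpStable T N) (h : ∀ u v, ∀ f ∈ N, altOp T u v f ∈ N) : IsGlStable T N := by
  intro p q f hf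
  rw [unitOp_eq]
  simp only [LinearMap.add_apply, LinearMap.smul_apply, Module.End.one_apply]
  exact N.smul_mem _ (N.add_mem (N.add_mem (hN _ _ f hf) (h _ _ f hf)) (N.smul_mem _ hf))

/-- Stability under one of the operators `altOp T p (bar p)` implies stability under the general
linear algebra. -/
theorem IsSpStable.isGlStable_of_altOp_bar {T : Finset (Idx n)} {N : Submodule ℂ (Poly n)}
    (hN : IsSpStable T N) (p : Idx n) (h : ∀ f ∈ N, altOp T p (bar p) f ∈ N) :
    IsGlStable T N := by
  have comm : ∀ r s u v, (∀ f ∈ N, altOp T u v f ∈ N) → ∀ f ∈ N,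
      (form s u • altOp T r v + form r u • altOp T s v
        + form s v • altOp T u r + form r v • altOp T u s) f ∈ N := by
    intro r s u v h f hf
    rw [← symOp_altOp_comm, LinearMap.sub_apply, Module.End.mul_apply, Module.End.mul_apply]
    exact N.sub_mem (hN _ _ _ (h f hf)) (h _ (hN _ _ f hf))
  have hs : ∀ u v, (∀ f ∈ N, altOp T u v f ∈ N) → ∀ f ∈ N, altOp T v u f ∈ N := by
    intro u v h f hf
    rw [altOp_swap]
    exact N.neg_mem (h f hf)
  have hself : ∀ u, ∀ f ∈ N, altOp T u u f ∈ N := by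
    intro u f hf
    have : altOp T u u = 0 := by
      have h : form u u = 0 := form_eq_zero (bar_ne u)
      simp [altOp, altElt, h]
    simp [this]
  have step1 : ∀ q, (∀ f ∈ N, altOp T q (bar q) f ∈ N) → ∀ r, r ≠ q → r ≠ bar q →
      ∀ f ∈ N, altOp T r (bar q) f ∈ N := by
    intro q hq r h1 h2 f hf
    have := comm r (bar q) q (bar q) hq f hf
    rw [form_bar', form_eq_zero (u := r) (v := q) (fun h => h2 (bar_eq_comm.mp h)),
      form_eq_zero (u := bar q) (v := bar q) (bar_ne _),
      form_eq_zero (u := r) (v := bar q) (fun h => h1 (by rw [← bar_bar r, h, bar_bar]))] at this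
    simp only [zero_smul, add_zero, LinearMap.smul_apply] at this
    exact (N.smul_mem_iff (neg_ne_zero.mpr (sgn_ne_zero _))).mp this
  have h' : ∀ f ∈ N, altOp T (bar p) (bar (bar p)) f ∈ N := by
    rw [bar_bar]; exact hs _ _ h
  have step2 : ∀ r, r ≠ p → ∀ f ∈ N, altOp T r (bar p) f ∈ N := by
    intro r h1
    by_cases h2 : r = bar p
    · rw [h2]; exact hself _
    · exact step1 p h r h1 h2
  have step3 : ∀ r, ∀ f ∈ N, altOp T r (bar p) f ∈ N := by
    intro r
    by_cases h1 : r = p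
    · rw [h1]; exact h
    · exact step2 r h1
  have step4 : ∀ r, ∀ f ∈ N, altOp T r p f ∈ N := by
    intro r
    by_cases h1 : r = bar p
    · rw [h1]; exact hs _ _ h
    by_cases h2 : r = p
    · rw [h2]; exact hself _
    · have := step1 (bar p) h' r h1 (by rwa [bar_bar])
      rwa [bar_bar] at this
  refine hN.isGlStable fun u v => ?_
  by_cases hu : u = p
  · rw [hu]; exact hs _ _ (step4 v)
  by_cases hu' : u = bar p
  · rw [hu']; exact hs _ _ (step3 v)
  by_cases hv : v = p
  · rw [hv]; exact step4 u
  by_cases hv' : v = bar p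
  · rw [hv']; exact step3 u
  intro f hf
  -- In this commutator only form v u · `altOp T p (bar p)` and sgn p · `altOp T u v` survive; the
  -- first preserves `N` by hypothesis, hence so does the second.
  have := comm v p u (bar p) (step3 u) f hf
  rw [form_eq_zero (u := p) (v := u) (fun h => hu' h.symm),
    form_eq_zero (u := v) (v := bar p) (fun h => hv (by rw [← bar_bar v, h, bar_bar])),
    form_bar] at this
  simp only [zero_smul, add_zero, zero_add, LinearMap.add_apply, LinearMap.smul_apply] at this
  exact (N.smul_mem_iff (sgn_ne_zero _)).mp
    ((N.add_mem_iff_right (N.smul_mem _ (h f hf))).mp this)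

/-- On this particular pair `altOp` is diagonal on monomials, so its spectrum can be read off from
`diagValue`. -/
theorem leftOp_mul_rightOp_bar (T : Finset (Idx n)) (p : Idx n) :
    altOp T p (bar p) = -sgn p • (unitOp T p p + unitOp T (bar p) (bar p) + 1) := by
  simp only [altOp, altElt, dualOp, form_bar, bar_bar, sgn_bar, unitOp, mul_smul_comm]
  module

/-- If `p` and `bar p` lie in the same part, submodules under the symplectic algebra are
submodules under the general linear algebra. -/
theorem IsSpStable.isGlStable_of_same_part {T : Finset (Idx n)} {N : Submodule ℂ (Poly n)}
    (hN : IsSpStable T N) (p : Idx n) (hp : p ∈ T ↔ bar p ∈ T) : IsGlStable T N := by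
  refine hN.isGlStable_of_altOp_bar p fun f hf => ?_
  -- The square is available because it is a product of two `altOp`. Its eigenvalues do not depend
  -- on whether `p` and `bar p` lie both in `T` or both outside.
  have hD : IsDiagonal (altOp T p (bar p) * altOp T p (bar p))
      fun α => ((α p : ℂ) + α (bar p) + 1) ^ 2 := by
    have h1 : IsDiagonal (altOp T p (bar p))
        fun α => (-sgn p * (diagValue T p α + diagValue T (bar p) α + 1)) := by
      intro α f
      rw [leftOp_mul_rightOp_bar]
      simp only [LinearMap.smul_apply, LinearMap.add_apply, coeff_smul, coeff_add,
        isDiagonal_unitOp T _ α f, Module.End.one_apply, smul_eq_mul]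
      ring
    intro α f
    rw [Module.End.mul_apply, h1, h1, ← mul_assoc]
    congr 1
    have hs := sgn_mul_self p
    unfold diagValue
    by_cases h : p ∈ T
    · simp only [h, hp.mp h, if_true]
      linear_combination ((α p : ℂ) + α (bar p) + 1) ^ 2 * hs
    · simp only [h, mt hp.mpr h, if_false]
      linear_combination ((α p : ℂ) + α (bar p) + 1) ^ 2 * hs
  have hE : ∃ c : ℂ, IsDiagonal (altOp T p (bar p))
      fun α => c * ((α p : ℂ) + α (bar p) + 1) := by
    refine ⟨if p ∈ T then sgn p else -sgn p, fun α f => ?_⟩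
    rw [leftOp_mul_rightOp_bar]
    simp only [LinearMap.smul_apply, LinearMap.add_apply, coeff_smul, coeff_add,
        isDiagonal_unitOp T _ α f, Module.End.one_apply, smul_eq_mul]
    unfold diagValue
    by_cases h : p ∈ T
    · simp only [h, hp.mp h, if_true]; ring
    · simp only [h, mt hp.mpr h, if_false]; ring
  obtain ⟨c, hE⟩ := hE
  -- Since α_p + α_{bar p} + 1 is positive, the operator is recovered from its square by the
  -- nonnegative square root. For `p` and `bar p` in different parts the eigenvalue would be ±(α_p -
  -- α_{bar p}), whose sign varies, and no such function exists.
  refine hD.map_mem (g := fun z => c * (Real.sqrt z.re : ℂ)) ?_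
    (fun f hf => by rw [Module.End.mul_apply]; exact hN.altOp_altOp_mem _ _ _ _ hf) hf
  have : (fun α : Idx n →₀ ℕ => c * (Real.sqrt (((α p : ℂ) + α (bar p) + 1) ^ 2).re : ℂ)) =
      fun α => c * ((α p : ℂ) + α (bar p) + 1) := by
    funext α
    have h1 : (((α p : ℂ) + α (bar p) + 1) ^ 2).re = ((α p : ℝ) + α (bar p) + 1) ^ 2 := by
      rw [← Complex.ofReal_re (((α p : ℝ) + α (bar p) + 1) ^ 2)]
      push_cast; rfl
    rw [h1, Real.sqrt_sq (by positivity)]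
    push_cast; rfl
  rw [this]
  exact hE

/-! ### Irreducible modules, weights and singular vectors -/

/-- Every nonzero submodule of `V` under the symplectic algebra is all of `V`. -/
def IsSpSimple (T : Finset (Idx n)) (V : Submodule ℂ (Poly n)) : Prop :=
  ∀ W : Submodule ℂ (Poly n), IsSpStable T W → W ≤ V → W ≠ ⊥ → W = V

/-- A Lie submodule, as a space of polynomials. -/
def polySubmodule {T : Finset (Idx n)} (N : LieSubmodule ℂ (G n) (Osc T)) :
    Submodule ℂ (Poly n) :=
  N.toSubmodule.comap (toOsc T).toLinearMap

theorem mem_polySubmodule {T : Finset (Idx n)} {N : LieSubmodule ℂ (G n) (Osc T)} {f : Poly n} :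
    f ∈ polySubmodule N ↔ toOsc T f ∈ N := Iff.rfl

theorem polySubmodule_injective {T : Finset (Idx n)} :
    Function.Injective (polySubmodule (n := n) (T := T)) := by
  intro N N' h
  refine LieSubmodule.ext _ _ fun x => ?_
  exact SetLike.ext_iff.mp h x

theorem polySubmodule_mono {T : Finset (Idx n)} {N N' : LieSubmodule ℂ (G n) (Osc T)}
    (h : N ≤ N') : polySubmodule N ≤ polySubmodule N' := fun _ hx => h hx

theorem polySubmodule_isSpStable {T : Finset (Idx n)} (N : LieSubmodule ℂ (G n) (Osc T)) :
    IsSpStable T (polySubmodule N) :=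
  isSpStable_iff.mpr fun A _ hf => N.lie_mem (x := A) hf

theorem lieSubmodule_ne_bot_iff {L M : Type*} [LieRing L] [LieAlgebra ℂ L] [AddCommGroup M]
    [Module ℂ M] [LieRingModule L M] (N : LieSubmodule ℂ L M) : N ≠ ⊥ ↔ ∃ x ∈ N, x ≠ 0 := by
  rw [Ne, LieSubmodule.eq_bot_iff]
  push Not
  rfl

theorem polySubmodule_ne_bot {T : Finset (Idx n)} {N : LieSubmodule ℂ (G n) (Osc T)}
    (h : N ≠ ⊥) : polySubmodule N ≠ ⊥ := by
  obtain ⟨x, hx, h0⟩ := (lieSubmodule_ne_bot_iff N).mp h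
  exact (Submodule.ne_bot_iff _).mpr ⟨x, hx, h0⟩

theorem polySubmodule_piece (T : Finset (Idx n)) (k : ℤ) :
    polySubmodule (piece T k) = gradedSpan T k := by
  ext f
  constructor
  · rintro ⟨g, hg, h⟩
    have : g = f := h
    rwa [← this]
  · exact fun h => ⟨f, h, rfl⟩

/-- The Lie submodule given by a stable space of polynomials. -/
def ofSpStable {T : Finset (Idx n)} (V : Submodule ℂ (Poly n)) (hV : IsSpStable T V) :
    LieSubmodule ℂ (G n) (Osc T) where
  toSubmodule := V.map (toOsc T).toLinearMap
  lie_mem := by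
    rintro A _ ⟨f, hf, rfl⟩
    exact ⟨spRep T A f, isSpStable_iff.mp hV A f hf, rfl⟩

theorem polySubmodule_ofSpStable {T : Finset (Idx n)} (V : Submodule ℂ (Poly n))
    (hV : IsSpStable T V) : polySubmodule (ofSpStable V hV) = V := by
  ext f
  constructor
  · rintro ⟨g, hg, h⟩
    have : g = f := h
    rwa [← this]
  · exact fun h => ⟨f, h, rfl⟩

theorem isIrreducible_of_isSpSimple {T : Finset (Idx n)} {N : LieSubmodule ℂ (G n) (Osc T)}
    (h : IsSpSimple T (polySubmodule N)) (h0 : N ≠ ⊥) : LieModule.IsIrreducible ℂ (G n) N := by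
  have : Nontrivial N := by
    obtain ⟨x, hx, hx0⟩ := (lieSubmodule_ne_bot_iff N).mp h0
    exact ⟨⟨⟨x, hx⟩, 0, fun h => hx0 (congrArg Subtype.val h)⟩⟩
  refine LieModule.IsIrreducible.mk fun N' hN' => ?_
  have hle : N'.map N.incl ≤ N := LieSubmodule.map_incl_le
  have hne : N'.map N.incl ≠ ⊥ := by
    obtain ⟨x, hx, hx0⟩ := (lieSubmodule_ne_bot_iff N').mp hN'
    exact (lieSubmodule_ne_bot_iff _).mpr
      ⟨x.1, LieSubmodule.mem_map_of_mem (f := N.incl) hx, fun h => hx0 (Subtype.ext h)⟩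
  have heq := polySubmodule_injective (h _ (polySubmodule_isSpStable _) (polySubmodule_mono hle)
    (polySubmodule_ne_bot hne))
  refine top_le_iff.mp fun x _ => ?_
  have hx : x.1 ∈ N'.map N.incl := by rw [heq]; exact x.2
  obtain ⟨y, hy, hyx⟩ := hx
  have : y = x := Subtype.ext hyx
  rwa [← this]

theorem generated_eq_of_isSpSimple {T : Finset (Idx n)} {N : LieSubmodule ℂ (G n) (Osc T)}
    (h : IsSpSimple T (polySubmodule N)) {v : Poly n} (hv : v ∈ polySubmodule N) (h0 : v ≠ 0) :
    generated T v = N := by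
  have hmem : toOsc T v ∈ generated T v := LieSubmodule.subset_lieSpan rfl
  refine polySubmodule_injective (h _ (polySubmodule_isSpStable _) (polySubmodule_mono ?_)
    ((Submodule.ne_bot_iff _).mpr ⟨v, hmem, h0⟩))
  exact LieSubmodule.lieSpan_le.mpr (Set.singleton_subset_iff.mpr hv)

theorem isIrrHighestWeight_of_isSpSimple {T : Finset (Idx n)} {N : LieSubmodule ℂ (G n) (Osc T)}
    (h : IsSpSimple T (polySubmodule N)) {v : Poly n} (hv : v ∈ polySubmodule N)
    {μ : Module.Dual ℂ (cartan n)} (hs : IsSingular (stdCoweight n) μ (toOsc T v)) :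
    IsIrrHighestWeight N μ v := by
  have h0 : v ≠ 0 := hs.1
  refine ⟨isIrreducible_of_isSpSimple h ?_, hs, generated_eq_of_isSpSimple h hv h0⟩
  exact (lieSubmodule_ne_bot_iff N).mpr ⟨v, hv, h0⟩

/-! ### Irreducibility when S_1 ∪ T_1 is nonempty -/

theorem isSpSimple_gradedSpan_of_same_part (T : Finset (Idx n)) (p : Idx n)
    (hp : p ∈ T ↔ bar p ∈ T) (k : ℤ) : IsSpSimple T (gradedSpan T k) :=
  fun _ hW hle h0 => (hW.isGlStable_of_same_part p hp).eq_gradedSpan hle h0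

theorem exists_same_part {T : Finset (Idx n)} (h : (S₁ T ∪ T₁ T).Nonempty) :
    ∃ p : Idx n, p ∈ T ↔ bar p ∈ T := by
  obtain ⟨i, hi⟩ := h
  simp only [S₁, T₁, Finset.mem_union, Finset.mem_filter, Finset.mem_univ, true_and,
    Finset.mem_compl] at hi
  exact ⟨Sum.inl i, by simp only [bar, Sum.swap_inl]; tauto⟩

theorem X_pow_eq (p : Idx n) (k : ℕ) :
    (X p ^ k : Poly n) = monomial (Finsupp.single p k) 1 := X_pow_eq_monomial

theorem X_pow_mem_gradedSpan (T : Finset (Idx n)) (p : Idx n) (k : ℕ) :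
    (X p ^ k : Poly n) ∈ gradedSpan T (if p ∈ T then -k else k) := by
  refine Submodule.subset_span ⟨Finsupp.single p k, ?_, X_pow_eq p k⟩
  rw [tdeg_eq_sum, Finset.sum_eq_single p]
  · split_ifs <;> simp
  · intro q _ hq; simp [hq]
  · simp

theorem piece_ne_bot {T : Finset (Idx n)} (hT : T.Nonempty) (hS : Tᶜ.Nonempty) (k : ℤ) :
    piece T k ≠ ⊥ := by
  obtain ⟨p, hp⟩ := hT
  obtain ⟨q, hq⟩ := hS
  rw [Finset.mem_compl] at hq
  have h : ∃ f : Poly n, f ∈ polySubmodule (piece T k) ∧ f ≠ 0 := by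
    rw [polySubmodule_piece]
    rcases le_total 0 k with hk | hk
    · refine ⟨X q ^ k.toNat, ?_, pow_ne_zero _ (X_ne_zero _)⟩
      have := X_pow_mem_gradedSpan T q k.toNat
      rwa [if_neg hq, Int.toNat_of_nonneg hk] at this
    · refine ⟨X p ^ (-k).toNat, ?_, pow_ne_zero _ (X_ne_zero _)⟩
      have := X_pow_mem_gradedSpan T p (-k).toNat
      rwa [if_pos hp, Int.toNat_of_nonneg (by omega), neg_neg] at this
  obtain ⟨f, hf, h0⟩ := h
  exact (lieSubmodule_ne_bot_iff _).mpr ⟨f, hf, h0⟩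

theorem isIrreducible_piece {T : Finset (Idx n)} (hT : T.Nonempty) (hS : Tᶜ.Nonempty)
    (h : (S₁ T ∪ T₁ T).Nonempty) (k : ℤ) : LieModule.IsIrreducible ℂ (G n) (piece T k) := by
  obtain ⟨p, hp⟩ := exists_same_part h
  refine isIrreducible_of_isSpSimple ?_ (piece_ne_bot hT hS k)
  rw [polySubmodule_piece]
  exact isSpSimple_gradedSpan_of_same_part T p hp k

/-! ### Absence of singular vectors when S_1 and T_1 are nonempty -/

theorem coweightExt_bar (c : Fin n → ℝ) (p : Idx n) :
    coweightExt c (bar p) = -coweightExt c p := by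
  cases p <;> simp [coweightExt, bar]

theorem exists_pos_coweight {c : Fin n → ℝ} (hc : IsRegularCoweight c) (i : Fin n) :
    ∃ p : Idx n, (p = Sum.inl i ∨ p = Sum.inr i) ∧ 0 < coweightExt c p := by
  rcases lt_or_gt_of_ne (hc.1 i) with h | h
  · exact ⟨Sum.inr i, Or.inr rfl, by simpa [coweightExt] using h⟩
  · exact ⟨Sum.inl i, Or.inl rfl, by simpa [coweightExt] using h⟩

/-- The long root vector `elt p (bar p)` is twice a matrix unit, so here a condition on sp(2n) is
already one on gl(2n). -/
theorem unitOp_bar_eq_zero {c : Fin n → ℝ} {T : Finset (Idx n)} {μ : Module.Dual ℂ (cartan n)}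
    {v : Poly n} (hv : IsSingular c μ (toOsc T v)) {p : Idx n} (hp : 0 < coweightExt c p) :
    unitOp T p (bar p) v = 0 := by
  have h : spRep T (elt p (bar p)) v = 0 := hv.2.2 p (bar p) (by rw [coweightExt_bar]; linarith)
  rw [spRep_elt, bar_bar, sgn_bar, mul_neg, sgn_mul_self] at h
  have h2 : (2 : ℂ) • unitOp T p (bar p) v = 0 := by
    rw [← h, two_smul]; simp
  exact (smul_eq_zero.mp h2).resolve_left two_ne_zero

/-- If `S_1` and `T_1` are both nonempty, there are no singular vectors at all. -/
theorem not_isSingular {T : Finset (Idx n)} (hS : (S₁ T).Nonempty) (hT : (T₁ T).Nonempty)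
    {c : Fin n → ℝ} (hc : IsRegularCoweight c) (μ : Module.Dual ℂ (cartan n)) (v : Poly n) :
    ¬ IsSingular c μ (toOsc T v) := by
  intro hv
  obtain ⟨i, hi⟩ := hS
  obtain ⟨j, hj⟩ := hT
  simp only [S₁, T₁, Finset.mem_filter, Finset.mem_univ, true_and, Finset.mem_compl] at hi hj
  obtain ⟨p, hp, hp0⟩ := exists_pos_coweight hc i
  obtain ⟨r, hr, hr0⟩ := exists_pos_coweight hc j
  have hpT : p ∉ T ∧ bar p ∉ T := by rcases hp with rfl | rfl <;> simp [bar, hi]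
  have hrT : r ∈ T ∧ bar r ∈ T := by rcases hr with rfl | rfl <;> simp [bar, hj]
  have h1 := unitOp_bar_eq_zero hv hp0
  have h2 : spRep T (elt p (bar r)) v = 0 :=
    hv.2.2 p (bar r) (by rw [coweightExt_bar]; linarith)
  rw [unitOp_apply, if_neg hpT.1, if_neg hpT.2] at h1
  -- The long root vector at `p` acts by x_p ∂_{bar p}, and the polynomial ring is a domain. Then in
  -- the root vector `elt p (bar r)` the second-order term vanishes on `v`, leaving multiplication
  -- by -x_p x_{bar r}, which is injective.
  have h3 : pderiv (bar p) v = 0 := (mul_eq_zero.mp h1).resolve_left (X_ne_zero _)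
  rw [spRep_elt, bar_bar, LinearMap.sub_apply, LinearMap.smul_apply, unitOp_apply, unitOp_apply,
    if_neg hpT.1, if_pos hrT.2, if_pos hrT.1, if_neg hpT.2, h3] at h2
  simp only [map_zero, smul_zero, sub_zero, neg_eq_zero, mul_eq_zero, X_ne_zero, false_or] at h2
  exact hv.1 h2

theorem not_isOfHighestWeightType {T : Finset (Idx n)} (hS : (S₁ T).Nonempty)
    (hT : (T₁ T).Nonempty) (N : LieSubmodule ℂ (G n) (Osc T)) : ¬ IsOfHighestWeightType N := by
  rintro ⟨c, hc, μ, v, hv, -⟩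
  exact not_isSingular hS hT hc μ v hv

/-! ### Weights of monomials and singular powers of variables -/

theorem spRep_cartan (T : Finset (Idx n)) (h : cartan n) :
    spRep T (h : G n) =
      ∑ i, eps i h • (unitOp T (Sum.inl i) (Sum.inl i) - unitOp T (Sum.inr i) (Sum.inr i)) := by
  obtain ⟨h, hh⟩ := h
  simp only [eps_apply]
  induction hh using Submodule.span_induction with
  | mem x hx =>
    obtain ⟨j, rfl⟩ := hx
    rw [spRep_elt, Finset.sum_eq_single j]
    · simp [elt, bar, sgn]
    · intro i _ hij; simp [elt, bar, sgn, hij.symm]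
    · simp
  | zero =>
    refine (map_zero (spRep T : G n →ₗ[ℂ] Module.End ℂ (Poly n))).trans ?_
    symm
    exact Finset.sum_eq_zero fun i _ => zero_smul _ _
  | add x y _ _ hx hy =>
    refine (map_add (spRep T : G n →ₗ[ℂ] Module.End ℂ (Poly n)) x y).trans ?_
    refine (congrArg₂ (· + ·) hx hy).trans ?_
    rw [← Finset.sum_add_distrib]
    exact Finset.sum_congr rfl fun i _ => (add_smul _ _ _).symm
  | smul c x _ hx =>
    refine (map_smul (spRep T : G n →ₗ[ℂ] Module.End ℂ (Poly n)) c x).trans ?_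
    refine (congrArg (c • ·) hx).trans ?_
    rw [Finset.smul_sum]
    exact Finset.sum_congr rfl fun i _ => smul_smul _ _ _

/-- The weight of the monomial `x^α`, in coordinates. -/
def monomialWeight (T : Finset (Idx n)) (α : Idx n →₀ ℕ) (i : Fin n) : ℂ :=
  diagValue T (Sum.inl i) α - diagValue T (Sum.inr i) α

theorem spRep_cartan_monomial (T : Finset (Idx n)) (h : cartan n) (α : Idx n →₀ ℕ) :
    spRep T (h : G n) (monomial α 1) = (∑ i, eps i h * monomialWeight T α i) • monomial α 1 := by
  rw [spRep_cartan, LinearMap.sum_apply, Finset.sum_smul]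
  refine Finset.sum_congr rfl fun i _ => ?_
  rw [LinearMap.smul_apply, LinearMap.sub_apply, unitOp_self_monomial, unitOp_self_monomial,
    ← sub_smul, smul_smul, monomialWeight]

theorem fundWeight_apply (m : ℕ) (h : cartan n) :
    fundWeight n m h = ∑ i, eps i h * if i.val < m then 1 else 0 := by
  simp only [fundWeight, Finset.sum_filter, LinearMap.sum_apply, mul_ite, mul_one, mul_zero]
  exact Finset.sum_congr rfl fun i _ => by split_ifs <;> rfl

/-- A vector killed by the positive root vectors of the general linear algebra is singular. -/
theorem isSingular_of_unitOp {T : Finset (Idx n)} {c : Fin n → ℝ} {μ : Module.Dual ℂ (cartan n)}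
    {v : Poly n} (h0 : v ≠ 0) (hμ : ∀ h : cartan n, spRep T (h : G n) v = μ h • v)
    (h : ∀ p q, coweightExt c q < coweightExt c p → unitOp T p q v = 0) :
    IsSingular c μ (toOsc T v) := by
  refine ⟨h0, hμ, fun p q hpq => ?_⟩
  change spRep T (elt p q) v = 0
  have h' := h (bar q) (bar p) (by rw [coweightExt_bar, coweightExt_bar]; linarith)
  rw [spRep_elt, LinearMap.sub_apply, LinearMap.smul_apply, h p q hpq, h', smul_zero, sub_zero]

theorem mem_initialIdx {t : ℕ} {p : Idx n} :
    p ∈ initialIdx n t ↔ ∃ i : Fin n, i.val < t ∧ p = Sum.inl i := by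
  simp [initialIdx, eq_comm]

theorem inl_mem_initialIdx {t : ℕ} {i : Fin n} :
    (Sum.inl i : Idx n) ∈ initialIdx n t ↔ i.val < t := by
  simp [mem_initialIdx]

theorem inr_notMem_initialIdx {t : ℕ} {i : Fin n} :
    (Sum.inr i : Idx n) ∉ initialIdx n t := by
  simp [mem_initialIdx]

theorem stdCoweight_lt_inl {i : Fin n} {p : Idx n}
    (h : coweightExt (stdCoweight n) (Sum.inl i) < coweightExt (stdCoweight n) p) :
    ∃ j : Fin n, p = Sum.inl j ∧ j.val < i.val := by
  have hi : (i.val : ℝ) < n := by exact_mod_cast i.2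
  rcases p with j | j <;> have hj : (j.val : ℝ) < n := by exact_mod_cast j.2
  · refine ⟨j, rfl, ?_⟩
    simp only [coweightExt, stdCoweight, Sum.elim_inl] at h
    exact_mod_cast (by linarith : (j.val : ℝ) < i.val)
  · simp only [coweightExt, stdCoweight, Sum.elim_inl, Sum.elim_inr] at h
    linarith

theorem stdCoweight_lt_inr_last {i : Fin n} (hi : i.val = n - 1) {p : Idx n}
    (h : coweightExt (stdCoweight n) (Sum.inr i) < coweightExt (stdCoweight n) p) :
    ∃ j : Fin n, p = Sum.inl j := by
  rcases p with j | j
  · exact ⟨j, rfl⟩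
  · simp only [coweightExt, stdCoweight, Sum.elim_inr] at h
    have : (j.val : ℝ) ≤ i.val := by exact_mod_cast (by omega : j.val ≤ i.val)
    linarith

theorem pderiv_X_pow_of_ne {p q : Idx n} (h : q ≠ p) (k : ℕ) :
    pderiv p (X q ^ k : Poly n) = 0 := by
  rw [Derivation.leibniz_pow, pderiv_X_of_ne h]; simp

/-- The powers of the last variable in `T` are singular. -/
theorem unitOp_X_pow_of_mem {t : ℕ} {i : Fin n} (hi : i.val + 1 = t) (k : ℕ)
    {p q : Idx n} (h : coweightExt (stdCoweight n) q < coweightExt (stdCoweight n) p) :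
    unitOp (initialIdx n t) p q (X (Sum.inl i) ^ k) = 0 := by
  rw [unitOp_apply]
  by_cases hq : q ∈ initialIdx n t
  · obtain ⟨j, hj, rfl⟩ := mem_initialIdx.mp hq
    obtain ⟨l, rfl, hl⟩ := stdCoweight_lt_inl h
    have hlT : (Sum.inl l : Idx n) ∈ initialIdx n t := inl_mem_initialIdx.mpr (by omega)
    rw [if_pos hlT, if_pos hq, pderiv_X_pow_of_ne]
    · simp only [mul_zero, neg_zero, zero_sub, neg_eq_zero, ite_eq_right_iff, Sum.inl.injEq]
      rintro rfl; omega
    · simp only [ne_eq, Sum.inl.injEq]; rintro rfl; omega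
  · rw [if_neg hq, if_neg hq, pderiv_X_pow_of_ne]
    · simp
    · rintro rfl; exact hq (inl_mem_initialIdx.mpr (by omega))

/-- The powers of the first variable outside `T` are singular. -/
theorem unitOp_X_pow_of_notMem {t : ℕ} {x : Idx n} (hx : x ∉ initialIdx n t)
    (hlt : ∀ p, coweightExt (stdCoweight n) x < coweightExt (stdCoweight n) p →
      p ∈ initialIdx n t) (k : ℕ)
    {p q : Idx n} (h : coweightExt (stdCoweight n) q < coweightExt (stdCoweight n) p) :
    unitOp (initialIdx n t) p q (X x ^ k) = 0 := by
  rw [unitOp_apply]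
  by_cases hq : q ∈ initialIdx n t
  · obtain ⟨j, hj, rfl⟩ := mem_initialIdx.mp hq
    obtain ⟨l, rfl, hl⟩ := stdCoweight_lt_inl h
    have hlT : (Sum.inl l : Idx n) ∈ initialIdx n t := inl_mem_initialIdx.mpr (by omega)
    rw [if_pos hlT, if_pos hq, pderiv_X_pow_of_ne]
    · simp only [mul_zero, neg_zero, zero_sub, neg_eq_zero, ite_eq_right_iff, Sum.inl.injEq]
      rintro rfl; omega
    · rintro rfl; exact hx hlT
  · by_cases hqx : x = q
    · subst hqx
      have hp := hlt p h
      have hxp : x ≠ p := by rintro rfl; exact hx hp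
      rw [if_pos hp, if_neg hx, pderiv_comm', pderiv_X_pow_of_ne hxp, map_zero]
    · rw [if_neg hq, if_neg hq, pderiv_X_pow_of_ne hqx]; simp

theorem monomialWeight_initialIdx_single {t : ℕ} (x : Idx n) (k : ℕ) (i : Fin n) :
    monomialWeight (initialIdx n t) (Finsupp.single x k) i =
      (if i.val < t then -1 else 0) + (if x = Sum.inl i then (if i.val < t then -(k : ℂ) else k) else 0)
        - if x = Sum.inr i then (k : ℂ) else 0 := by
  simp only [monomialWeight, diagValue, inl_mem_initialIdx, inr_notMem_initialIdx, if_false,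
    Finsupp.single_apply]
  split_ifs <;> push_cast <;> ring

theorem isSingular_X_pow {T : Finset (Idx n)} {x : Idx n} {k : ℕ} {μ : Module.Dual ℂ (cartan n)}
    (h : ∀ p q, coweightExt (stdCoweight n) q < coweightExt (stdCoweight n) p →
      unitOp T p q (X x ^ k) = 0)
    (hμ : ∀ h, μ h = ∑ i, eps i h * monomialWeight T (Finsupp.single x k) i) :
    IsSingular (stdCoweight n) μ (toOsc T (X x ^ k)) := by
  refine isSingular_of_unitOp (pow_ne_zero _ (X_ne_zero _)) (fun a => ?_) h
  rw [X_pow_eq, spRep_cartan_monomial, hμ]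

theorem isIrrHighestWeight_nonneg {t : ℕ} (htn : t < n) {k : ℤ} (hk : 0 ≤ k)
    (hs : IsSpSimple (initialIdx n t) (gradedSpan (initialIdx n t) k)) :
    IsIrrHighestWeight (piece (initialIdx n t) k)
          (-(k + 1) • fundWeight n t + k • fundWeight n (t + 1))
          (X (Sum.inl ⟨t, htn⟩) ^ k.toNat) := by
  have hx : (Sum.inl ⟨t, htn⟩ : Idx n) ∉ initialIdx n t := by simp [inl_mem_initialIdx]
  refine isIrrHighestWeight_of_isSpSimple (by rwa [polySubmodule_piece]) ?_ ?_
  · rw [polySubmodule_piece]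
    have := X_pow_mem_gradedSpan (initialIdx n t) (Sum.inl ⟨t, htn⟩) k.toNat
    rwa [if_neg hx, Int.toNat_of_nonneg hk] at this
  · refine isSingular_X_pow (fun p q => unitOp_X_pow_of_notMem hx ?_ _) ?_
    · intro p hp
      obtain ⟨j, rfl, hj⟩ := stdCoweight_lt_inl hp
      exact inl_mem_initialIdx.mpr hj
    · intro a
      lift k to ℕ using hk
      simp only [LinearMap.add_apply, LinearMap.smul_apply, fundWeight_apply, Finset.smul_sum,
        ← Finset.sum_add_distrib, monomialWeight_initialIdx_single]
      refine Finset.sum_congr rfl fun i _ => ?_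
      simp only [zsmul_eq_mul, Sum.inl.injEq, Fin.ext_iff, reduceCtorEq, if_false,
        Int.toNat_natCast]
      split_ifs <;> first | omega | (push_cast; ring)

theorem isIrrHighestWeight_neg {t : ℕ} (ht : 1 ≤ t) (htn : t ≤ n) {k : ℤ} (hk : k < 0)
    (hs : IsSpSimple (initialIdx n t) (gradedSpan (initialIdx n t) k)) :
    IsIrrHighestWeight (piece (initialIdx n t) k)
          (-k • fundWeight n (t - 1) + (k - 1) • fundWeight n t)
          (X (Sum.inl ⟨t - 1, by omega⟩) ^ (-k).toNat) := by
  have hx : (Sum.inl ⟨t - 1, by omega⟩ : Idx n) ∈ initialIdx n t := by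
    rw [inl_mem_initialIdx]; change t - 1 < t; omega
  refine isIrrHighestWeight_of_isSpSimple (by rwa [polySubmodule_piece]) ?_ ?_
  · rw [polySubmodule_piece]
    have := X_pow_mem_gradedSpan (initialIdx n t) (Sum.inl ⟨t - 1, by omega⟩) (-k).toNat
    rwa [if_pos hx, Int.toNat_of_nonneg (by omega), neg_neg] at this
  · refine isSingular_X_pow (fun p q => unitOp_X_pow_of_mem (by simp; omega) _) ?_
    intro a
    obtain ⟨m, rfl⟩ : ∃ m : ℕ, k = -m := ⟨(-k).toNat, by omega⟩
    simp only [LinearMap.add_apply, LinearMap.smul_apply, fundWeight_apply, Finset.smul_sum,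
      ← Finset.sum_add_distrib, monomialWeight_initialIdx_single]
    refine Finset.sum_congr rfl fun i _ => ?_
    simp only [zsmul_eq_mul, Sum.inl.injEq, Fin.ext_iff, reduceCtorEq, if_false, neg_neg,
      Int.toNat_natCast]
    split_ifs <;> first | omega | (push_cast; ring)

/-! ### Symmetries -/

/-- An entrywise form of the symplectic condition, in which relabelling of indices and transposition
are easy to follow. -/
theorem mem_G_iff (A : Matrix (Idx n) (Idx n) ℂ) :
    A ∈ G n ↔ ∀ p q, A (bar q) (bar p) = -(sgn p * sgn q) * A p q := by
  refine ⟨fun h p q => apply_bar_bar ⟨A, h⟩ p q, fun h => ?_⟩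
  refine (mem_skewAdjointMatricesLieSubalgebra _ _).mpr
    ((mem_skewAdjointMatricesSubmodule _ _).mpr ?_)
  change Aᵀ * Matrix.J (Fin n) ℂ = Matrix.J (Fin n) ℂ * (-A)
  ext q r
  have h' := h (bar r) q
  rw [bar_bar] at h'
  rcases r with p | p <;> rcases q with q | q <;>
    simp [Matrix.mul_apply, Matrix.J, Fintype.sum_sum_type, Matrix.one_apply, sgn, bar] at h' ⊢ <;>
    simp [h']

theorem mem_cartan_iff (A : G n) : A ∈ cartan n ↔ ∀ p q, p ≠ q → A.1 p q = 0 := by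
  constructor
  · intro h
    induction h using Submodule.span_induction with
    | mem x hx =>
      obtain ⟨i, rfl⟩ := hx
      rintro p q hpq
      have h : ∀ r : Idx n, Matrix.single r r (1 : ℂ) p q = 0 := fun r => by
        rw [Matrix.single_apply, if_neg]
        rintro ⟨rfl, rfl⟩
        exact hpq rfl
      simp only [elt, Matrix.sub_apply, Matrix.smul_apply, h, smul_zero, sub_zero]
    | zero => intros; rfl
    | add x y _ _ hx hy =>
      intro p q hpq
      have : (x + y).1 p q = x.1 p q + y.1 p q := rfl
      rw [this, hx p q hpq, hy p q hpq, add_zero]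
    | smul c x _ hx =>
      intro p q hpq
      have : (c • x).1 p q = c * x.1 p q := rfl
      rw [this, hx p q hpq, mul_zero]
  · intro h
    rw [eq_sum_elt A]
    refine Submodule.smul_mem _ _ (Submodule.sum_mem _ fun p _ => Submodule.sum_mem _ fun q _ => ?_)
    by_cases hpq : p = q
    · subst hpq
      refine Submodule.smul_mem _ _ ?_
      rcases p with i | i
      · exact Submodule.subset_span ⟨i, rfl⟩
      · have : elt (Sum.inr i : Idx n) (Sum.inr i) = -elt (Sum.inl i) (Sum.inl i) := by
          apply Subtype.ext
          change _ = -(elt (Sum.inl i) (Sum.inl i)).1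
          simp [elt, sgn, bar]
        rw [this]
        exact Submodule.neg_mem _ (Submodule.subset_span ⟨i, rfl⟩)
    · rw [h p q hpq, zero_smul]; exact Submodule.zero_mem _

/-- An automorphism of `gl(2n, ℂ)` preserving `sp(2n, ℂ)`, restricted to it. -/
def restrictToG (Φ : Matrix (Idx n) (Idx n) ℂ ≃ₗ⁅ℂ⁆ Matrix (Idx n) (Idx n) ℂ)
    (h : ∀ A, Φ A ∈ G n ↔ A ∈ G n) : G n ≃ₗ⁅ℂ⁆ G n :=
  LieEquiv.ofSubalgebras (G n) (G n) Φ (by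
    ext A
    constructor
    · rintro ⟨B, hB, rfl⟩; exact (h B).mpr hB
    · intro hA
      refine ⟨Φ.symm A, (h _).mp ?_, Φ.apply_symm_apply A⟩
      rwa [Φ.apply_symm_apply])

theorem restrictToG_apply (Φ : Matrix (Idx n) (Idx n) ℂ ≃ₗ⁅ℂ⁆ Matrix (Idx n) (Idx n) ℂ)
    (h : ∀ A, Φ A ∈ G n ↔ A ∈ G n) (A : G n) : (restrictToG Φ h A).1 = Φ A.1 := rfl

theorem map_cartan_restrictToG (Φ : Matrix (Idx n) (Idx n) ℂ ≃ₗ⁅ℂ⁆ Matrix (Idx n) (Idx n) ℂ)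
    (h : ∀ A, Φ A ∈ G n ↔ A ∈ G n)
    (hd : ∀ A, (∀ p q, p ≠ q → Φ A p q = 0) ↔ ∀ p q, p ≠ q → A p q = 0) :
    (cartan n).map (restrictToG Φ h : G n →ₗ[ℂ] G n) = cartan n := by
  ext A
  constructor
  · rintro ⟨B, hB, rfl⟩
    exact (mem_cartan_iff _).mpr ((hd B.1).mpr ((mem_cartan_iff B).mp hB))
  · intro hA
    refine ⟨(restrictToG Φ h).symm A, ?_, (restrictToG Φ h).apply_symm_apply A⟩
    refine (mem_cartan_iff _).mpr ((hd _).mp ?_)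
    rw [← restrictToG_apply Φ h, LieEquiv.apply_symm_apply]
    exact (mem_cartan_iff A).mp hA

/-- The relabelling `x_p ↦ e_p x_{w p}` of the variables. -/
def signedPerm (w : Equiv.Perm (Idx n)) (e : Idx n → ℂ) (he : ∀ p, e p * e p = 1) :
    Poly n ≃ₐ[ℂ] Poly n :=
  AlgEquiv.ofAlgHom (aeval fun p => e p • X (w p)) (aeval fun p => e (w.symm p) • X (w.symm p))
    (by apply MvPolynomial.algHom_ext; intro p; simp [smul_smul, he])
    (by apply MvPolynomial.algHom_ext; intro p; simp [smul_smul, he])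

section signedPerm

variable (w : Equiv.Perm (Idx n)) (e : Idx n → ℂ) (he : ∀ p, e p * e p = 1)

theorem signedPerm_X (p : Idx n) : signedPerm w e he (X p) = e p • X (w p) := by
  simp [signedPerm]

theorem signedPerm_symm_X (p : Idx n) :
    (signedPerm w e he).symm (X p) = e (w.symm p) • X (w.symm p) := by
  rw [AlgEquiv.symm_apply_eq, map_smul, signedPerm_X, smul_smul, he, one_smul, w.apply_symm_apply]

theorem signedPerm_pderiv (p : Idx n) (f : Poly n) :
    signedPerm w e he (pderiv p f) = e p • pderiv (w p) (signedPerm w e he f) := by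
  induction f using MvPolynomial.induction_on with
  | C a =>
    rw [pderiv_C, map_zero, ← algebraMap_eq, AlgEquiv.commutes, algebraMap_eq, pderiv_C, smul_zero]
  | add f g hf hg => simp only [map_add, smul_add, hf, hg]
  | mul_X f q hf =>
    simp only [Derivation.leibniz, map_mul, map_add, hf, signedPerm_X, smul_eq_mul,
      Derivation.map_smul]
    have : signedPerm w e he (pderiv p (X q)) = e p • e q • pderiv (w p) (X (w q)) := by
      by_cases h : q = p
      · subst h; rw [pderiv_X_self, pderiv_X_self, map_one, smul_smul, he, one_smul]
      · rw [pderiv_X_of_ne h, pderiv_X_of_ne (fun h' => h (w.injective h')), map_zero]; simp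
    rw [this, smul_add]
    simp only [Algebra.mul_smul_comm, Algebra.smul_mul_assoc]

theorem signedPerm_sign (h : ∀ p, e p = 1 ∨ e p = -1) (p : Idx n) :
    signedPerm w e he (X p) = X (w p) ∨ signedPerm w e he (X p) = -X (w p) := by
  rw [signedPerm_X]
  rcases h p with h | h <;> simp [h]

end signedPerm

/-! ### Compatibility of relabellings with the grading and the action -/

theorem tdeg_add (T : Finset (Idx n)) (α β : Idx n →₀ ℕ) :
    tdeg T (α + β) = tdeg T α + tdeg T β := by
  simp only [tdeg_eq_sum, Finsupp.add_apply, Nat.cast_add, mul_add, Finset.sum_add_distrib]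

theorem mul_mem_gradedSpan {T : Finset (Idx n)} {k l : ℤ} {f g : Poly n}
    (hf : f ∈ gradedSpan T k) (hg : g ∈ gradedSpan T l) : f * g ∈ gradedSpan T (k + l) := by
  classical
  rw [mem_gradedSpan_iff] at *
  intro α hα
  obtain ⟨β, hβ, γ, hγ, rfl⟩ := Finset.mem_add.mp (support_mul f g hα)
  rw [tdeg_add, hf β hβ, hg γ hγ]

theorem one_mem_gradedSpan (T : Finset (Idx n)) : (1 : Poly n) ∈ gradedSpan T 0 :=
  Submodule.subset_span ⟨0, by simp [tdeg], rfl⟩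

theorem pow_mem_gradedSpan {T : Finset (Idx n)} {k : ℤ} {f : Poly n} (hf : f ∈ gradedSpan T k)
    (m : ℕ) : f ^ m ∈ gradedSpan T (m * k) := by
  induction m with
  | zero => simpa using one_mem_gradedSpan T
  | succ m ih =>
    rw [pow_succ]
    convert mul_mem_gradedSpan ih hf using 1
    push_cast; ring

theorem prod_mem_gradedSpan {T : Finset (Idx n)} {ι : Type*} (s : Finset ι) {k : ι → ℤ}
    {f : ι → Poly n} (hf : ∀ i ∈ s, f i ∈ gradedSpan T (k i)) :
    ∏ i ∈ s, f i ∈ gradedSpan T (∑ i ∈ s, k i) := by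
  classical
  induction s using Finset.induction_on with
  | empty => simpa using one_mem_gradedSpan T
  | insert a s ha ih =>
    rw [Finset.prod_insert ha, Finset.sum_insert ha]
    exact mul_mem_gradedSpan (hf a (Finset.mem_insert_self a s))
      (ih fun i hi => hf i (Finset.mem_insert_of_mem hi))

theorem X_mem_gradedSpan (T : Finset (Idx n)) (p : Idx n) :
    (X p : Poly n) ∈ gradedSpan T (if p ∈ T then -1 else 1) := by
  simpa using X_pow_mem_gradedSpan T p 1

theorem algHom_mem_gradedSpan {T T' : Finset (Idx n)} {s : ℤ} (θ : Poly n →ₐ[ℂ] Poly n)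
    (h : ∀ p, θ (X p) ∈ gradedSpan T' (s * if p ∈ T then -1 else 1)) {k : ℤ} {f : Poly n}
    (hf : f ∈ gradedSpan T k) : θ f ∈ gradedSpan T' (s * k) := by
  induction hf using Submodule.span_induction with
  | mem f hf =>
    obtain ⟨α, hα, rfl⟩ := hf
    have : (monomial α 1 : Poly n) = ∏ p, X p ^ α p := by
      rw [monomial_eq, C_1, one_mul, Finsupp.prod_fintype _ _ (by simp)]
    rw [this, map_prod, ← hα, tdeg_eq_sum, Finset.mul_sum]
    refine prod_mem_gradedSpan _ fun p _ => ?_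
    rw [map_pow]
    convert pow_mem_gradedSpan (h p) (α p) using 1
    ring
  | zero => simp
  | add f g _ _ hf hg => rw [map_add]; exact add_mem hf hg
  | smul c f _ hf => rw [map_smul]; exact Submodule.smul_mem _ c hf

theorem map_signedPerm_gradedSpan {T T' : Finset (Idx n)} {s : ℤ} (hs : s * s = 1)
    (w : Equiv.Perm (Idx n)) (e : Idx n → ℂ) (he : ∀ p, e p * e p = 1)
    (h : ∀ p, (if w p ∈ T' then -1 else 1 : ℤ) = s * if p ∈ T then -1 else 1) (k : ℤ) :
    (gradedSpan T k).map (signedPerm w e he).toLinearMap = gradedSpan T' (s * k) := by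
  apply le_antisymm
  · rintro _ ⟨f, hf, rfl⟩
    refine algHom_mem_gradedSpan (signedPerm w e he : Poly n →ₐ[ℂ] Poly n) (fun p => ?_) hf
    have := X_mem_gradedSpan T' (w p)
    rw [h] at this
    exact (signedPerm_X w e he p) ▸ Submodule.smul_mem _ _ this
  · intro f hf
    refine ⟨(signedPerm w e he).symm f, ?_, (signedPerm w e he).apply_symm_apply f⟩
    have := algHom_mem_gradedSpan (T := T') (T' := T) (s := s)
      ((signedPerm w e he).symm : Poly n →ₐ[ℂ] Poly n) (fun p => ?_) hf
    · rwa [← mul_assoc, hs, one_mul] at this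
    · have h1 := X_mem_gradedSpan T (w.symm p)
      have h2 := h (w.symm p)
      rw [w.apply_symm_apply] at h2
      rw [h2, ← mul_assoc, hs, one_mul]
      exact (signedPerm_symm_X w e he p) ▸ Submodule.smul_mem _ _ h1

theorem glMap_apply (T : Finset (Idx n)) (A : Matrix (Idx n) (Idx n) ℂ) (f : Poly n) :
    glMap T A f = ∑ p, ∑ q, A p q • unitOp T p q f := by
  change (∑ p, ∑ q, A p q • unitOp T p q) f = _
  simp only [LinearMap.sum_apply, LinearMap.smul_apply]

theorem signedPerm_unitOp {T T' : Finset (Idx n)} (w : Equiv.Perm (Idx n)) (e : Idx n → ℂ)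
    (he : ∀ p, e p * e p = 1) (h : ∀ p, p ∈ T ↔ w p ∈ T') (p q : Idx n) (f : Poly n) :
    signedPerm w e he (unitOp T p q f) =
      (e p * e q) • unitOp T' (w p) (w q) (signedPerm w e he f) := by
  have hl : ∀ f, signedPerm w e he (leftOp T p f) = e p • leftOp T' (w p) (signedPerm w e he f) := by
    intro f
    by_cases hp : p ∈ T
    · simp [leftOp, hp, (h p).mp hp, signedPerm_pderiv]
    · simp [leftOp, hp, mt (h p).mpr hp, signedPerm_X]
  have hr : ∀ f, signedPerm w e he (rightOp T q f) =
      e q • rightOp T' (w q) (signedPerm w e he f) := by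
    intro f
    by_cases hq : q ∈ T
    · simp [rightOp, hq, (h q).mp hq, signedPerm_X]
    · simp [rightOp, hq, mt (h q).mpr hq, signedPerm_pderiv]
  rw [unitOp, Module.End.mul_apply, hl, hr, map_smul, smul_smul, unitOp, Module.End.mul_apply]

/-- Conjugation by a signed permutation matrix. -/
def signedConj (w : Equiv.Perm (Idx n)) (e : Idx n → ℂ) (he : ∀ p, e p * e p = 1) :
    Matrix (Idx n) (Idx n) ℂ ≃ₗ⁅ℂ⁆ Matrix (Idx n) (Idx n) ℂ where
  toFun A := Matrix.of fun r s => e (w.symm r) * e (w.symm s) * A (w.symm r) (w.symm s)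
  invFun A := Matrix.of fun p q => e p * e q * A (w p) (w q)
  map_add' A B := by ext; simp [mul_add]
  map_smul' c A := by ext; simp [mul_left_comm]
  map_lie' := by
    intro A B
    have key : ∀ A B : Matrix (Idx n) (Idx n) ℂ,
        (Matrix.of fun r s => e (w.symm r) * e (w.symm s) * (A * B) (w.symm r) (w.symm s)) =
        (Matrix.of fun r s => e (w.symm r) * e (w.symm s) * A (w.symm r) (w.symm s)) *
        (Matrix.of fun r s => e (w.symm r) * e (w.symm s) * B (w.symm r) (w.symm s)) := by
      intro A B
      ext r s
      simp only [Matrix.of_apply, Matrix.mul_apply, Finset.mul_sum]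
      rw [← Equiv.sum_comp w.symm]
      refine Finset.sum_congr rfl fun x _ => ?_
      linear_combination (-e (w.symm r) * e (w.symm s) * A (w.symm r) (w.symm x) *
        B (w.symm x) (w.symm s)) * he (w.symm x)
    simp only [LieRing.of_associative_ring_bracket]
    rw [← key, ← key]
    ext r s
    simp [mul_sub]
  left_inv A := by
    ext p q
    simp only [Matrix.of_apply, Equiv.symm_apply_apply]
    linear_combination (e q * e q * A p q) * he p + A p q * he q
  right_inv A := by
    ext p q
    simp only [Matrix.of_apply, Equiv.apply_symm_apply]
    linear_combination (e (w.symm q) * e (w.symm q) * A p q) * he (w.symm p)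
      + A p q * he (w.symm q)

theorem signedConj_apply (w : Equiv.Perm (Idx n)) (e : Idx n → ℂ) (he : ∀ p, e p * e p = 1)
    (A : Matrix (Idx n) (Idx n) ℂ) (p q : Idx n) :
    signedConj w e he A (w p) (w q) = e p * e q * A p q := by
  change e (w.symm (w p)) * e (w.symm (w q)) * A (w.symm (w p)) (w.symm (w q)) = _
  simp

/-- The hypotheses on `w` and `e` say that the signed permutation matrix preserves the symplectic
form. -/
theorem signedConj_mem_iff {w : Equiv.Perm (Idx n)} {e : Idx n → ℂ} (he : ∀ p, e p * e p = 1)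
    (hbar : ∀ p, w (bar p) = bar (w p)) (hsgn : ∀ p, sgn p * e p * e (bar p) = sgn (w p))
    (A : Matrix (Idx n) (Idx n) ℂ) : signedConj w e he A ∈ G n ↔ A ∈ G n := by
  rw [mem_G_iff, mem_G_iff, w.forall_congr_right.symm]
  refine forall_congr' fun p => ?_
  rw [w.forall_congr_right.symm]
  refine forall_congr' fun q => ?_
  rw [← hbar, ← hbar, signedConj_apply, signedConj_apply, ← hsgn p, ← hsgn q]
  have h0 : e (bar q) * e (bar p) ≠ 0 := by
    have h1 := he (bar q)
    have h2 := he (bar p)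
    exact mul_ne_zero (left_ne_zero_of_mul_eq_one h1) (left_ne_zero_of_mul_eq_one h2)
  constructor
  · intro h
    refine mul_left_cancel₀ h0 (h.trans ?_)
    linear_combination (-(sgn p * sgn q * e (bar p) * e (bar q) * A p q * e q * e q)) * he p
      - (sgn p * sgn q * e (bar p) * e (bar q) * A p q) * he q
  · intro h
    rw [h]
    linear_combination (sgn p * sgn q * e (bar p) * e (bar q) * A p q * e q * e q) * he p
      + (sgn p * sgn q * e (bar p) * e (bar q) * A p q) * he q

theorem symmetricTo_of_perm {T T' : Finset (Idx n)} (w : Equiv.Perm (Idx n)) (e : Idx n → ℂ)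
    (h1 : ∀ p, e p = 1 ∨ e p = -1) (hT : ∀ p, p ∈ T ↔ w p ∈ T')
    (hbar : ∀ p, w (bar p) = bar (w p)) (hsgn : ∀ p, sgn p * e p * e (bar p) = sgn (w p)) :
    SymmetricTo T T' 1 := by
  have he : ∀ p, e p * e p = 1 := fun p => by rcases h1 p with h | h <;> simp [h]
  refine ⟨signedPerm w e he, w, restrictToG (signedConj w e he) (signedConj_mem_iff he hbar hsgn),
    signedPerm_sign w e he h1, map_cartan_restrictToG _ _ fun A => ?_, fun A f => ?_,
    map_signedPerm_gradedSpan (by norm_num) w e he fun p => by simp [hT p]⟩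
  · rw [w.forall_congr_right.symm]
    refine forall_congr' fun p => ?_
    rw [w.forall_congr_right.symm]
    refine forall_congr' fun q => ?_
    rw [signedConj_apply, w.injective.ne_iff, mul_eq_zero]
    have : e p * e q ≠ 0 := mul_ne_zero (left_ne_zero_of_mul_eq_one (he p))
      (left_ne_zero_of_mul_eq_one (he q))
    simp [this]
  · rw [spRep_apply, spRep_apply, restrictToG_apply, glMap_apply, glMap_apply, map_sum]
    refine Eq.trans ?_ (Equiv.sum_comp w _)
    refine Finset.sum_congr rfl fun p _ => ?_
    rw [map_sum]
    refine Eq.trans ?_ (Equiv.sum_comp w _)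
    refine Finset.sum_congr rfl fun q _ => ?_
    rw [map_smul, signedPerm_unitOp w e he hT, signedConj_apply, smul_smul, mul_comm (A.1 p q)]

/-- `A ↦ -Aᵀ`. -/
def negTranspose : Matrix (Idx n) (Idx n) ℂ ≃ₗ⁅ℂ⁆ Matrix (Idx n) (Idx n) ℂ where
  toFun A := -Aᵀ
  invFun A := -Aᵀ
  map_add' A B := by simp [add_comm]
  map_smul' c A := by simp
  map_lie' := by
    intro A B
    simp [LieRing.of_associative_ring_bracket, Matrix.transpose_mul]
  left_inv A := by simp
  right_inv A := by simp

theorem negTranspose_apply (A : Matrix (Idx n) (Idx n) ℂ) (p q : Idx n) :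
    negTranspose A p q = -A q p := rfl

/-- Interchanging the two parts reverses the order of `leftOp` and `rightOp`, which shifts the
diagonal matrix units by constants; tracelessness makes these cancel on sp(2n). -/
theorem trace_eq_zero (A : G n) : ∑ p, A.1 p p = 0 := by
  have h : ∑ p, A.1 p p = -∑ p, A.1 p p := by
    conv_lhs => rw [← Equiv.sum_comp (Equiv.sumComm (Fin n) (Fin n))]
    rw [← Finset.sum_neg_distrib]
    refine Finset.sum_congr rfl fun p _ => ?_
    have := apply_bar_bar A p p
    rw [sgn_mul_self] at this
    change A.1 (bar p) (bar p) = _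
    rw [this]; ring
  exact self_eq_neg.mp h

/-- Passing to the complement turns `leftOp` into `-rightOp` and `rightOp` into `leftOp`, up to the
signs absorbed by `e`. Reversing the products gives the dual matrix action A ↦ -Aᵀ, and degrees
change sign. -/
theorem symmetricTo_compl (T : Finset (Idx n)) : SymmetricTo T Tᶜ (-1) := by
  set e : Idx n → ℂ := fun p => if p ∈ T then 1 else -1 with he'
  have he : ∀ p, e p * e p = 1 := fun p => by simp only [he']; split_ifs <;> norm_num
  have hmem : ∀ A : Matrix (Idx n) (Idx n) ℂ, negTranspose A ∈ G n ↔ A ∈ G n := by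
    intro A
    rw [mem_G_iff, mem_G_iff, forall_comm]
    refine forall_congr' fun p => forall_congr' fun q => ?_
    rw [negTranspose_apply, negTranspose_apply]
    constructor <;> intro h <;> linear_combination -h
  refine ⟨signedPerm 1 e he, 1, restrictToG negTranspose hmem,
    signedPerm_sign 1 e he fun p => by simp only [he']; split_ifs <;> simp,
    map_cartan_restrictToG _ _ fun A => ?_, fun A f => ?_,
    map_signedPerm_gradedSpan (by norm_num) 1 e he fun p => by
      by_cases hp : p ∈ T <;> simp [hp]⟩
  · rw [forall_comm]
    refine forall_congr' fun p => forall_congr' fun q => ?_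
    rw [negTranspose_apply, neg_eq_zero, ne_comm]
  · have hl : ∀ p f, signedPerm 1 e he (leftOp T p f) = rightOp Tᶜ p (signedPerm 1 e he f) := by
      intro p f
      by_cases hp : p ∈ T
      · simp [leftOp, rightOp, hp, signedPerm_pderiv, he']
      · simp [leftOp, rightOp, hp, signedPerm_X, he']
    have hr : ∀ p f, signedPerm 1 e he (rightOp T p f) = -leftOp Tᶜ p (signedPerm 1 e he f) := by
      intro p f
      by_cases hp : p ∈ T
      · simp [leftOp, rightOp, hp, signedPerm_X, he']
      · simp [leftOp, rightOp, hp, signedPerm_pderiv, he']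
    have hu : ∀ p q, signedPerm 1 e he (unitOp T p q f) =
        -(unitOp Tᶜ q p (signedPerm 1 e he f)) -
          if p = q then signedPerm 1 e he f else 0 := by
      intro p q
      rw [unitOp, Module.End.mul_apply, hl, hr, map_neg, ← Module.End.mul_apply, rightOp_leftOp,
        unitOp, LinearMap.add_apply]
      split_ifs <;> simp [sub_eq_add_neg, add_comm]
    rw [spRep_apply, spRep_apply, restrictToG_apply, glMap_apply, glMap_apply, map_sum]
    simp only [map_sum, map_smul, hu, negTranspose_apply, smul_sub, Finset.sum_sub_distrib]
    have h0 : ∑ p, ∑ q, A.1 p q • (if p = q then signedPerm 1 e he f else 0) = 0 := by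
      simp only [smul_ite, smul_zero, Finset.sum_ite_eq, Finset.mem_univ, if_true]
      rw [← Finset.sum_smul, trace_eq_zero, zero_smul]
    rw [h0, sub_zero, Finset.sum_comm]
    simp only [smul_neg, neg_smul]

theorem SymmetricTo.trans {T T' T'' : Finset (Idx n)} {s s' : ℤ} (h : SymmetricTo T T' s)
    (h' : SymmetricTo T' T'' s') : SymmetricTo T T'' (s' * s) := by
  obtain ⟨θ, w, φ, h1, h2, h3, h4⟩ := h
  obtain ⟨θ', w', φ', h1', h2', h3', h4'⟩ := h'
  refine ⟨θ.trans θ', w.trans w', φ.trans φ', fun p => ?_, ?_, fun A f => ?_, fun k => ?_⟩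
  · simp only [AlgEquiv.trans_apply, Equiv.trans_apply]
    rcases h1 p with h | h <;> rcases h1' (w p) with h' | h' <;> simp [h, h']
  · have : ((φ.trans φ' : G n ≃ₗ⁅ℂ⁆ G n) : G n →ₗ[ℂ] G n) =
      (φ' : G n →ₗ[ℂ] G n).comp (φ : G n →ₗ[ℂ] G n) := rfl
    rw [this, Submodule.map_comp, h2, h2']
  · simp only [AlgEquiv.trans_apply, LieEquiv.trans_apply, h3, h3']
  · have : (θ.trans θ').toLinearMap = θ'.toLinearMap.comp θ.toLinearMap := rfl
    rw [this, Submodule.map_comp, h4, h4', mul_assoc]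

/-- The number of `i` such that `i` or `n + i` lies in `T`. -/
def halfCard (T : Finset (Idx n)) : ℕ :=
  (Finset.univ.filter fun i : Fin n => Sum.inl i ∈ T ∨ Sum.inr i ∈ T).card

theorem exists_perm_lt (U : Finset (Fin n)) :
    ∃ σ : Equiv.Perm (Fin n), ∀ i, i ∈ U ↔ (σ i).val < U.card := by
  classical
  have hle : U.card ≤ n := by simpa using U.card_le_univ
  have hc : Fintype.card {i : Fin n // i ∈ U} = Fintype.card {i : Fin n // i.val < U.card} := by
    rw [Fintype.card_coe, Fintype.card_subtype]
    rw [Fin.card_filter_val_lt, min_eq_right hle]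
  let f : {i : Fin n // i ∈ U} ≃ {i : Fin n // i.val < U.card} := Fintype.equivOfCardEq hc
  refine ⟨f.extendSubtype, fun i => ⟨fun hi => f.extendSubtype_mem i hi, fun hi => ?_⟩⟩
  by_contra h
  exact f.extendSubtype_not_mem i h hi

/-- When T_1 is empty each pair {i, n+i} meets `T` in at most one index. A signed exchange within
pairs puts that index among 1, …, n, and a permutation of the pairs puts those meeting `T` first. -/
theorem symmetricTo_initialIdx {T : Finset (Idx n)} (h : T₁ T = ∅) :
    SymmetricTo T (initialIdx n (halfCard T)) 1 := by
  have hT : ∀ i : Fin n, ¬ ((Sum.inl i : Idx n) ∈ T ∧ (Sum.inr i : Idx n) ∈ T) := by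
    intro i hi
    have : i ∈ T₁ T := by simp [T₁, hi]
    rw [h] at this
    exact absurd this (Finset.notMem_empty i)
  obtain ⟨σ, hσ⟩ := exists_perm_lt
    (Finset.univ.filter fun i : Fin n => (Sum.inl i : Idx n) ∈ T ∨ Sum.inr i ∈ T)
  simp only [Finset.mem_filter, Finset.mem_univ, true_and] at hσ
  let w₀ : Idx n → Idx n := Sum.elim
    (fun i => if (Sum.inr i : Idx n) ∈ T then Sum.inr (σ i) else Sum.inl (σ i))
    (fun i => if (Sum.inr i : Idx n) ∈ T then Sum.inl (σ i) else Sum.inr (σ i))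
  have hinj : Function.Injective w₀ := by
    rintro (i | i) (j | j) hij <;> simp only [w₀, Sum.elim_inl, Sum.elim_inr] at hij <;>
      split_ifs at hij <;> simp_all
  let w : Equiv.Perm (Idx n) := Equiv.ofBijective w₀ (Finite.injective_iff_bijective.mp hinj)
  have hw : ∀ p, w p = w₀ p := fun p => rfl
  -- One sign is needed for each exchanged pair, since the exchange of i and n+i reverses the
  -- symplectic form on that pair.
  refine symmetricTo_of_perm w (Sum.elim (fun _ => 1)
    fun i => if (Sum.inr i : Idx n) ∈ T then -1 else 1) ?_ ?_ ?_ ?_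
  · rintro (i | i)
    · simp
    · simp only [Sum.elim_inr]; split_ifs <;> simp
  · rintro (i | i) <;> rw [hw] <;> simp only [w₀, Sum.elim_inl, Sum.elim_inr] <;>
      split_ifs with hi <;> simp only [inl_mem_initialIdx, inr_notMem_initialIdx, halfCard] <;>
      have := hT i <;> have := hσ i <;> tauto
  · rintro (i | i) <;> simp only [hw, bar, Sum.swap_inl, Sum.swap_inr, w₀, Sum.elim_inl,
      Sum.elim_inr] <;> split_ifs <;> rfl
  · rintro (i | i) <;> simp only [hw, bar, Sum.swap_inl, Sum.swap_inr, w₀, Sum.elim_inl,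
      Sum.elim_inr, sgn] <;> split_ifs <;> simp

theorem halfCard_pos {T : Finset (Idx n)} (hT : T.Nonempty) : 1 ≤ halfCard T := by
  obtain ⟨p, hp⟩ := hT
  refine Finset.card_pos.mpr ?_
  rcases p with i | i <;> exact ⟨i, by simp [hp]⟩

theorem halfCard_lt {T : Finset (Idx n)} (hS : (S₁ T).Nonempty) : halfCard T < n := by
  obtain ⟨i, hi⟩ := hS
  simp only [S₁, Finset.mem_filter, Finset.mem_univ, true_and, Finset.mem_compl] at hi
  calc halfCard T < (Finset.univ : Finset (Fin n)).card :=
        Finset.card_lt_card ⟨Finset.subset_univ _, fun h => by simpa [hi] using h (Finset.mem_univ i)⟩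
    _ = n := by simp

theorem halfCard_eq {T : Finset (Idx n)} (hS : S₁ T = ∅) : halfCard T = n := by
  have : (Finset.univ.filter fun i : Fin n => (Sum.inl i : Idx n) ∈ T ∨ Sum.inr i ∈ T) =
      Finset.univ := by
    refine Finset.filter_true_of_mem fun i _ => ?_
    by_contra hi
    have : i ∈ S₁ T := by simpa [S₁] using hi
    rw [hS] at this
    exact absurd this (Finset.notMem_empty i)
  rw [halfCard, this]; simp

theorem S₁_compl (T : Finset (Idx n)) : S₁ Tᶜ = T₁ T := by simp [S₁, T₁]

theorem T₁_compl (T : Finset (Idx n)) : T₁ Tᶜ = S₁ T := by simp [S₁, T₁]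

/-! ### The case `T = {1, …, n}` -/

theorem inl_mem_full (i : Fin n) : (Sum.inl i : Idx n) ∈ initialIdx n n :=
  inl_mem_initialIdx.mpr i.2

/-- The exchange `x_i ↔ x_{n+i}`. -/
def swap (n : ℕ) : Poly n ≃ₐ[ℂ] Poly n :=
  signedPerm (Equiv.sumComm (Fin n) (Fin n)) (fun _ => 1) (fun _ => one_mul 1)

theorem swap_X (p : Idx n) : swap n (X p) = X (bar p) := by
  rw [swap, signedPerm_X, one_smul]; rfl

theorem swap_pderiv (p : Idx n) (f : Poly n) :
    swap n (pderiv p f) = pderiv (bar p) (swap n f) := by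
  rw [swap, signedPerm_pderiv, one_smul]; rfl

theorem swap_swap (f : Poly n) : swap n (swap n f) = f := by
  have : ((swap n : Poly n →ₐ[ℂ] Poly n).comp (swap n : Poly n →ₐ[ℂ] Poly n)) =
      AlgHom.id ℂ (Poly n) := by
    apply MvPolynomial.algHom_ext
    intro p
    simp [swap_X, bar_bar]
  exact DFunLike.congr_fun this f

theorem swap_leftOp (p : Idx n) (f : Poly n) :
    swap n (leftOp (initialIdx n n) p f) = dualOp (initialIdx n n) p (swap n f) := by
  rcases p with i | i
  · simp [leftOp, dualOp, rightOp, bar, inl_mem_full, inr_notMem_initialIdx, swap_pderiv, sgn]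
  · simp [leftOp, dualOp, rightOp, bar, inl_mem_full, inr_notMem_initialIdx, swap_X, sgn]

theorem swap_dualOp (p : Idx n) (f : Poly n) :
    swap n (dualOp (initialIdx n n) p f) = leftOp (initialIdx n n) p (swap n f) := by
  rw [← swap_swap (leftOp _ _ _), swap_leftOp, swap_swap]

/-- The exchange interchanges the two copies of the vector representation, and `symElt` is symmetric
in them: the constants from reordering are form u v and form v u, which cancel. -/
theorem swap_symOp (u v : Idx n) (f : Poly n) :
    swap n (symOp (initialIdx n n) u v f) = symOp (initialIdx n n) u v (swap n f) := by
  simp only [symOp, symElt, LinearMap.add_apply, Module.End.mul_apply, map_add, swap_leftOp,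
    swap_dualOp]
  simp only [← Module.End.mul_apply, dualOp_leftOp, LinearMap.add_apply, LinearMap.smul_apply,
    form_swap v u]
  module

/-- After interchange of the two copies an antisymmetric expression changes sign; the constant `form
u v` in `altOp` makes this exact. -/
theorem swap_altOp (u v : Idx n) (f : Poly n) :
    swap n (altOp (initialIdx n n) u v f) = -altOp (initialIdx n n) u v (swap n f) := by
  simp only [altOp, altElt, LinearMap.sub_apply, LinearMap.smul_apply, Module.End.one_apply,
    Module.End.mul_apply, map_sub, map_smul, swap_leftOp, swap_dualOp]
  simp only [← Module.End.mul_apply, dualOp_leftOp, LinearMap.add_apply, LinearMap.smul_apply,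
    form_swap v u, Module.End.one_apply]
  module

/-! ### Irreducibility for T = {1, …, n} -/

theorem altOp_mem_gradedSpan {T : Finset (Idx n)} {k : ℤ} (u v : Idx n) {f : Poly n}
    (hf : f ∈ gradedSpan T k) : altOp T u v f ∈ gradedSpan T k := by
  have h : ∀ u v, leftOp T u (dualOp T v f) ∈ gradedSpan T k := by
    intro u v
    rw [dualOp, LinearMap.smul_apply, map_smul]
    refine Submodule.smul_mem _ _ ?_
    have := leftOp_mem T _ u _ (rightOp_mem T k (bar v) f hf)
    rwa [sub_add_cancel] at this
  exact Submodule.sub_mem _ (Submodule.sub_mem _ (h u v) (h v u)) (Submodule.smul_mem _ _ hf)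

theorem isSpStable_gradedSpan (T : Finset (Idx n)) (k : ℤ) : IsSpStable T (gradedSpan T k) :=
  isSpStable_iff.mpr fun A f hf => spRep_mem T k A f hf

/-- Each summand is the diagonal operator with eigenvalue α_i - α_{n+i}, and these add up to minus
the degree. -/
theorem sum_altOp {k : ℤ} {f : Poly n} (hf : f ∈ gradedSpan (initialIdx n n) k) :
    ∑ i : Fin n, altOp (initialIdx n n) (Sum.inl i) (Sum.inr i) f = (-k : ℂ) • f := by
  induction hf using Submodule.span_induction with
  | mem f hf =>
    obtain ⟨α, hα, rfl⟩ := hf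
    have h : ∀ i : Fin n, altOp (initialIdx n n) (Sum.inl i) (Sum.inr i) (monomial α 1) =
        ((α (Sum.inl i) : ℂ) - α (Sum.inr i)) • monomial α 1 := by
      intro i
      have := leftOp_mul_rightOp_bar (initialIdx n n) (Sum.inl i)
      rw [show bar (Sum.inl i : Idx n) = Sum.inr i from rfl] at this
      rw [this, LinearMap.smul_apply, LinearMap.add_apply, LinearMap.add_apply,
        unitOp_self_monomial, unitOp_self_monomial, Module.End.one_apply]
      simp only [diagValue, inl_mem_full, inr_notMem_initialIdx, sgn, if_true, if_false,
        Sum.elim_inl]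
      module
    simp only [h]
    rw [← Finset.sum_smul]
    congr 1
    rw [← hα, tdeg_eq_sum, Fintype.sum_sum_type]
    simp only [inl_mem_full, inr_notMem_initialIdx, if_true, if_false]
    push_cast
    simp only [neg_mul, one_mul, Finset.sum_neg_distrib, Finset.sum_sub_distrib]
    ring
  | zero => simp
  | add f g _ _ hf hg => simp only [map_add, Finset.sum_add_distrib, hf, hg, smul_add]
  | smul c f _ hf => simp only [map_smul, ← Finset.smul_sum, hf, smul_comm c]

/-- Since `f` is -1/k times a sum of `altOp` applied to `f`, a single `altOp` on `f` becomes a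
combination of products of two, which preserve `W`. -/
theorem isSpSimple_gradedSpan_full {k : ℤ} (hk : k ≠ 0) :
    IsSpSimple (initialIdx n n) (gradedSpan (initialIdx n n) k) := by
  intro W hW hle h0
  refine IsGlStable.eq_gradedSpan (hW.isGlStable fun u v f hf => ?_) hle h0
  have hk' : (-k : ℂ) ≠ 0 := by simpa using hk
  rw [← W.smul_mem_iff hk', ← map_smul, ← sum_altOp (hle hf), map_sum]
  exact W.sum_mem fun i _ => hW.altOp_altOp_mem _ _ _ _ hf

/-- The part of `A_⟨0⟩` on which `swap` acts by the scalar `ε`. -/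
def signPart (n : ℕ) (ε : ℂ) : Submodule ℂ (Poly n) :=
  gradedSpan (initialIdx n n) 0 ⊓ LinearMap.eqLocus (swap n).toLinearMap (ε • LinearMap.id)

theorem mem_signPart {ε : ℂ} {f : Poly n} :
    f ∈ signPart n ε ↔ f ∈ gradedSpan (initialIdx n n) 0 ∧ swap n f = ε • f := Iff.rfl

theorem isSpStable_signPart (ε : ℂ) : IsSpStable (initialIdx n n) (signPart n ε) := by
  intro u v f hf
  rw [mem_signPart] at hf ⊢
  exact ⟨isSpStable_gradedSpan _ _ u v f hf.1, by rw [swap_symOp, hf.2, map_smul]⟩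

theorem signPart_inter {ε : ℂ} (hε : ε ≠ 0) {f : Poly n} (h1 : f ∈ signPart n ε)
    (h2 : f ∈ signPart n (-ε)) : f = 0 := by
  have h := h1.2.symm.trans h2.2
  simp only [LinearMap.smul_apply, LinearMap.id_apply, neg_smul] at h
  exact (smul_eq_zero.mp (self_eq_neg.mp h)).resolve_left hε

theorem map_mem_of_mem_span {D : Module.End ℂ (Poly n)} {s : Set (Poly n)}
    {N : Submodule ℂ (Poly n)} (h : ∀ g ∈ s, D g ∈ N) {f : Poly n}
    (hf : f ∈ Submodule.span ℂ s) : D f ∈ N := by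
  induction hf using Submodule.span_induction with
  | mem g hg => exact h g hg
  | zero => rw [map_zero]; exact N.zero_mem
  | add f g _ _ hf hg => rw [map_add]; exact N.add_mem hf hg
  | smul c f _ hf => rw [map_smul]; exact N.smul_mem c hf

/-- The `altOp` map `W` into the opposite eigenspace and map the result back into `W`. Hence `W` and
its image together are stable under gl(2n) and fill A_⟨0⟩, and the component in the eigenspace of
`ε` can only be `W`. -/
theorem isSpSimple_signPart {ε : ℂ} (hε : ε ≠ 0) :
    IsSpSimple (initialIdx n n) (signPart n ε) := by
  intro W hW hle h0
  set T := initialIdx n n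
  set W' : Submodule ℂ (Poly n) := Submodule.span ℂ {g | ∃ u v, ∃ f ∈ W, g = altOp T u v f}
  have h1 : ∀ u v, ∀ f ∈ W, altOp T u v f ∈ W' :=
    fun u v f hf => Submodule.subset_span ⟨u, v, f, hf, rfl⟩
  have h2 : ∀ u v, ∀ f ∈ W', altOp T u v f ∈ W := by
    intro u v f hf
    refine map_mem_of_mem_span ?_ hf
    rintro _ ⟨w, z, f, hf, rfl⟩
    exact hW.altOp_altOp_mem _ _ _ _ hf
  -- A `symOp` moves past an `altOp` at the cost of a combination of further `altOp`.
  have h3 : IsSpStable T W' := by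
    intro r s f hf
    refine map_mem_of_mem_span ?_ hf
    rintro _ ⟨u, v, f, hf, rfl⟩
    have := congrArg (fun D : Module.End ℂ (Poly n) => D f) (symOp_altOp_comm T r s u v)
    simp only [LinearMap.sub_apply, Module.End.mul_apply, LinearMap.add_apply,
      LinearMap.smul_apply] at this
    rw [sub_eq_iff_eq_add.mp this]
    exact W'.add_mem (W'.add_mem (W'.add_mem (W'.add_mem (W'.smul_mem _ (h1 _ _ f hf))
      (W'.smul_mem _ (h1 _ _ f hf))) (W'.smul_mem _ (h1 _ _ f hf)))
      (W'.smul_mem _ (h1 _ _ f hf))) (h1 _ _ _ (hW _ _ f hf))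
  have h4 : W' ≤ signPart n (-ε) := by
    refine Submodule.span_le.mpr ?_
    rintro _ ⟨u, v, f, hf, rfl⟩
    refine mem_signPart.mpr ⟨altOp_mem_gradedSpan _ _ (hle hf).1, ?_⟩
    rw [swap_altOp, (mem_signPart.mp (hle hf)).2, map_smul, neg_smul]
  have hM : W ⊔ W' = gradedSpan T 0 := by
    refine IsGlStable.eq_gradedSpan (T := T) (IsSpStable.isGlStable ?_ ?_) ?_ ?_
    · intro u v f hf
      obtain ⟨a, ha, b, hb, rfl⟩ := Submodule.mem_sup.mp hf
      rw [map_add]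
      exact Submodule.add_mem_sup (hW _ _ a ha) (h3 _ _ b hb)
    · intro u v f hf
      obtain ⟨a, ha, b, hb, rfl⟩ := Submodule.mem_sup.mp hf
      rw [map_add, add_comm]
      exact Submodule.add_mem_sup (h2 _ _ b hb) (h1 _ _ a ha)
    · exact sup_le (fun f hf => (hle hf).1) (fun f hf => (h4 hf).1)
    · exact fun h => h0 (le_bot_iff.mp (h ▸ le_sup_left))
  refine le_antisymm hle fun f hf => ?_
  have hf0 : f ∈ W ⊔ W' := by rw [hM]; exact hf.1
  obtain ⟨a, ha, b, hb, rfl⟩ := Submodule.mem_sup.mp hf0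
  have hb' : b ∈ signPart n ε := by
    have := (signPart n ε).sub_mem hf (hle ha)
    rwa [add_sub_cancel_left] at this
  rw [signPart_inter hε hb' (h4 hb), add_zero]
  exact ha

theorem swap_mem_gradedSpan {f : Poly n} (hf : f ∈ gradedSpan (initialIdx n n) 0) :
    swap n f ∈ gradedSpan (initialIdx n n) 0 := by
  have := algHom_mem_gradedSpan (T := initialIdx n n) (T' := initialIdx n n) (s := -1)
    (swap n : Poly n →ₐ[ℂ] Poly n) (fun p => ?_) hf
  · simpa using this
  · have h := X_mem_gradedSpan (initialIdx n n) (bar p)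
    have e : (swap n : Poly n →ₐ[ℂ] Poly n) (X p) = X (bar p) := swap_X p
    rw [e]
    rcases p with i | i <;>
      simpa [bar, inl_mem_full, inr_notMem_initialIdx] using h

theorem signPart_sup : signPart n 1 ⊔ signPart n (-1) = gradedSpan (initialIdx n n) 0 := by
  refine le_antisymm (sup_le inf_le_left inf_le_left) fun f hf => ?_
  have hf' := swap_mem_gradedSpan hf
  have e : f = (2⁻¹ : ℂ) • (f + swap n f) + (2⁻¹ : ℂ) • (f - swap n f) := by module
  rw [e]
  refine Submodule.add_mem_sup (Submodule.smul_mem _ _ ?_) (Submodule.smul_mem _ _ ?_)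
  · exact mem_signPart.mpr ⟨Submodule.add_mem _ hf hf', by rw [map_add, swap_swap]; module⟩
  · exact mem_signPart.mpr ⟨Submodule.sub_mem _ hf hf', by rw [map_sub, swap_swap]; module⟩

/-! ### Highest weight vectors for T = {1, …, n} -/

theorem one_mem_signPart : (1 : Poly n) ∈ signPart n 1 :=
  mem_signPart.mpr ⟨one_mem_gradedSpan _, by simp⟩

theorem generated_eq_signPart {ε : ℂ} (hε : ε ≠ 0) {v : Poly n} (hv : v ∈ signPart n ε)
    (h0 : v ≠ 0) : generated (initialIdx n n) v = ofSpStable (signPart n ε) (isSpStable_signPart ε) :=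
  generated_eq_of_isSpSimple (by rw [polySubmodule_ofSpStable]; exact isSpSimple_signPart hε)
    (by rwa [polySubmodule_ofSpStable]) h0

theorem polySubmodule_generated {ε : ℂ} (hε : ε ≠ 0) {v : Poly n} (hv : v ∈ signPart n ε)
    (h0 : v ≠ 0) : polySubmodule (generated (initialIdx n n) v) = signPart n ε := by
  rw [generated_eq_signPart hε hv h0, polySubmodule_ofSpStable]

theorem isIrrHighestWeight_one :
    IsIrrHighestWeight (generated (initialIdx n n) 1) (-fundWeight n n) 1 := by
  have hp := polySubmodule_generated (n := n) one_ne_zero one_mem_signPart one_ne_zero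
  refine isIrrHighestWeight_of_isSpSimple ?_ ?_ ?_
  · rw [hp]; exact isSpSimple_signPart one_ne_zero
  · rw [hp]; exact one_mem_signPart
  · refine isSingular_of_unitOp one_ne_zero (fun h => ?_) fun p q hpq => ?_
    · rw [show (1 : Poly n) = monomial 0 1 from rfl, spRep_cartan_monomial, LinearMap.neg_apply,
        fundWeight_apply, ← Finset.sum_neg_distrib]
      congr 1
      refine Finset.sum_congr rfl fun i _ => ?_
      simp [monomialWeight, diagValue, inl_mem_full, inr_notMem_initialIdx]
    · have h1 : ∀ p : Idx n, pderiv p (1 : Poly n) = 0 := fun p => pderiv_C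
      rw [unitOp_apply]
      by_cases hq : q ∈ initialIdx n n
      · obtain ⟨j, hj, rfl⟩ := mem_initialIdx.mp hq
        obtain ⟨l, rfl, hl⟩ := stdCoweight_lt_inl hpq
        have hne : l ≠ j := by rintro rfl; omega
        simp [inl_mem_full, hne, h1]
      · simp [hq, h1]

/-- The `2 × 2` minor `x_a x_{n+b} - x_b x_{n+a}`. -/
def minor (a b : Fin n) : Poly n :=
  X (Sum.inl a) * X (Sum.inr b) - X (Sum.inl b) * X (Sum.inr a)

theorem swap_minor (a b : Fin n) : swap n (minor a b) = -minor a b := by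
  simp only [minor, map_sub, map_mul, swap_X, bar, Sum.swap_inl, Sum.swap_inr]; ring

theorem minor_eq (a b : Fin n) : minor a b =
    monomial (Finsupp.single (Sum.inl a) 1 + Finsupp.single (Sum.inr b) 1) 1 -
      monomial (Finsupp.single (Sum.inl b) 1 + Finsupp.single (Sum.inr a) 1) 1 := by
  simp [minor, X, monomial_mul]

theorem minor_mem_gradedSpan (a b : Fin n) : minor a b ∈ gradedSpan (initialIdx n n) 0 := by
  have h : ∀ a b : Fin n, (X (Sum.inl a) * X (Sum.inr b) : Poly n) ∈
      gradedSpan (initialIdx n n) 0 := by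
    intro a b
    simpa [inl_mem_full, inr_notMem_initialIdx] using
      mul_mem_gradedSpan (X_mem_gradedSpan (initialIdx n n) (Sum.inl a))
        (X_mem_gradedSpan (initialIdx n n) (Sum.inr b))
  exact Submodule.sub_mem _ (h a b) (h b a)

theorem minor_mem_signPart (a b : Fin n) : minor a b ∈ signPart n (-1) :=
  mem_signPart.mpr ⟨minor_mem_gradedSpan a b, by rw [swap_minor]; simp⟩

theorem minor_ne_zero {a b : Fin n} (h : a ≠ b) : minor a b ≠ 0 := by
  intro h0
  have := congrArg (eval (Sum.elim (fun i => if i = a then (1 : ℂ) else 0)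
    fun i => if i = b then 1 else 0)) h0
  simp [minor, h, h.symm] at this

theorem pderiv_inl_minor (a b l : Fin n) : pderiv (Sum.inl l) (minor a b) =
    (if l = a then X (Sum.inr b) else 0) - if l = b then X (Sum.inr a) else 0 := by
  simp only [minor, map_sub, Derivation.leibniz, pderiv_X, Pi.single_apply, smul_eq_mul]
  simp [eq_comm]

theorem pderiv_inr_minor (a b l : Fin n) : pderiv (Sum.inr l) (minor a b) =
    (if l = b then X (Sum.inl a) else 0) - if l = a then X (Sum.inl b) else 0 := by
  simp only [minor, map_sub, Derivation.leibniz, pderiv_X, Pi.single_apply, smul_eq_mul]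
  simp [eq_comm]

/-- `isSingular_of_unitOp` does not apply: single matrix units such as ∂_{x_a} ∂_{x_{n+b}} do not
kill the minor. Only the combinations belonging to sp(2n) do, by antisymmetry in the two rows. -/
theorem isSingular_minor {a b : Fin n} (ha : a.val + 2 = n) (hb : b.val + 1 = n) :
    IsSingular (stdCoweight n) (fundWeight n (n - 2) - (2 : ℤ) • fundWeight n n)
      (toOsc (initialIdx n n) (minor a b)) := by
  have hab : a ≠ b := by rintro rfl; omega
  refine ⟨minor_ne_zero hab, fun h => ?_, fun p q hpq => ?_⟩
  · suffices spRep (initialIdx n n) (h : G n) (minor a b) =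
        ((fundWeight n (n - 2) - (2 : ℤ) • fundWeight n n) h) • (minor a b : Poly n) from this
    rw [minor_eq, map_sub, spRep_cartan_monomial, spRep_cartan_monomial, smul_sub]
    have hw : ∀ c d : Fin n, (c = a ∧ d = b) ∨ (c = b ∧ d = a) →
        ∑ i, eps i h * monomialWeight (initialIdx n n)
          (Finsupp.single (Sum.inl c) 1 + Finsupp.single (Sum.inr d) 1) i =
        (fundWeight n (n - 2) - (2 : ℤ) • fundWeight n n) h := by
      intro c d hcd
      rw [LinearMap.sub_apply, LinearMap.smul_apply, fundWeight_apply, fundWeight_apply,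
        Finset.smul_sum, ← Finset.sum_sub_distrib]
      refine Finset.sum_congr rfl fun i _ => ?_
      simp only [monomialWeight, diagValue, inl_mem_full, inr_notMem_initialIdx, if_true, if_false,
        Finsupp.add_apply, Finsupp.single_apply, Sum.inl.injEq, Sum.inr.injEq, reduceCtorEq,
        Fin.ext_iff, i.2, zsmul_eq_mul] at hcd ⊢
      split_ifs <;> first | omega | (push_cast; ring)
    rw [hw a b (Or.inl ⟨rfl, rfl⟩), hw b a (Or.inr ⟨rfl, rfl⟩)]
  · change spRep _ (elt p q) (minor a b) = 0
    have key : ∀ l j : Fin n, l.val < j.val →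
        X (Sum.inl j) * pderiv (Sum.inl l) (minor a b) +
          X (Sum.inr j) * pderiv (Sum.inr l) (minor a b) = 0 := by
      intro l j hlj
      rw [pderiv_inl_minor, pderiv_inr_minor]
      have hlb : l ≠ b := by rintro rfl; omega
      by_cases hla : l = a
      · have hj : j = b := by ext; subst hla; omega
        subst hj; simp [hla, hab]; ring
      · simp [hla, hlb]
    have h2 : ∀ l j : Fin n, pderiv (Sum.inl l) (pderiv (Sum.inr j) (minor a b)) +
        pderiv (Sum.inl j) (pderiv (Sum.inr l) (minor a b)) = 0 := by
      intro l j
      simp only [pderiv_inr_minor, map_sub, apply_ite (pderiv _), map_zero, pderiv_X,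
        Pi.single_apply, Sum.inl.injEq, eq_comm (a := a), eq_comm (a := b)]
      by_cases h1 : l = a <;> by_cases h2 : j = b <;> by_cases h3 : l = b <;> by_cases h4 : j = a <;>
        simp [h1, h2, h3, h4, hab, hab.symm]
    rw [spRep_elt, LinearMap.sub_apply, LinearMap.smul_apply, unitOp_apply, unitOp_apply]
    rcases q with j | j
    · obtain ⟨l, rfl, hl⟩ := stdCoweight_lt_inl hpq
      have hne : l ≠ j := by rintro rfl; omega
      have := key l j hl
      simp only [inl_mem_full, bar, Sum.swap_inl, inr_notMem_initialIdx, if_true, if_false, sgn,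
        Sum.elim_inl, Sum.inl.injEq, hne, one_mul, one_smul, sub_zero]
      linear_combination -this
    · rcases p with l | l
      · have := h2 l j
        simp only [inl_mem_full, bar, Sum.swap_inl, Sum.swap_inr, inr_notMem_initialIdx, if_true,
          if_false, sgn, Sum.elim_inl, Sum.elim_inr, one_mul, neg_smul, one_smul, sub_neg_eq_add]
        exact this
      · have hlj : j.val < l.val := by
          simp only [coweightExt, stdCoweight, Sum.elim_inr] at hpq
          exact_mod_cast (by linarith : (j.val : ℝ) < l.val)
        have hne : j ≠ l := by rintro rfl; omega
        have := key j l hlj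
        simp only [inl_mem_full, bar, Sum.swap_inr, inr_notMem_initialIdx, if_true, if_false, sgn,
          Sum.elim_inr, Sum.inl.injEq, hne, one_mul, one_smul, sub_zero, neg_mul_neg]
        linear_combination this

theorem isIrrHighestWeight_minor {a b : Fin n} (ha : a.val + 2 = n) (hb : b.val + 1 = n) :
    IsIrrHighestWeight (generated (initialIdx n n) (minor a b))
      (fundWeight n (n - 2) - (2 : ℤ) • fundWeight n n) (minor a b) := by
  have hab : a ≠ b := by rintro rfl; omega
  have hp := polySubmodule_generated (n := n) (neg_ne_zero.mpr one_ne_zero)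
    (minor_mem_signPart a b) (minor_ne_zero hab)
  refine isIrrHighestWeight_of_isSpSimple ?_ ?_ (isSingular_minor ha hb)
  · rw [hp]; exact isSpSimple_signPart (neg_ne_zero.mpr one_ne_zero)
  · rw [hp]; exact minor_mem_signPart a b

theorem isIrrHighestWeight_full_pos (hn : 1 ≤ n) {k : ℕ} (hk : 0 < k) :
    IsIrrHighestWeight (piece (initialIdx n n) k)
      ((k : ℤ) • fundWeight n (n - 1) - ((k : ℤ) + 1) • fundWeight n n)
      (X (Sum.inr ⟨n - 1, by omega⟩) ^ k) := by
  refine isIrrHighestWeight_of_isSpSimple ?_ ?_ ?_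
  · rw [polySubmodule_piece]; exact isSpSimple_gradedSpan_full (by omega)
  · rw [polySubmodule_piece]
    have := X_pow_mem_gradedSpan (initialIdx n n) (Sum.inr ⟨n - 1, by omega⟩) k
    rwa [if_neg inr_notMem_initialIdx] at this
  · refine isSingular_X_pow (fun p q => unitOp_X_pow_of_notMem inr_notMem_initialIdx ?_ _) ?_
    · intro p hp
      obtain ⟨j, rfl⟩ := stdCoweight_lt_inr_last rfl hp
      exact inl_mem_full j
    · intro a
      simp only [LinearMap.sub_apply, LinearMap.smul_apply, fundWeight_apply, Finset.smul_sum,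
        ← Finset.sum_sub_distrib, monomialWeight_initialIdx_single]
      refine Finset.sum_congr rfl fun i _ => ?_
      simp only [zsmul_eq_mul, Sum.inr.injEq, Fin.ext_iff, reduceCtorEq, if_false, i.2]
      split_ifs <;> first | omega | (push_cast; ring)

theorem isIrrHighestWeight_full_neg (hn : 1 ≤ n) {k : ℕ} (hk : 0 < k) :
    IsIrrHighestWeight (piece (initialIdx n n) (-k))
      ((k : ℤ) • fundWeight n (n - 1) - ((k : ℤ) + 1) • fundWeight n n)
      (X (Sum.inl ⟨n - 1, by omega⟩) ^ k) := by
  have := isIrrHighestWeight_neg hn le_rfl (k := -(k : ℤ)) (by omega)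
    (isSpSimple_gradedSpan_full (by omega))
  have e : ((k : ℤ) • fundWeight n (n - 1) - ((k : ℤ) + 1) • fundWeight n n) =
      (-(-(k : ℤ)) • fundWeight n (n - 1) + (-(k : ℤ) - 1) • fundWeight n n) := by
    module
  rw [e]
  simpa using this

/-! ### Standard monomials: spanning -/

section Pi

theorem exists_eq_add_single {ι : Type*} [DecidableEq ι] {k : ι → ℕ} {c : ι} (h : k c ≠ 0) :
    ∃ k' : ι → ℕ, k = k' + Pi.single c 1 := by
  refine ⟨k - Pi.single c 1, (tsub_add_cancel_of_le fun i => ?_).symm⟩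
  by_cases hi : i = c
  · subst hi; simp; omega
  · simp [hi]

variable {ι : Type*} [Fintype ι] [DecidableEq ι]

theorem pi_nat_induction {P : (ι → ℕ) → Prop} (h0 : P 0)
    (h1 : ∀ k c, P k → P (k + Pi.single c 1)) (k : ι → ℕ) : P k := by
  induction hs : ∑ i, k i generalizing k with
  | zero =>
    have : k = 0 := funext fun i => by simpa using (Finset.sum_eq_zero_iff.mp hs) i
    rwa [this]
  | succ s ih =>
    obtain ⟨c, -, hc⟩ := Finset.exists_ne_zero_of_sum_ne_zero (s := Finset.univ) (f := k) (by omega)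
    have hle : Pi.single c 1 ≤ k := by
      intro i
      by_cases h : i = c
      · subst h; simp; omega
      · simp [h]
    rw [← tsub_add_cancel_of_le hle]
    refine h1 _ _ (ih _ ?_)
    have := congrArg (fun f : ι → ℕ => ∑ i, f i) (tsub_add_cancel_of_le hle)
    simp only [Pi.add_apply, Finset.sum_add_distrib, Finset.sum_pi_single', Finset.mem_univ,
      if_true] at this
    omega

theorem sum_add_single (k : ι → ℕ) (c : ι) (φ : ι → ℕ) :
    ∑ i, (k + Pi.single c 1 : ι → ℕ) i * φ i = ∑ i, k i * φ i + φ c := by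
  simp [add_mul, Finset.sum_add_distrib, Pi.single_apply]

theorem sum_add_single_one (k : ι → ℕ) (c : ι) :
    ∑ i, (k + Pi.single c 1 : ι → ℕ) i = ∑ i, k i + 1 := by
  simpa using sum_add_single k c 1

theorem prod_pow_add_single {M : Type*} [CommMonoid M] (f : ι → M) (k : ι → ℕ) (c : ι) :
    ∏ i, f i ^ (k + Pi.single c 1 : ι → ℕ) i = (∏ i, f i ^ k i) * f c := by
  simp only [Pi.add_apply, pow_add, Finset.prod_mul_distrib]
  congr 1
  rw [Finset.prod_eq_single c (fun i _ hi => by simp [hi]) (by simp)]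
  simp

end Pi

/-- `x_t + s y_t`. -/
def linForm (t : Fin n) : Polynomial (Poly n) :=
  Polynomial.C (X (Sum.inl t)) + Polynomial.X * Polynomial.C (X (Sum.inr t))

/-- `∏ (x_t + s y_t)^{k_t}`. -/
def linProd (k : Fin n → ℕ) : Polynomial (Poly n) := ∏ t, linForm t ^ k t

/-- The polarization of the monomial `∏ x_t^{k_t}` of degree `r` in the second variables. -/
def polarized (k : Fin n → ℕ) (r : ℕ) : Poly n := (linProd k).coeff r

/-- The product of the `2 × 2` minors with exponents `m`. -/
def minorProd (m : Pairs n → ℕ) : Poly n := ∏ a : Pairs n, minor a.1.1 a.1.2 ^ m a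

/-! ### Recursions and symmetries of polarized monomials and minors -/

theorem linProd_add_single (k : Fin n → ℕ) (c : Fin n) :
    linProd (k + Pi.single c 1) = linProd k * linForm c := prod_pow_add_single _ _ _

theorem minorProd_add_single (m : Pairs n → ℕ) (a : Pairs n) :
    minorProd (m + Pi.single a 1) = minorProd m * minor a.1.1 a.1.2 := prod_pow_add_single _ _ _

theorem polarized_add_single_zero (k : Fin n → ℕ) (c : Fin n) :
    polarized (k + Pi.single c 1) 0 = X (Sum.inl c) * polarized k 0 := by
  rw [polarized, linProd_add_single, linForm, mul_add, ← mul_assoc, Polynomial.coeff_add,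
    Polynomial.coeff_mul_C, Polynomial.coeff_mul_C, Polynomial.coeff_mul_X_zero, polarized]
  ring

theorem polarized_add_single_succ (k : Fin n → ℕ) (c : Fin n) (r : ℕ) :
    polarized (k + Pi.single c 1) (r + 1) =
      X (Sum.inl c) * polarized k (r + 1) + X (Sum.inr c) * polarized k r := by
  rw [polarized, linProd_add_single, linForm, mul_add, ← mul_assoc, Polynomial.coeff_add,
    Polynomial.coeff_mul_C, Polynomial.coeff_mul_C, Polynomial.coeff_mul_X, polarized, polarized]
  ring

theorem linProd_zero : linProd (0 : Fin n → ℕ) = 1 := by simp [linProd]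

theorem polarized_zero_zero : polarized (0 : Fin n → ℕ) 0 = 1 := by
  simp [polarized, linProd_zero]

theorem polarized_zero_succ (r : ℕ) : polarized (0 : Fin n → ℕ) (r + 1) = 0 := by
  simp [polarized, linProd_zero, Polynomial.coeff_one]

theorem polarized_zero_right (k : Fin n → ℕ) :
    polarized k 0 = ∏ t, (X (Sum.inl t) : Poly n) ^ k t := by
  induction k using pi_nat_induction with
  | h0 => simp [polarized_zero_zero]
  | h1 k c ih => rw [polarized_add_single_zero, ih, prod_pow_add_single, mul_comm]

theorem polarized_eq_zero (k : Fin n → ℕ) {r : ℕ} (h : ∑ t, k t < r) : polarized k r = 0 := by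
  induction k using pi_nat_induction generalizing r with
  | h0 =>
    obtain ⟨r, rfl⟩ := Nat.exists_eq_succ_of_ne_zero (by omega : r ≠ 0)
    exact polarized_zero_succ r
  | h1 k c ih =>
    rw [sum_add_single_one] at h
    obtain ⟨r, rfl⟩ := Nat.exists_eq_succ_of_ne_zero (by omega : r ≠ 0)
    rw [Nat.succ_eq_add_one, polarized_add_single_succ, ih (by omega), ih (by omega)]; simp

/-- The exchange turns each factor x_t + s y_t into y_t + s x_t and so reverses the coefficients of
the product. The middle coefficient, the one in the basis, is fixed. -/
theorem swap_polarized (k : Fin n → ℕ) {r j : ℕ} (h : r + j = ∑ t, k t) :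
    swap n (polarized k r) = polarized k j := by
  induction k using pi_nat_induction generalizing r j with
  | h0 =>
    have h1 : r = 0 ∧ j = 0 := by simpa using h
    rw [h1.1, h1.2, polarized_zero_zero, map_one]
  | h1 k c ih =>
    rw [sum_add_single_one] at h
    rcases r with _ | r <;> rcases j with _ | j
    · omega
    · rw [polarized_add_single_zero, polarized_add_single_succ, map_mul, swap_X,
        polarized_eq_zero k (r := j + 1) (by omega), ih (by omega : 0 + j = _)]
      simp [bar]
    · rw [polarized_add_single_zero, polarized_add_single_succ, map_add, map_mul, map_mul, swap_X,
        swap_X, polarized_eq_zero k (r := r + 1) (by omega), ih (by omega : r + 0 = _)]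
      simp [bar]
    · rw [polarized_add_single_succ, polarized_add_single_succ, map_add, map_mul, map_mul, swap_X,
        swap_X, ih (by omega : r + 1 + j = _), ih (by omega : r + (j + 1) = _)]
      simp only [bar, Sum.swap_inl, Sum.swap_inr]
      ring

theorem swap_minorProd (m : Pairs n → ℕ) :
    swap n (minorProd m) = (-1) ^ (∑ a, m a) * minorProd m := by
  simp only [minorProd, map_prod, map_pow, swap_minor, neg_pow (minor _ _),
    Finset.prod_mul_distrib, Finset.prod_pow_eq_pow_sum]

theorem polarized_mem_gradedSpan (k : Fin n → ℕ) (r : ℕ) :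
    polarized k r ∈ gradedSpan (initialIdx n n) (2 * r - ∑ t, (k t : ℤ)) := by
  have hx : ∀ c : Fin n, (X (Sum.inl c) : Poly n) ∈ gradedSpan (initialIdx n n) (-1) := by
    intro c
    simpa [inl_mem_full] using X_mem_gradedSpan (initialIdx n n) (Sum.inl c)
  have hy : ∀ c : Fin n, (X (Sum.inr c) : Poly n) ∈ gradedSpan (initialIdx n n) 1 := by
    intro c
    simpa [inr_notMem_initialIdx] using X_mem_gradedSpan (initialIdx n n) (Sum.inr c)
  simp only [← Nat.cast_sum]
  induction k using pi_nat_induction generalizing r with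
  | h0 =>
    rcases r with _ | r
    · simpa [polarized_zero_zero] using one_mem_gradedSpan _
    · rw [polarized_zero_succ]; exact Submodule.zero_mem _
  | h1 k c ih =>
    rw [sum_add_single_one]
    rcases r with _ | r
    · rw [polarized_add_single_zero]
      convert mul_mem_gradedSpan (hx c) (ih 0) using 1
      push_cast; ring
    · rw [polarized_add_single_succ]
      refine Submodule.add_mem _ ?_ ?_
      · convert mul_mem_gradedSpan (hx c) (ih (r + 1)) using 1
        push_cast; ring
      · convert mul_mem_gradedSpan (hy c) (ih r) using 1
        push_cast; ring

theorem minorProd_mem_gradedSpan (m : Pairs n → ℕ) :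
    minorProd m ∈ gradedSpan (initialIdx n n) 0 := by
  have := prod_mem_gradedSpan (T := initialIdx n n) (Finset.univ : Finset (Pairs n))
    (fun a _ => pow_mem_gradedSpan (minor_mem_gradedSpan a.1.1 a.1.2) (m a))
  simpa [minorProd] using this

/-- The span of the products of a polarized monomial and minors, of given degree. -/
def standardSpan (n : ℕ) (w : ℤ) : Submodule ℂ (Poly n) :=
  Submodule.span ℂ {f | ∃ (k : Fin n → ℕ) (r : ℕ) (m : Pairs n → ℕ),
    2 * (r : ℤ) - ((∑ t, k t : ℕ) : ℤ) = w ∧ f = polarized k r * minorProd m}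

theorem mem_standardSpan (k : Fin n → ℕ) (r : ℕ) (m : Pairs n → ℕ) {w : ℤ}
    (h : 2 * (r : ℤ) - ((∑ t, k t : ℕ) : ℤ) = w) : polarized k r * minorProd m ∈ standardSpan n w :=
  Submodule.subset_span ⟨k, r, m, h, rfl⟩

theorem minor_swap (a b : Fin n) : minor b a = -minor a b := by
  simp only [minor]; ring

theorem minor_self (a : Fin n) : minor a a = 0 := by
  simp only [minor]; ring

theorem minor_mul_mem_standardSpan (c t : Fin n) (k : Fin n → ℕ) (r : ℕ) (m : Pairs n → ℕ) {w : ℤ}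
    (h : 2 * (r : ℤ) - ((∑ t, k t : ℕ) : ℤ) = w) :
    minor c t * (polarized k r * minorProd m) ∈ standardSpan n w := by
  rcases lt_trichotomy c t with hlt | rfl | hlt
  · have := mem_standardSpan k r (m + Pi.single ⟨(c, t), hlt⟩ 1) h
    rw [minorProd_add_single] at this
    convert this using 1; ring
  · rw [minor_self, zero_mul]; exact Submodule.zero_mem _
  · have := mem_standardSpan k r (m + Pi.single ⟨(t, c), hlt⟩ 1) h
    rw [minorProd_add_single] at this
    rw [minor_swap t c, neg_mul]
    refine Submodule.neg_mem _ ?_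
    convert this using 1; ring

/-- The Clebsch–Gordan relation for multiplication by `y_c`. -/
theorem X_inr_mul_linProd (c : Fin n) (k : Fin n → ℕ) :
    Polynomial.C (((∑ t, k t : ℕ) : Poly n) + 1) * (Polynomial.C (X (Sum.inr c)) * linProd k) =
      Polynomial.derivative (linProd (k + Pi.single c 1)) -
        ∑ t, Polynomial.C ((k t : Poly n) * minor c t) * linProd (k - Pi.single t 1) := by
  have hd : ∀ t, Polynomial.derivative (linForm t : Polynomial (Poly n)) =
      Polynomial.C (X (Sum.inr t)) := by
    intro t; simp [linForm]
  have hsplit : ∀ t, k t ≠ 0 → linProd k = linProd (k - Pi.single t 1) * linForm t := by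
    intro t ht
    obtain ⟨k', rfl⟩ := exists_eq_add_single ht
    rw [linProd_add_single, add_tsub_cancel_right]
  have hP : Polynomial.derivative (linProd k) =
      ∑ t, Polynomial.C ((k t : Poly n) * X (Sum.inr t)) * linProd (k - Pi.single t 1) := by
    rw [linProd, Polynomial.derivative_prod_finset]
    refine Finset.sum_congr rfl fun t _ => ?_
    by_cases ht : k t = 0
    · simp [ht]
    obtain ⟨k', rfl⟩ := exists_eq_add_single ht
    have he : ∏ j ∈ Finset.univ.erase t, linForm j ^ (k' + Pi.single t 1 : Fin n → ℕ) j =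
        ∏ j ∈ Finset.univ.erase t, linForm j ^ k' j :=
      Finset.prod_congr rfl fun j hj => by simp [Finset.ne_of_mem_erase hj]
    rw [add_tsub_cancel_right, he, linProd, ← Finset.mul_prod_erase _ _ (Finset.mem_univ t),
      Polynomial.derivative_pow, hd]
    simp only [Pi.add_apply, Pi.single_eq_same, Nat.add_sub_cancel, map_mul]
    push_cast
    ring
  have hK : Polynomial.C ((∑ t, k t : ℕ) : Poly n) * linProd k =
      ∑ t, Polynomial.C (k t : Poly n) * linForm t * linProd (k - Pi.single t 1) := by
    rw [Nat.cast_sum, map_sum, Finset.sum_mul]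
    refine Finset.sum_congr rfl fun t _ => ?_
    by_cases ht : k t = 0
    · simp [ht]
    · rw [hsplit t ht]; ring
  -- Because x_c y_t - x_t y_c equals ℓ_c y_t - ℓ_t y_c for ℓ = x + s y, the sum of minors is
  -- computed by Leibniz for P' and by ℓ_t · P_{k - e_t} = P_k.
  have hsum : ∑ t, Polynomial.C ((k t : Poly n) * minor c t) * linProd (k - Pi.single t 1) =
      linForm c * Polynomial.derivative (linProd k) -
        Polynomial.C (X (Sum.inr c)) * (Polynomial.C ((∑ t, k t : ℕ) : Poly n) * linProd k) := by
    rw [hP, hK, Finset.mul_sum, Finset.mul_sum, ← Finset.sum_sub_distrib]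
    refine Finset.sum_congr rfl fun t _ => ?_
    simp only [minor, linForm, map_mul, map_sub]
    ring
  rw [hsum, linProd_add_single, Polynomial.derivative_mul, hd, map_add, map_one]
  ring

theorem X_inr_mul_polarized (c : Fin n) (k : Fin n → ℕ) (r : ℕ) (g : Poly n) :
    (((∑ t, k t : ℕ) : ℂ) + 1) • (X (Sum.inr c) * (polarized k r * g)) =
      ((r : ℂ) + 1) • (polarized (k + Pi.single c 1) (r + 1) * g) -
        ∑ t, (k t : ℂ) • (minor c t * (polarized (k - Pi.single t 1) r * g)) := by
  have h : (((∑ t, k t : ℕ) : Poly n) + 1) * (X (Sum.inr c) * polarized k r) =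
      polarized (k + Pi.single c 1) (r + 1) * ((r : Poly n) + 1) -
        ∑ t, (k t : Poly n) * minor c t * polarized (k - Pi.single t 1) r := by
    have h := congrArg (fun p : Polynomial (Poly n) => p.coeff r) (X_inr_mul_linProd c k)
    simp only [Polynomial.coeff_C_mul, Polynomial.coeff_sub, Polynomial.coeff_derivative,
      Polynomial.finsetSum_coeff] at h
    exact h
  have hs : ∑ t, (k t : ℂ) • (minor c t * (polarized (k - Pi.single t 1) r * g)) =
      (∑ t, (k t : Poly n) * minor c t * polarized (k - Pi.single t 1) r) * g := by
    rw [Finset.sum_mul]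
    refine Finset.sum_congr rfl fun t _ => ?_
    rw [Algebra.smul_def, map_natCast]; ring
  rw [hs, Algebra.smul_def, Algebra.smul_def, map_add, map_add, map_natCast, map_natCast, map_one]
  linear_combination g * h

/-! ### Spanning by polarized monomials and minors -/

theorem X_inr_mul_polarized_mem (c : Fin n) {w : ℤ} (k : Fin n → ℕ) (r : ℕ) (m : Pairs n → ℕ)
    (hw : 2 * (r : ℤ) - ((∑ t, k t : ℕ) : ℤ) = w) :
    X (Sum.inr c) * (polarized k r * minorProd m) ∈ standardSpan n (w + 1) := by
  have h0 : ((∑ t, k t : ℕ) : ℂ) + 1 ≠ 0 := Nat.cast_add_one_ne_zero _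
  refine ((standardSpan n (w + 1)).smul_mem_iff h0).mp ?_
  rw [X_inr_mul_polarized]
  refine Submodule.sub_mem _ (Submodule.smul_mem _ _ (mem_standardSpan _ _ _ ?_))
    (Submodule.sum_mem _ fun t _ => ?_)
  · rw [sum_add_single_one]; push_cast at hw ⊢; linarith
  · by_cases ht : k t = 0
    · rw [ht, Nat.cast_zero, zero_smul]; exact Submodule.zero_mem _
    · obtain ⟨k', rfl⟩ := exists_eq_add_single ht
      refine Submodule.smul_mem _ _ (minor_mul_mem_standardSpan _ _ _ _ _ ?_)
      rw [sum_add_single_one] at hw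
      rw [add_tsub_cancel_right]; push_cast at hw ⊢; linarith

theorem X_inr_mul_mem_standardSpan (c : Fin n) {w : ℤ} {f : Poly n} (hf : f ∈ standardSpan n w) :
    X (Sum.inr c) * f ∈ standardSpan n (w + 1) := by
  induction hf using Submodule.span_induction with
  | mem f hf =>
    obtain ⟨k, r, m, hw, rfl⟩ := hf
    exact X_inr_mul_polarized_mem c k r m hw
  | zero => simp
  | add f g _ _ hf hg => rw [mul_add]; exact Submodule.add_mem _ hf hg
  | smul c f _ hf => rw [mul_smul_comm]; exact Submodule.smul_mem _ _ hf

theorem X_inl_mul_mem_standardSpan (c : Fin n) {w : ℤ} {f : Poly n} (hf : f ∈ standardSpan n w) :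
    X (Sum.inl c) * f ∈ standardSpan n (w - 1) := by
  induction hf using Submodule.span_induction with
  | mem f hf =>
    obtain ⟨k, r, m, hw, rfl⟩ := hf
    rcases r with _ | r
    · rw [← mul_assoc, ← polarized_add_single_zero]
      refine mem_standardSpan _ _ _ ?_
      rw [sum_add_single_one]; push_cast at hw ⊢; linarith
    · have e : X (Sum.inl c) * (polarized k (r + 1) * minorProd m) =
          polarized (k + Pi.single c 1) (r + 1) * minorProd m -
            X (Sum.inr c) * (polarized k r * minorProd m) := by
        rw [polarized_add_single_succ]; ring
      rw [e]
      refine Submodule.sub_mem _ (mem_standardSpan _ _ _ ?_) ?_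
      · rw [sum_add_single_one]; push_cast at hw ⊢; linarith
      · have := X_inr_mul_mem_standardSpan c (mem_standardSpan k r m rfl)
        convert this using 2
        push_cast at hw ⊢; linarith
  | zero => simp
  | add f g _ _ hf hg => rw [mul_add]; exact Submodule.add_mem _ hf hg
  | smul c f _ hf => rw [mul_smul_comm]; exact Submodule.smul_mem _ _ hf

/-- The spans contain 1 and are carried into one another by multiplication by the variables, with
the right shift of degree; every monomial is built this way. -/
theorem gradedSpan_le_standardSpan (w : ℤ) :
    gradedSpan (initialIdx n n) w ≤ standardSpan n w := by
  have hX : ∀ (p : Idx n) (w : ℤ) (f : Poly n), f ∈ standardSpan n w →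
      X p * f ∈ standardSpan n (w + if p ∈ initialIdx n n then -1 else 1) := by
    rintro (c | c) w f hf
    · simpa [inl_mem_full, sub_eq_add_neg] using X_inl_mul_mem_standardSpan c hf
    · simpa [inr_notMem_initialIdx] using X_inr_mul_mem_standardSpan c hf
  refine Submodule.span_le.mpr ?_
  rintro _ ⟨α, rfl, rfl⟩
  change (monomial α 1 : Poly n) ∈ standardSpan n (tdeg (initialIdx n n) α)
  obtain ⟨k, rfl⟩ : ∃ k : Idx n → ℕ, α = Finsupp.equivFunOnFinite.symm k :=
    ⟨α, (Finsupp.equivFunOnFinite.symm_apply_apply α).symm⟩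
  induction k using pi_nat_induction with
  | h0 =>
    have := mem_standardSpan (n := n) 0 0 0 rfl
    have e : Finsupp.equivFunOnFinite.symm (0 : Idx n → ℕ) = 0 := by ext; simp
    rw [e]
    simpa [polarized_zero_zero, minorProd, tdeg] using this
  | h1 k c ih =>
    have e : Finsupp.equivFunOnFinite.symm (k + Pi.single c 1) =
        Finsupp.equivFunOnFinite.symm k + Finsupp.single c 1 := by
      ext p; simp [Finsupp.single_apply, Pi.single_apply, eq_comm]
    rw [e, tdeg_add_single, ← mul_one (1 : ℂ), ← monomial_mul, mul_comm]
    exact hX c _ _ ih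

/-- No two of the columns of the tableau of `(k, m)` are nested. -/
def IsNestFree (k : Fin n → ℕ) (m : Pairs n → ℕ) : Prop :=
  (∀ (a : Pairs n) (t : Fin n), a.1.2 < t → m a * k t = 0) ∧
  ∀ a b : Pairs n, a.1.1 < b.1.1 → b.1.2 < a.1.2 → m a * m b = 0

/-- The generating polynomial of the products of polarized monomials and minors. -/
def genPoly (k : Fin n → ℕ) (m : Pairs n → ℕ) : Polynomial (Poly n) :=
  linProd k * Polynomial.C (minorProd m)

theorem coeff_genPoly (k : Fin n → ℕ) (m : Pairs n → ℕ) (r : ℕ) :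
    (genPoly k m).coeff r = polarized k r * minorProd m := Polynomial.coeff_mul_C _ _ _

/-- The straightening law. -/
theorem genPoly_mem_span (k : Fin n → ℕ) (m : Pairs n → ℕ) :
    genPoly k m ∈ Submodule.span ℂ {p | ∃ k' m', IsNestFree k' m' ∧ ∑ t, k' t = ∑ t, k t ∧
      p = genPoly (n := n) k' m'} := by
  -- A factor ℓ_t is viewed as an arc from -1 to t, a minor as an arc from i to j; both kinds of
  -- forbidden pairs are then nested arcs. The Plücker relation replaces nested arcs by crossing and
  -- by disjoint ones, which lowers the sum of squared lengths.
  induction hμ : ∑ t, k t * (t.val + 1) ^ 2 + ∑ a, m a * (a.1.2.val - a.1.1.val) ^ 2 using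
    Nat.strong_induction_on generalizing k m with
  | _ μ ih =>
  by_cases h1 : ∃ (a : Pairs n) (t : Fin n), a.1.2 < t ∧ m a ≠ 0 ∧ k t ≠ 0
  · obtain ⟨⟨⟨i, j⟩, hij⟩, t, hjt, hm, hk⟩ := h1
    obtain ⟨m, rfl⟩ := exists_eq_add_single hm
    obtain ⟨k, rfl⟩ := exists_eq_add_single hk
    have hit : i < t := lt_trans hij hjt
    have e : genPoly (k + Pi.single t 1) (m + Pi.single ⟨(i, j), hij⟩ 1) =
        genPoly (k + Pi.single j 1) (m + Pi.single ⟨(i, t), hit⟩ 1) -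
          genPoly (k + Pi.single i 1) (m + Pi.single ⟨(j, t), hjt⟩ 1) := by
      simp only [genPoly, linProd_add_single, minorProd_add_single, minor, linForm, map_mul,
        map_sub]
      ring
    simp only [sum_add_single_one] at ih ⊢
    rw [e]
    rw [sum_add_single, sum_add_single] at hμ
    have hij' : i.val < j.val := hij
    have hjt' : j.val < t.val := hjt
    refine Submodule.sub_mem _ ?_ ?_
    · have := ih _ ?_ (k + Pi.single j 1) (m + Pi.single ⟨(i, t), hit⟩ 1) rfl
      · rwa [sum_add_single_one] at this
      · rw [← hμ, sum_add_single, sum_add_single]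
        dsimp only
        obtain ⟨x, hx⟩ := Nat.exists_eq_add_of_lt hij'
        obtain ⟨y, hy⟩ := Nat.exists_eq_add_of_lt hjt'
        rw [hy, hx, show i.val + x + 1 + y + 1 - i.val = x + y + 2 by omega,
          show i.val + x + 1 - i.val = x + 1 by omega]
        nlinarith
    · have := ih _ ?_ (k + Pi.single i 1) (m + Pi.single ⟨(j, t), hjt⟩ 1) rfl
      · rwa [sum_add_single_one] at this
      · rw [← hμ, sum_add_single, sum_add_single]
        dsimp only
        obtain ⟨x, hx⟩ := Nat.exists_eq_add_of_lt hij'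
        obtain ⟨y, hy⟩ := Nat.exists_eq_add_of_lt hjt'
        rw [hy, hx, show i.val + x + 1 + y + 1 - (i.val + x + 1) = y + 1 by omega,
          show i.val + x + 1 - i.val = x + 1 by omega]
        nlinarith
  by_cases h2 : ∃ a b : Pairs n, a.1.1 < b.1.1 ∧ b.1.2 < a.1.2 ∧ m a ≠ 0 ∧ m b ≠ 0
  · obtain ⟨⟨⟨i, j⟩, hij⟩, ⟨⟨c, d⟩, hcd⟩, hic, hdj, ha, hb⟩ := h2
    obtain ⟨m, rfl⟩ := exists_eq_add_single ha
    have hb' : m ⟨(c, d), hcd⟩ ≠ 0 := by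
      have hne : (⟨(c, d), hcd⟩ : Pairs n) ≠ ⟨(i, j), hij⟩ := by
        intro h
        simp only [Subtype.mk.injEq, Prod.mk.injEq] at h
        exact absurd hic (by simp [h.1])
      simpa [Pi.single_apply, hne] using hb
    obtain ⟨m, rfl⟩ := exists_eq_add_single hb'
    have hic' : i.val < c.val := hic
    have hcd' : c.val < d.val := hcd
    have hdj' : d.val < j.val := hdj
    have h1 : i < d := lt_trans hic hcd
    have h2 : c < j := lt_trans hcd hdj
    have e : genPoly k (m + Pi.single ⟨(c, d), hcd⟩ 1 + Pi.single ⟨(i, j), hij⟩ 1) =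
        genPoly k (m + Pi.single ⟨(i, d), h1⟩ 1 + Pi.single ⟨(c, j), h2⟩ 1) -
          genPoly k (m + Pi.single ⟨(i, c), hic⟩ 1 + Pi.single ⟨(d, j), hdj⟩ 1) := by
      simp only [genPoly, minorProd_add_single, minor, map_mul, map_sub]
      ring
    rw [e]
    rw [sum_add_single, sum_add_single] at hμ
    obtain ⟨x, hx⟩ := Nat.exists_eq_add_of_lt hic'
    obtain ⟨y, hy⟩ := Nat.exists_eq_add_of_lt hcd'
    obtain ⟨z, hz⟩ := Nat.exists_eq_add_of_lt hdj'
    refine Submodule.sub_mem _ (ih _ ?_ _ _ rfl) (ih _ ?_ _ _ rfl)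
    · rw [← hμ, sum_add_single, sum_add_single]
      dsimp only
      rw [show j.val - i.val = x + y + z + 3 by omega, show d.val - c.val = y + 1 by omega,
        show d.val - i.val = x + y + 2 by omega, show j.val - c.val = y + z + 2 by omega]
      nlinarith
    · rw [← hμ, sum_add_single, sum_add_single]
      dsimp only
      rw [show j.val - i.val = x + y + z + 3 by omega, show d.val - c.val = y + 1 by omega,
        show c.val - i.val = x + 1 by omega, show j.val - d.val = z + 1 by omega]
      nlinarith
  · refine Submodule.subset_span ⟨k, m, ⟨fun a t h => ?_, fun a b h h' => ?_⟩, rfl, rfl⟩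
    · by_contra h0
      exact h1 ⟨a, t, h, left_ne_zero_of_mul h0, right_ne_zero_of_mul h0⟩
    · by_contra h0
      exact h2 ⟨a, b, h, h', left_ne_zero_of_mul h0, right_ne_zero_of_mul h0⟩

/-- Straightening is done on generating polynomials in s and preserves ∑ k_t. In degree 0 the
coefficient taken is the middle one, and ∑ k_t is even. -/
theorem gradedSpan_zero_le : gradedSpan (initialIdx n n) 0 ≤
    Submodule.span ℂ {f | ∃ k m, IsAdmissible k m ∧
      f = polarized (n := n) k ((∑ t, k t) / 2) * minorProd m} := by
  refine (gradedSpan_le_standardSpan 0).trans (Submodule.span_le.mpr ?_)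
  rintro _ ⟨k, r, m, hw, rfl⟩
  have hr : ∑ t, k t = 2 * r := by omega
  rw [← coeff_genPoly]
  have hmem := genPoly_mem_span k m
  have key : ∀ p ∈ Submodule.span ℂ {p | ∃ k' m', IsNestFree k' m' ∧ ∑ t, k' t = ∑ t, k t ∧
      p = genPoly (n := n) k' m'}, p.coeff r ∈ Submodule.span ℂ {f | ∃ k m, IsAdmissible k m ∧
      f = polarized (n := n) k ((∑ t, k t) / 2) * minorProd m} := by
    intro p hp
    induction hp using Submodule.span_induction with
    | mem p hp =>
      obtain ⟨k', m', hf, hs, rfl⟩ := hp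
      refine Submodule.subset_span ⟨k', m', ⟨by rw [hs, hr]; simp, hf⟩, ?_⟩
      rw [coeff_genPoly, hs, hr, Nat.mul_div_cancel_left _ two_pos]
    | zero => simp
    | add p q _ _ hp hq => rw [Polynomial.coeff_add]; exact Submodule.add_mem _ hp hq
    | smul c p _ hp => rw [Polynomial.coeff_smul]; exact Submodule.smul_mem _ _ hp
  exact key _ hmem

/-! ### Standard monomials: linear independence -/

/-- A family that is triangular with respect to a linearly independent one is linearly
independent. -/
theorem linearIndependent_of_triangular {ι M M' : Type*} [AddCommGroup M] [Module ℂ M]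
    [AddCommGroup M'] [Module ℂ M'] {v : ι → M} {w : ι → M'} (hw : LinearIndependent ℂ w)
    (ht : ι → ℕ) (D : ℕ → M →ₗ[ℂ] M') (c : ι → ℂ) (hc : ∀ i, c i ≠ 0)
    (h1 : ∀ i, D (ht i) (v i) = c i • w i) (h2 : ∀ i d, ht i < d → D d (v i) = 0) :
    LinearIndependent ℂ v := by
  classical
  rw [linearIndependent_iff'] at hw ⊢
  intro s g hg
  by_contra! hne
  obtain ⟨i, his, hi⟩ := hne
  obtain ⟨j, hj, hmax⟩ := (s.filter fun i => g i ≠ 0).exists_max_image ht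
    ⟨i, Finset.mem_filter.mpr ⟨his, hi⟩⟩
  obtain ⟨hjs, hj0⟩ := Finset.mem_filter.mp hj
  have h := congrArg (D (ht j)) hg
  rw [map_sum, map_zero] at h
  have h' : ∑ i ∈ s, (if ht i = ht j then g i * c i else 0) • w i = 0 := by
    rw [← h]
    refine Finset.sum_congr rfl fun i hi => ?_
    rw [map_smul]
    split_ifs with he
    · rw [← he, h1, smul_smul]
    · rw [zero_smul]
      by_cases hgi : g i = 0
      · rw [hgi, zero_smul]
      · have := hmax i (Finset.mem_filter.mpr ⟨hi, hgi⟩)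
        rw [h2 i _ (by omega), smul_zero]
  have := hw s _ h' j hjs
  rw [if_pos rfl] at this
  exact mul_ne_zero hj0 (hc j) this

/-- The derivation with `y_i ↦ x_i ↦ 0`. -/
def raising (n : ℕ) : Derivation ℂ (Poly n) (Poly n) :=
  mkDerivation ℂ (Sum.elim (fun _ => 0) fun i => X (Sum.inl i))

theorem raising_X_inl (i : Fin n) : raising n (X (Sum.inl i)) = 0 := by
  simp [raising, mkDerivation_X]

theorem raising_X_inr (i : Fin n) : raising n (X (Sum.inr i)) = X (Sum.inl i) := by
  simp [raising, mkDerivation_X]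

/-- This is the sl(2)-action on binary forms: the polarizations of one monomial form a string of
length ∑ k_t + 1. Minors are invariants and are killed. -/
theorem raising_polarized (k : Fin n → ℕ) :
    raising n (polarized k 0) = 0 ∧ ∀ r, raising n (polarized k (r + 1)) =
      ((∑ t, k t : ℕ) - r : ℂ) • polarized k r := by
  induction k using pi_nat_induction with
  | h0 =>
    refine ⟨by rw [polarized_zero_zero, Derivation.map_one_eq_zero], fun r => ?_⟩
    rw [polarized_zero_succ, map_zero]
    rcases r with _ | r
    · simp
    · rw [polarized_zero_succ, smul_zero]
  | h1 k c ih =>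
    refine ⟨?_, fun r => ?_⟩
    · rw [polarized_add_single_zero, Derivation.leibniz, ih.1, raising_X_inl]; simp
    · rw [polarized_add_single_succ, map_add, Derivation.leibniz, Derivation.leibniz, ih.2,
        raising_X_inl, raising_X_inr, sum_add_single_one]
      rcases r with _ | r
      · rw [ih.1, polarized_add_single_zero]
        simp only [smul_eq_mul, mul_zero, add_zero, zero_add, Algebra.smul_def, map_sub,
          algebraMap_eq, Nat.cast_add, Nat.cast_one, map_add, map_one, Nat.cast_zero, map_zero]
        ring
      · rw [ih.2, polarized_add_single_succ]
        simp only [smul_eq_mul, mul_zero, add_zero, Algebra.smul_def, map_sub,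
          algebraMap_eq, Nat.cast_add, Nat.cast_one, map_add, map_one]
        ring

theorem raising_minorProd (m : Pairs n → ℕ) : raising n (minorProd m) = 0 := by
  induction m using pi_nat_induction with
  | h0 => simp [minorProd]
  | h1 m a ih =>
    rw [minorProd_add_single, Derivation.leibniz, ih, minor, map_sub, Derivation.leibniz,
      Derivation.leibniz, raising_X_inl, raising_X_inl, raising_X_inr, raising_X_inr]
    simp only [smul_eq_mul]
    ring

/-- The scalars ∑ k_t - r met on the way down the string are nonzero as long as the starting index
is at most ∑ k_t. -/
theorem raising_pow_apply (k : Fin n → ℕ) (m : Pairs n → ℕ) (r : ℕ) (hr : r ≤ ∑ t, k t) :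
    (∃ c : ℂ, c ≠ 0 ∧ ((raising n).toLinearMap ^ r) (polarized k r * minorProd m) =
      c • ((∏ t, X (Sum.inl t) ^ k t) * minorProd m)) ∧
    ∀ d, r < d → ((raising n).toLinearMap ^ d) (polarized k r * minorProd m) = 0 := by
  induction r with
  | zero =>
    refine ⟨⟨1, one_ne_zero, by rw [pow_zero, one_smul, polarized_zero_right]; rfl⟩,
      fun d hd => ?_⟩
    obtain ⟨d, rfl⟩ := Nat.exists_eq_succ_of_ne_zero (by omega : d ≠ 0)
    have : (raising n).toLinearMap (polarized k 0 * minorProd m) = 0 := by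
      change raising n _ = 0
      rw [Derivation.leibniz, (raising_polarized k).1, raising_minorProd]; simp
    rw [Nat.succ_eq_add_one, pow_succ, Module.End.mul_apply, this, map_zero]
  | succ r ih =>
    have h : (raising n).toLinearMap (polarized k (r + 1) * minorProd m) =
        ((∑ t, k t : ℕ) - r : ℂ) • (polarized k r * minorProd m) := by
      change raising n _ = _
      rw [Derivation.leibniz, (raising_polarized k).2, raising_minorProd]
      simp only [smul_eq_mul, mul_zero, zero_add, mul_smul_comm, mul_comm]
    obtain ⟨⟨c, hc, he⟩, hd⟩ := ih (by omega)
    refine ⟨⟨((∑ t, k t : ℕ) - r : ℂ) * c, mul_ne_zero ?_ hc, ?_⟩, fun d hrd => ?_⟩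
    · rw [sub_ne_zero]; exact_mod_cast (by omega : (∑ t, k t) ≠ r)
    · rw [pow_succ, Module.End.mul_apply, h, map_smul, he, smul_smul]
    · obtain ⟨d, rfl⟩ := Nat.exists_eq_succ_of_ne_zero (by omega : d ≠ 0)
      rw [Nat.succ_eq_add_one, pow_succ, Module.End.mul_apply, h, map_smul, hd d (by omega),
        smul_zero]

/-- The substitution `x_i ↦ s^i x_i`, `y_i ↦ y_i`. -/
def weightHom (n : ℕ) : Poly n →ₐ[ℂ] Polynomial (Poly n) :=
  aeval (Sum.elim (fun i => Polynomial.C (X (Sum.inl i)) * Polynomial.X ^ (i.val))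
    fun i => Polynomial.C (X (Sum.inr i)))

theorem weightHom_minor (a b : Fin n) : weightHom n (minor a b) =
    Polynomial.C (X (Sum.inl a) * X (Sum.inr b)) * Polynomial.X ^ a.val -
      Polynomial.C (X (Sum.inl b) * X (Sum.inr a)) * Polynomial.X ^ b.val := by
  simp only [weightHom, minor, map_sub, map_mul, aeval_X, Sum.elim_inl, Sum.elim_inr]
  ring

theorem leadingCoeff_weightHom_minor {a b : Fin n} (h : a < b) :
    (weightHom n (minor a b)).leadingCoeff = -(X (Sum.inl b) * X (Sum.inr a)) := by
  have hne : (X (Sum.inl b) * X (Sum.inr a) : Poly n) ≠ 0 := mul_ne_zero (X_ne_zero _) (X_ne_zero _)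
  rw [weightHom_minor, ← neg_sub, Polynomial.leadingCoeff_neg,
    Polynomial.leadingCoeff_sub_of_degree_lt, Polynomial.leadingCoeff_C_mul_X_pow]
  refine (Polynomial.degree_C_mul_X_pow_le _ _).trans_lt ?_
  rw [Polynomial.degree_C_mul_X_pow _ hne]
  exact_mod_cast h

/-- In the minor with rows a < b the top power of s comes from x_b y_a, and leading coefficients are
multiplicative over a domain. -/
theorem leadingCoeff_weightHom (k : Fin n → ℕ) (m : Pairs n → ℕ) :
    (weightHom n ((∏ t, X (Sum.inl t) ^ k t) * minorProd m)).leadingCoeff =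
      (-1) ^ (∑ a, m a) * ((∏ t, X (Sum.inl t) ^ k t) *
        ∏ a : Pairs n, (X (Sum.inl a.1.2) * X (Sum.inr a.1.1)) ^ m a) := by
  rw [map_mul, Polynomial.leadingCoeff_mul, map_prod, Polynomial.leadingCoeff_prod, minorProd,
    map_prod, Polynomial.leadingCoeff_prod]
  have h1 : ∀ t : Fin n, (weightHom n (X (Sum.inl t) ^ k t)).leadingCoeff = X (Sum.inl t) ^ k t := by
    intro t
    rw [map_pow, Polynomial.leadingCoeff_pow]
    simp [weightHom]
  have h2 : ∀ a : Pairs n, (weightHom n (minor a.1.1 a.1.2 ^ m a)).leadingCoeff =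
      (-1) ^ m a * (X (Sum.inl a.1.2) * X (Sum.inr a.1.1)) ^ m a := by
    intro a
    rw [map_pow, Polynomial.leadingCoeff_pow, leadingCoeff_weightHom_minor a.2, neg_pow]
  simp only [h1, h2, Finset.prod_mul_distrib, Finset.prod_pow_eq_pow_sum]
  ring

/-- The exponent of the leading monomial. -/
def leadExp (k : Fin n → ℕ) (m : Pairs n → ℕ) : Idx n →₀ ℕ :=
  Finsupp.equivFunOnFinite.symm (Sum.elim
    (fun t => k t + ∑ a : Pairs n, if a.1.2 = t then m a else 0)
    (fun i => ∑ a : Pairs n, if a.1.1 = i then m a else 0))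

theorem leadExp_inl (k : Fin n → ℕ) (m : Pairs n → ℕ) (t : Fin n) :
    leadExp k m (Sum.inl t) = k t + ∑ a : Pairs n, if a.1.2 = t then m a else 0 := rfl

theorem leadExp_inr (k : Fin n → ℕ) (m : Pairs n → ℕ) (i : Fin n) :
    leadExp k m (Sum.inr i) = ∑ a : Pairs n, if a.1.1 = i then m a else 0 := rfl

theorem leadExp_add_single (k : Fin n → ℕ) (m : Pairs n → ℕ) (a : Pairs n) :
    leadExp k (m + Pi.single a 1) =
      leadExp k m + (Finsupp.single (Sum.inl a.1.2) 1 + Finsupp.single (Sum.inr a.1.1) 1) := by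
  have h : ∀ p : Pairs n → Prop, [DecidablePred p] →
      (∑ b, if p b then (m + Pi.single a 1 : Pairs n → ℕ) b else 0) =
      (∑ b, if p b then m b else 0) + if p a then 1 else 0 := by
    intro p _
    rw [← Finset.sum_filter, ← Finset.sum_filter]
    simp only [Pi.add_apply, Finset.sum_add_distrib]
    congr 1
    rw [Finset.sum_filter, Finset.sum_eq_single a]
    · simp
    · intro b _ hb; simp [hb]
    · simp
  ext p
  rcases p with t | i
  · rw [Finsupp.add_apply, Finsupp.add_apply, leadExp_inl, leadExp_inl, h]
    simp [Finsupp.single_apply, add_assoc]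
  · rw [Finsupp.add_apply, Finsupp.add_apply, leadExp_inr, leadExp_inr, h]
    simp [Finsupp.single_apply]

theorem leadExp_zero_right (k : Fin n → ℕ) (t : Fin n) : leadExp k 0 (Sum.inl t) = k t := by
  simp [leadExp_inl]

theorem prod_eq_monomial_leadExp (k : Fin n → ℕ) (m : Pairs n → ℕ) :
    (∏ t, X (Sum.inl t) ^ k t) * ∏ a : Pairs n, (X (Sum.inl a.1.2) * X (Sum.inr a.1.1)) ^ m a =
      (monomial (leadExp k m) 1 : Poly n) := by
  induction m using pi_nat_induction with
  | h0 =>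
    rw [monomial_eq, C_1, one_mul, Finsupp.prod_fintype _ _ (by simp), Fintype.prod_sum_type]
    simp [leadExp_zero_right, leadExp_inr]
  | h1 m a ih =>
    rw [prod_pow_add_single, ← mul_assoc, ih, leadExp_add_single, X, X, monomial_mul, monomial_mul]
    simp

/-- The largest column of a nonempty tableau. -/
theorem IsNestFree.exists_max {k : Fin n → ℕ} {m : Pairs n → ℕ} (h : IsNestFree k m)
    (hm : m ≠ 0) : ∃ a, m a ≠ 0 ∧ (∀ t, leadExp k m (Sum.inl t) ≠ 0 → t ≤ a.1.2) ∧
      ∀ i, leadExp k m (Sum.inr i) ≠ 0 → i ≤ a.1.1 := by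
  obtain ⟨b, hb⟩ := Function.ne_iff.mp hm
  obtain ⟨a, ha, hmax⟩ := (Finset.univ.filter fun a => m a ≠ 0).exists_max_image
    -- Without nesting, the columns form a chain for the componentwise order, so maximizing the sum
    -- of the two entries maximizes both.
    (fun a => a.1.1.val + a.1.2.val) ⟨b, by simpa using hb⟩
  have ha0 : m a ≠ 0 := by simpa using ha
  have key : ∀ b, m b ≠ 0 → b.1.1 ≤ a.1.1 ∧ b.1.2 ≤ a.1.2 := by
    intro b hb
    have h1 := hmax b (by simpa using hb)
    have h2 : ¬ (a.1.1 < b.1.1 ∧ b.1.2 < a.1.2) := fun h' =>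
      mul_ne_zero ha0 hb (h.2 a b h'.1 h'.2)
    have h3 : ¬ (b.1.1 < a.1.1 ∧ a.1.2 < b.1.2) := fun h' =>
      mul_ne_zero hb ha0 (h.2 b a h'.1 h'.2)
    simp only [Fin.lt_def, Fin.le_def] at *
    omega
  refine ⟨a, ha0, fun t ht => ?_, fun i hi => ?_⟩
  · by_cases hk : k t = 0
    · rw [leadExp_inl, hk, zero_add] at ht
      obtain ⟨b, -, hb⟩ := Finset.exists_ne_zero_of_sum_ne_zero ht
      obtain ⟨rfl, hb'⟩ := ite_ne_right_iff.mp hb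
      exact (key b hb').2
    · by_contra hlt
      exact mul_ne_zero ha0 hk (h.1 a t (not_le.mp hlt))
  · rw [leadExp_inr] at hi
    obtain ⟨b, -, hb⟩ := Finset.exists_ne_zero_of_sum_ne_zero hi
    obtain ⟨rfl, hb'⟩ := ite_ne_right_iff.mp hb
    exact (key b hb').1

theorem IsNestFree.of_add {k : Fin n → ℕ} {m m' : Pairs n → ℕ} (h : IsNestFree k (m + m')) :
    IsNestFree k m := by
  constructor
  · intro a t hat
    have := h.1 a t hat
    rw [Pi.add_apply, add_mul] at this
    omega
  · intro a b h1 h2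
    have := h.2 a b h1 h2
    rw [Pi.add_apply, Pi.add_apply, add_mul, mul_add] at this
    omega

theorem leadExp_ne_zero {k : Fin n → ℕ} {m : Pairs n → ℕ} {a : Pairs n} (h : m a ≠ 0) :
    leadExp k m (Sum.inl a.1.2) ≠ 0 ∧ leadExp k m (Sum.inr a.1.1) ≠ 0 := by
  obtain ⟨m, rfl⟩ := exists_eq_add_single h
  rw [leadExp_add_single]
  constructor <;> simp

/-- The largest column is visible in the exponent: its entries are the largest indices occurring
among the second and the first variables. Removing it from both sides gives the induction. -/
theorem leadExp_injective {k k' : Fin n → ℕ} {m m' : Pairs n → ℕ} (h : IsNestFree k m)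
    (h' : IsNestFree k' m') (he : leadExp k m = leadExp k' m') : k = k' ∧ m = m' := by
  have hzero : ∀ {k k' : Fin n → ℕ} {m m' : Pairs n → ℕ}, leadExp k m = leadExp k' m' →
      m = 0 → m' = 0 := by
    intro k k' m m' he hm
    by_contra hm'
    obtain ⟨b, hb⟩ := Function.ne_iff.mp hm'
    have := (leadExp_ne_zero (k := k') hb).2
    rw [← he, hm, leadExp_inr] at this
    simp at this
  induction hs : ∑ a, m a generalizing m m' with
  | zero =>
    have hm : m = 0 := funext fun a => by simpa using (Finset.sum_eq_zero_iff.mp hs) a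
    have hm' := hzero he hm
    subst hm hm'
    refine ⟨funext fun t => ?_, rfl⟩
    rw [← leadExp_zero_right k t, he, leadExp_zero_right]
  | succ s ih =>
    have hm : m ≠ 0 := by rintro rfl; simp at hs
    have hm' : m' ≠ 0 := fun h0 => hm (hzero he.symm h0)
    obtain ⟨a, ha, h1, h2⟩ := h.exists_max hm
    obtain ⟨b, hb, h1', h2'⟩ := h'.exists_max hm'
    have hab : a = b := by
      have ha' := leadExp_ne_zero (k := k) ha
      have hb' := leadExp_ne_zero (k := k') hb
      refine Subtype.ext (Prod.ext ?_ ?_)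
      · exact le_antisymm (h2' _ (he ▸ ha'.2)) (h2 _ (he ▸ hb'.2))
      · exact le_antisymm (h1' _ (he ▸ ha'.1)) (h1 _ (he ▸ hb'.1))
    subst hab
    obtain ⟨m, rfl⟩ := exists_eq_add_single ha
    obtain ⟨m', rfl⟩ := exists_eq_add_single hb
    rw [leadExp_add_single, leadExp_add_single] at he
    rw [sum_add_single_one] at hs
    obtain ⟨e1, e2⟩ := ih h.of_add h'.of_add (add_right_cancel he) (by omega)
    exact ⟨e1, by rw [e2]⟩

/-- The index set of the bases. -/
abbrev Admissible (n : ℕ) : Type :=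
  {km : (Fin n → ℕ) × (Pairs n → ℕ) // IsAdmissible km.1 km.2}

theorem Admissible.isNestFree (km : Admissible n) : IsNestFree km.1.1 km.1.2 := km.2.2

theorem linearIndependent_leading : LinearIndependent ℂ fun km : Admissible n =>
    (∏ t, X (Sum.inl t) ^ km.1.1 t) * minorProd km.1.2 := by
  have hw : LinearIndependent ℂ fun km : Admissible n =>
      (monomial (leadExp km.1.1 km.1.2) 1 : Poly n) := by
    have h := (basisMonomials (Idx n) ℂ).linearIndependent.comp
      (fun km : Admissible n => leadExp km.1.1 km.1.2) (fun x y hxy => by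
        obtain ⟨h1, h2⟩ := leadExp_injective x.isNestFree y.isNestFree hxy
        exact Subtype.ext (Prod.ext h1 h2))
    simpa [Function.comp_def] using h
  refine linearIndependent_of_triangular hw
    (fun km => (weightHom n ((∏ t, X (Sum.inl t) ^ km.1.1 t) * minorProd km.1.2)).natDegree)
    (fun d => ((Polynomial.lcoeff (Poly n) d).restrictScalars ℂ).comp (weightHom n).toLinearMap)
    (fun km => (-1) ^ ∑ a, km.1.2 a) (fun km => by simp) (fun km => ?_) fun km d hd => ?_
  · change (weightHom n _).leadingCoeff = _
    rw [leadingCoeff_weightHom, prod_eq_monomial_leadExp, Algebra.smul_def, map_pow, map_neg,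
      map_one (algebraMap ℂ (Poly n))]
  · exact Polynomial.coeff_eq_zero_of_natDegree_lt hd

/-! ### The two bases -/

theorem basisPoly_eq (k : Fin n → ℕ) (m : Pairs n → ℕ) :
    basisPoly k m = (((∑ t, k t) / 2).factorial : ℂ) •
      (polarized k ((∑ t, k t) / 2) * minorProd m) := by
  have h1 : ∀ t : Fin n, linForm t ^ k t = ∑ r ∈ Finset.range (k t + 1),
      Polynomial.C (C ((k t).choose r : ℂ) * X (Sum.inl t) ^ (k t - r) * X (Sum.inr t) ^ r) *
        Polynomial.X ^ r := by
    intro t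
    rw [linForm, add_comm, add_pow]
    refine Finset.sum_congr rfl fun r _ => ?_
    simp only [mul_pow, map_mul, map_pow, map_natCast]
    ring
  have h2 : linProd k = ∑ r ∈ Fintype.piFinset fun t => Finset.range (k t + 1),
      Polynomial.C (∏ t, (C ((k t).choose (r t) : ℂ) * X (Sum.inl t) ^ (k t - r t) *
        X (Sum.inr t) ^ r t)) * Polynomial.X ^ (∑ t, r t) := by
    rw [linProd, Finset.prod_congr rfl fun t _ => h1 t, Finset.prod_univ_sum]
    refine Finset.sum_congr rfl fun r _ => ?_
    rw [Finset.prod_mul_distrib, ← map_prod, Finset.prod_pow_eq_pow_sum]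
  have h3 : polarized k ((∑ t, k t) / 2) =
      ∑ r ∈ (Fintype.piFinset fun t => Finset.range (k t + 1)).filter
        (fun r => ∑ t, r t = (∑ t, k t) / 2),
      ∏ t, (C ((k t).choose (r t) : ℂ) * X (Sum.inl t) ^ (k t - r t) *
        X (Sum.inr t) ^ r t) := by
    rw [polarized, h2, Polynomial.finsetSum_coeff, Finset.sum_filter]
    refine Finset.sum_congr rfl fun r _ => ?_
    rw [Polynomial.coeff_C_mul_X_pow]
    simp only [eq_comm]
  rw [basisPoly, h3, ← smul_mul_assoc, Finset.smul_sum]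
  refine congrArg₂ (· * ·) (Finset.sum_congr rfl fun r hr => ?_) rfl
  rw [(Finset.mem_filter.mp hr).2, Algebra.smul_def, algebraMap_eq]

/-- Triangularity is used with height r = ∑ k_t / 2: the r-th power of the raising derivation
reaches the bottom of the string and kills all strings of smaller height. -/
theorem linearIndependent_basisPoly :
    LinearIndependent ℂ fun km : Admissible n => basisPoly km.1.1 km.1.2 := by
  have hr : ∀ km : Admissible n, (∑ t, km.1.1 t) / 2 ≤ ∑ t, km.1.1 t := fun km => by omega
  choose c hc he using fun km : Admissible n =>
    (raising_pow_apply km.1.1 km.1.2 _ (hr km)).1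
  refine linearIndependent_of_triangular linearIndependent_leading
    (fun km => (∑ t, km.1.1 t) / 2) (fun d => (raising n).toLinearMap ^ d)
    (fun km => (((∑ t, km.1.1 t) / 2).factorial : ℂ) * c km)
    (fun km => mul_ne_zero (Nat.cast_ne_zero.mpr (Nat.factorial_ne_zero _)) (hc km))
    (fun km => ?_) fun km d hd => ?_
  · rw [basisPoly_eq, map_smul, he, smul_smul]
  · rw [basisPoly_eq, map_smul, (raising_pow_apply km.1.1 km.1.2 _ (hr km)).2 d hd, smul_zero]

theorem basisPoly_mem_signPart {k : Fin n → ℕ} {m : Pairs n → ℕ} (h : IsAdmissible k m) :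
    basisPoly k m ∈ signPart n ((-1) ^ ∑ a, m a) := by
  obtain ⟨r, hr⟩ := h.1
  have hr' : (∑ t, k t) / 2 = r := by omega
  rw [basisPoly_eq, hr']
  refine Submodule.smul_mem _ _ (mem_signPart.mpr ⟨?_, ?_⟩)
  · have := mul_mem_gradedSpan (polarized_mem_gradedSpan k r) (minorProd_mem_gradedSpan m)
    rw [← Nat.cast_sum, hr] at this
    convert this using 1
    push_cast; ring
  · rw [map_mul, swap_polarized k hr.symm, swap_minorProd, Algebra.smul_def, map_pow, map_neg,
      map_one]
    ring

theorem span_basisPoly {ε : ℂ} (hε : ε * ε = 1) {P : ℕ → Prop} (hP : ∀ j, P j ↔ (-1) ^ j = ε) :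
    Submodule.span ℂ (Set.range fun km : {km : (Fin n → ℕ) × (Pairs n → ℕ) //
      IsAdmissible km.1 km.2 ∧ P (∑ a, km.2 a)} => basisPoly km.1.1 km.1.2) = signPart n ε := by
  have hε' : ε = 1 ∨ ε = -1 := mul_self_eq_one_iff.mp hε
  apply le_antisymm
  · refine Submodule.span_le.mpr ?_
    rintro _ ⟨km, rfl⟩
    have := basisPoly_mem_signPart km.2.1
    rwa [(hP _).mp km.2.2] at this
  · intro f hf
    set N := Submodule.span ℂ (Set.range fun km : {km : (Fin n → ℕ) × (Pairs n → ℕ) //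
      IsAdmissible km.1 km.2 ∧ P (∑ a, km.2 a)} => (basisPoly km.1.1 km.1.2 : Poly n))
    -- The map g ↦ g + ε · swap g is twice the projection to the eigenspace of `ε`; it doubles the
    -- basis polynomials of the right parity and kills the others.
    have key : ∀ g ∈ Submodule.span ℂ {f | ∃ k m, IsAdmissible k m ∧
        f = polarized (n := n) k ((∑ t, k t) / 2) * minorProd m}, g + ε • swap n g ∈ N := by
      intro g hg
      induction hg using Submodule.span_induction with
      | mem g hg =>
        obtain ⟨k, m, h, rfl⟩ := hg
        have h0 : (((∑ t, k t) / 2).factorial : ℂ) ≠ 0 :=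
          Nat.cast_ne_zero.mpr (Nat.factorial_ne_zero _)
        rw [← N.smul_mem_iff h0, smul_add, smul_comm _ ε, ← map_smul, ← basisPoly_eq,
          (mem_signPart.mp (basisPoly_mem_signPart h)).2, smul_smul]
        by_cases hp : P (∑ a, m a)
        · rw [(hP _).mp hp, hε, one_smul]
          have hb : basisPoly k m ∈ N := Submodule.subset_span ⟨⟨(k, m), h, hp⟩, rfl⟩
          exact N.add_mem hb hb
        · have : ε * (-1) ^ (∑ a, m a) = -1 := by
            have h1 := mt (hP _).mpr hp
            rcases neg_one_pow_eq_or ℂ (∑ a, m a) with h2 | h2 <;> rw [h2] at h1 ⊢ <;>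
              rcases hε' with rfl | rfl <;> simp_all
          rw [this, neg_one_smul, add_neg_cancel]
          exact N.zero_mem
      | zero => simp
      | add f g _ _ hf hg =>
        have e : f + g + ε • swap n (f + g) = (f + ε • swap n f) + (g + ε • swap n g) := by
          rw [map_add]; module
        rw [e]; exact N.add_mem hf hg
      | smul c f _ hf =>
        have e : c • f + ε • swap n (c • f) = c • (f + ε • swap n f) := by
          rw [map_smul]; module
        rw [e]; exact N.smul_mem c hf
    have h := key f (gradedSpan_zero_le (mem_signPart.mp hf).1)
    rw [(mem_signPart.mp hf).2, smul_smul, hε, one_smul, ← two_smul ℂ] at h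
    exact (N.smul_mem_iff two_ne_zero).mp h

theorem polySubmodule_sup {T : Finset (Idx n)} (N N' : LieSubmodule ℂ (G n) (Osc T)) :
    polySubmodule (N ⊔ N') = polySubmodule N ⊔ polySubmodule N' := by
  ext f
  rw [mem_polySubmodule, LieSubmodule.mem_sup, Submodule.mem_sup]
  rfl

theorem hasBasis_generated {ε : ℂ} (hε : ε * ε = 1) {P : ℕ → Prop}
    (hP : ∀ j, P j ↔ (-1) ^ j = ε) {v : Poly n} (hv : v ∈ signPart n ε) (h0 : v ≠ 0) :
    HasBasis (initialIdx n n) (generated (initialIdx n n) v) P := by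
  have hε0 : ε ≠ 0 := left_ne_zero_of_mul_eq_one hε
  constructor
  · have h := linearIndependent_basisPoly.comp
      (fun km : {km : (Fin n → ℕ) × (Pairs n → ℕ) // IsAdmissible km.1 km.2 ∧ P (∑ a, km.2 a)} =>
        (⟨km.1, km.2.1⟩ : Admissible n)) (fun x y hxy => by
          simpa [Subtype.ext_iff] using hxy)
    exact h.map' (toOsc (initialIdx n n)).toLinearMap (toOsc (initialIdx n n)).ker
  · rw [generated_eq_signPart hε0 hv h0]
    change _ = (signPart n ε).map (toOsc (initialIdx n n)).toLinearMap
    rw [← span_basisPoly hε hP, Submodule.map_span, ← Set.range_comp]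
    rfl

end NoncanonicalSp
end

open NoncanonicalSp

/-! ### Assembly of the theorem -/

theorem even_iff_neg_one_pow (j : ℕ) : Even j ↔ (-1 : ℂ) ^ j = 1 :=
  (neg_one_pow_eq_one_iff_even (by norm_num)).symm

theorem odd_iff_neg_one_pow (j : ℕ) : Odd j ↔ (-1 : ℂ) ^ j = -1 :=
  (neg_one_pow_eq_neg_one_iff_odd (by norm_num)).symm

/-- In each claim `S` is the complement of `T`, and `G n` is `sp(2n, ℂ)`. -/
theorem theorem2p10 (n : ℕ) (T : Finset (Idx n)) (hT : T.Nonempty) (hS : Tᶜ.Nonempty) :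
    -- The case in which `S_1 ∪ T_1` is nonempty
    ((S₁ T ∪ T₁ T).Nonempty →
      (∀ k : ℤ, LieModule.IsIrreducible ℂ (G n) (piece T k)) ∧
      -- a)
      ((S₁ T).Nonempty → (T₁ T).Nonempty → ∀ k : ℤ, ¬ IsOfHighestWeightType (piece T k)) ∧
      -- b), the reduction to `T = {1, …, t}`
      (T₁ T = ∅ → ∃ t : ℕ, 1 ≤ t ∧ t < n ∧ SymmetricTo T (initialIdx n t) 1) ∧
      (S₁ T = ∅ → ∃ t : ℕ, 1 ≤ t ∧ t < n ∧ SymmetricTo T (initialIdx n t) (-1)) ∧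
      -- b), the case `T = {1, …, t}`
      (∀ (t : ℕ) (ht : 1 ≤ t) (htn : t < n), T = initialIdx n t → ∀ k : ℤ,
        (0 ≤ k → IsIrrHighestWeight (piece T k)
          (-(k + 1) • fundWeight n t + k • fundWeight n (t + 1))
          (X (Sum.inl ⟨t, htn⟩) ^ k.toNat)) ∧
        (k < 0 → IsIrrHighestWeight (piece T k)
          (-k • fundWeight n (t - 1) + (k - 1) • fundWeight n t)
          (X (Sum.inl ⟨t - 1, by omega⟩) ^ (-k).toNat)))) ∧
    -- The case in which `S_1 ∪ T_1` is empty
    (S₁ T ∪ T₁ T = ∅ →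
      -- the reduction to `T_2 = {1, …, n}`
      SymmetricTo T (initialIdx n n) 1 ∧
      (T = initialIdx n n → ∀ hn : 1 ≤ n,
        -- e)
        (∀ k : ℕ, 0 < k →
          IsIrrHighestWeight (piece T k)
            ((k : ℤ) • fundWeight n (n - 1) - ((k : ℤ) + 1) • fundWeight n n)
            (X (Sum.inr ⟨n - 1, by omega⟩) ^ k) ∧
          IsIrrHighestWeight (piece T (-k))
            ((k : ℤ) • fundWeight n (n - 1) - ((k : ℤ) + 1) • fundWeight n n)
            (X (Sum.inl ⟨n - 1, by omega⟩) ^ k)) ∧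
        -- f)
        IsIrrHighestWeight (generated T 1) (-fundWeight n n) 1 ∧
        HasBasis T (generated T 1) Even ∧
        (n = 1 → piece T 0 = generated T 1) ∧
        (∀ hn2 : 2 ≤ n,
          let u : Poly n :=
            X (Sum.inl ⟨n - 2, by omega⟩) * X (Sum.inr ⟨n - 1, by omega⟩)
              - X (Sum.inl ⟨n - 1, by omega⟩) * X (Sum.inr ⟨n - 2, by omega⟩)
          piece T 0 = generated T 1 ⊔ generated T u ∧
          Disjoint (generated T 1) (generated T u) ∧
          IsIrrHighestWeight (generated T u)
            (fundWeight n (n - 2) - (2 : ℤ) • fundWeight n n) u ∧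
          HasBasis T (generated T u) Odd))) := by
  refine ⟨fun h => ⟨isIrreducible_piece hT hS h, fun h1 h2 k => not_isOfHighestWeightType h1 h2 _,
    fun h1 => ?_, fun h1 => ?_, ?_⟩, fun h => ⟨?_, ?_⟩⟩
  · rw [h1, Finset.union_empty] at h
    exact ⟨halfCard T, halfCard_pos hT, halfCard_lt h, symmetricTo_initialIdx h1⟩
  · rw [h1, Finset.empty_union] at h
    refine ⟨halfCard Tᶜ, halfCard_pos hS, halfCard_lt (by rwa [S₁_compl]), ?_⟩
    have h' : T₁ Tᶜ = ∅ := by rwa [T₁_compl]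
    simpa using (symmetricTo_compl T).trans (symmetricTo_initialIdx h')
  · rintro t ht htn rfl k
    obtain ⟨p, hp⟩ := exists_same_part h
    have hs := isSpSimple_gradedSpan_of_same_part (initialIdx n t) p hp k
    exact ⟨fun hk => isIrrHighestWeight_nonneg htn hk hs,
      fun hk => isIrrHighestWeight_neg ht htn.le hk hs⟩
  · have h1 := Finset.union_eq_empty.mp h
    have := symmetricTo_initialIdx h1.2
    rwa [halfCard_eq h1.1] at this
  · rintro rfl hn
    refine ⟨fun k hk => ⟨isIrrHighestWeight_full_pos hn hk, isIrrHighestWeight_full_neg hn hk⟩,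
      isIrrHighestWeight_one,
      hasBasis_generated (by norm_num) even_iff_neg_one_pow one_mem_signPart one_ne_zero, ?_, ?_⟩
    · rintro rfl
      apply polySubmodule_injective
      rw [polySubmodule_generated one_ne_zero one_mem_signPart one_ne_zero, polySubmodule_piece,
        ← signPart_sup, sup_eq_left, ← span_basisPoly (ε := -1) (by norm_num) odd_iff_neg_one_pow]
      refine Submodule.span_le.mpr ?_
      rintro _ ⟨⟨⟨k, m⟩, h1, h2⟩, rfl⟩
      -- For n = 1 there are no minors, so no basis polynomial is odd and the eigenspace for -1 is
      -- zero.
      have : IsEmpty (Pairs 1) := ⟨fun a => absurd a.2 (by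
        rw [Subsingleton.elim a.1.1 a.1.2]; exact lt_irrefl _)⟩
      simp at h2
    · intro hn2 u
      have hu : u = minor ⟨n - 2, by omega⟩ ⟨n - 1, by omega⟩ := rfl
      have ha : (n - 2) + 2 = n := by omega
      have hb : (n - 1) + 1 = n := by omega
      have hm : u ∈ signPart n (-1) := minor_mem_signPart _ _
      have hu0 : u ≠ 0 := minor_ne_zero (by simp only [ne_eq, Fin.mk.injEq]; omega)
      have hε : (-1 : ℂ) ≠ 0 := by norm_num
      have g1 := polySubmodule_generated (n := n) one_ne_zero one_mem_signPart one_ne_zero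
      have g2 := polySubmodule_generated hε hm hu0
      refine ⟨?_, ?_, isIrrHighestWeight_minor ha hb,
        hasBasis_generated (by norm_num) odd_iff_neg_one_pow hm hu0⟩
      · apply polySubmodule_injective
        rw [polySubmodule_sup, g1, g2, polySubmodule_piece, signPart_sup]
      · rw [disjoint_iff, LieSubmodule.eq_bot_iff]
        intro x hx
        have h1 : (toOsc (initialIdx n n)).symm x ∈ signPart n 1 := by
          rw [← g1]; exact ((LieSubmodule.mem_inf _ _ _).mp hx).1
        have h2 : (toOsc (initialIdx n n)).symm x ∈ signPart n (-1) := by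
          rw [← g2]; exact ((LieSubmodule.mem_inf _ _ _).mp hx).2
        exact (LinearEquiv.map_eq_zero_iff _).mp (signPart_inter one_ne_zero h1 h2)
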